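/- Let $H$ be a complex Hilbert space and let $\mathcal N\subseteq B(H)$ be a von Neumann algebra with a faithful normal semifinite trace $\tau$ such that $\tau(1)=\infty$. Assume that either $\mathcal N$ is diffuse (it has no minimal projections) or $\mathcal N=B(H)$. For $A\in\mathcal N$ and $t\ge 0$ put $\mu(t,A)=\inf\{\|Ap\| : p\in\mathcal N \text{ a projection},\ \tau(1-p)\le t\}$, and let $$\mathcal M_{1,\infty}=\Big\{A\in\mathcal N:\ \sup_{t>0}\frac1{\log(1+t)}\int_0^t\mu(s,A)\,ds<\infty\Big\}.$$ Write $B\prec\prec A$ if $\int_0^t\mu(s,B)\,ds\le\int_0^t\mu(s,A)\,ds$ for all $t\ge0$. A linear functional $\varphi:\mathcal M_{1,\infty}\to\mathbb C$ is called fully symmetric if $\varphi(B)\le\varphi(A)$ for all positive $A,B\in\mathcal M_{1,\infty}$ with $B\prec\prec A$. A generalised limit is a linear functional $\omega:L_\infty(0,\infty)\to\mathbb R$ that is positive, satisfies $\omega(1)=1$, and vanishes on every $z$ with $\lim_{t\to\infty}z(t)=0$; it is dilation invariant if $\omega(z(\cdot/s))=\omega(z)$ for all $s>0$ and all $z\in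 L_\infty(0,\infty)$. Fix $0<q<\infty$ and put $(Mx)(t)=\frac1{\log t}\int_1^t x(s)\frac{ds}{s}$ for $t>0$. For a dilation invariant generalised limit $\omega$ and a positive $A\in\mathcal M_{1,\infty}$ set $$\xi_\omega(A)=\omega\Big(M\big(t\mapsto\tfrac1t\tau(\exp(-(tA)^{-q}))\big)\Big),\qquad \tau_\omega(A)=\omega\Big(t\mapsto\tfrac1{\log(1+t)}\int_0^t\mu(s,A)\,ds\Big),$$ where $\exp(-(tA)^{-q})=f(tA)$ with $f(u)=e^{-u^{-q}}$ for $u>0$ and $f(0)=0$. Extend both to $A\in\mathcal M_{1,\infty}$ by $\xi_\omega(A)=\xi_\omega((\Re A)_+)-\xi_\omega((\Re A)_-)+i\,(\xi_\omega((\Im A)_+)-\xi_\omega((\Im A)_-))$, and likewise for $\tau_\omega$ (the Dixmier traces). Then for every positive $A\in\mathcal M_{1,\infty}$ these expressions are well defined (the traces are finite, the integrals exist, and the functions to which $\omega$ is applied belong to $L_\infty(0,\infty)$). For a linear functional $\varphi:\mathcal M_{1,\infty}\to\mathbb C$ the following are equivalent: 1. $\varphi$ is fully symmetric; 2. there are a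 dilation invariant generalised limit $\omega$ and a constant $c\ge0$ with $\varphi=c\,\xi_\omega$ on $\mathcal M_{1,\infty}$; 3. there are a dilation invariant generalised limit $\omega$ and a constant $c\ge0$ with $\varphi=c\,\tau_\omega$ on $\mathcal M_{1,\infty}$. In particular, every fully symmetric functional on $\mathcal M_{1,\infty}$ is a constant multiple of $\xi_\omega$ for some dilation invariant generalised limit $\omega$. -/

import Mathlib

open MeasureTheory Set Filter Topology
open scoped ENNReal ComplexOrder ComplexStarModule

noncomputable section

namespace HeatKernel

/-- Lebesgue measure on the half-line `(0, ∞)`. -/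
abbrev halfLine : Measure ℝ := volume.restrict (Ioi (0 : ℝ))

/-- The real space `L_∞(0, ∞)`. -/
abbrev Linfty : Type := Lp ℝ ∞ halfLine

/-- The constant function `1` in `L_∞(0, ∞)`. -/
def oneLinfty : Linfty := (memLp_top_const (1 : ℝ) : MemLp (fun _ : ℝ => (1 : ℝ)) ∞ halfLine).toLp

/-- A generalised limit: a positive normalised linear functional on `L_∞(0, ∞)` that vanishes on
every `z` with `z(t) → 0` as `t → ∞` (for classes of functions: off a null set). -/
structure IsGeneralisedLimit (ω : Linfty →ₗ[ℝ] ℝ) : Prop where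
  nonneg : ∀ z : Linfty, 0 ≤ z → 0 ≤ ω z
  map_one : ω oneLinfty = 1
  map_null : ∀ z : Linfty, Tendsto z (atTop ⊓ ae halfLine) (𝓝 0) → ω z = 0

/-- Invariance under all dilations `(σ_s z)(t) = z(t / s)`, `s > 0`. -/
def IsDilationInvariant (ω : Linfty →ₗ[ℝ] ℝ) : Prop :=
  ∀ s : ℝ, 0 < s → ∀ z w : Linfty, (w =ᵐ[halfLine] fun t => z (t / s)) → ω w = ω z

open Classical in
/-- The value of `ω` at (the class of) a function `x` in `L_∞(0, ∞)`;
it is `0` if `x` is not essentially bounded and measurable. -/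
def evalAt (ω : Linfty →ₗ[ℝ] ℝ) (x : ℝ → ℝ) : ℝ :=
  if h : MemLp x ∞ halfLine then ω h.toLp else 0

/-- The Cesaro operator `(M x)(t) = (1 / log t) ∫_1^t x(s) ds / s`. -/
def cesaro (x : ℝ → ℝ) (t : ℝ) : ℝ := (1 / Real.log t) * ∫ s in (1 : ℝ)..t, x s / s

/-- The function `u ↦ exp(-u^{-q})` on `(0, ∞)`, extended continuously by `0`. -/
def heatFun (q u : ℝ) : ℝ := if 0 < u then Real.exp (-(u ^ (-q))) else 0

variable {H : Type*} [NormedAddCommGroup H] [InnerProductSpace ℂ H] [CompleteSpace H]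

/-- `τ`, restricted to the positive cone of `N`, is a faithful normal semifinite trace
with values in `[0, ∞]`. (The values of `τ` off this cone play no role.) -/
structure IsFNSTrace (N : VonNeumannAlgebra H) (τ : (H →L[ℂ] H) → ℝ≥0∞) : Prop where
  map_add : ∀ A ∈ N, ∀ B ∈ N, 0 ≤ A → 0 ≤ B → τ (A + B) = τ A + τ B
  map_smul : ∀ c : ℝ, 0 ≤ c → ∀ A ∈ N, 0 ≤ A → τ (c • A) = ENNReal.ofReal c * τ A
  tracial : ∀ A ∈ N, τ (star A * A) = τ (A * star A)
  faithful : ∀ A ∈ N, 0 ≤ A → τ A = 0 → A = 0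
  normal : ∀ S : Set (H →L[ℂ] H), S.Nonempty → (∀ A ∈ S, A ∈ N ∧ 0 ≤ A) →
    DirectedOn (· ≤ ·) S → ∀ A, IsLUB S A → IsLUB (τ '' S) (τ A)
  semifinite : ∀ A ∈ N, 0 ≤ A → A ≠ 0 → ∃ B ∈ N, 0 ≤ B ∧ B ≤ A ∧ B ≠ 0 ∧ τ B < ∞

/-- `N` is diffuse: it has no minimal projections. -/
def IsDiffuse (N : VonNeumannAlgebra H) : Prop :=
  ∀ p ∈ N, IsStarProjection p → p ≠ 0 → ∃ e ∈ N, IsStarProjection e ∧ e ≤ p ∧ e ≠ 0 ∧ e ≠ p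

/-- The generalised singular value function
`μ(t, A) = inf {‖A p‖ : p ∈ N a projection with τ(1 - p) ≤ t}`. -/
def singularValue (N : VonNeumannAlgebra H) (τ : (H →L[ℂ] H) → ℝ≥0∞)
    (A : H →L[ℂ] H) (t : ℝ) : ℝ :=
  sInf {r : ℝ | ∃ p ∈ N, IsStarProjection p ∧ τ (1 - p) ≤ ENNReal.ofReal t ∧ r = ‖A * p‖}

/-- The operator space `𝓜_{1,∞}(N, τ)`. -/
def marcinkiewicz (N : VonNeumannAlgebra H) (τ : (H →L[ℂ] H) → ℝ≥0∞) : Set (H →L[ℂ] H) :=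
  {A | A ∈ N ∧ ∃ K : ℝ, ∀ t : ℝ, 0 < t →
    (1 / Real.log (1 + t)) * ∫ s in (0 : ℝ)..t, singularValue N τ A s ≤ K}

/-- Hardy-Littlewood majorization `B ≺≺ A`. -/
def Majorized (N : VonNeumannAlgebra H) (τ : (H →L[ℂ] H) → ℝ≥0∞) (B A : H →L[ℂ] H) : Prop :=
  ∀ t : ℝ, 0 ≤ t →
    ∫ s in (0 : ℝ)..t, singularValue N τ B s ≤ ∫ s in (0 : ℝ)..t, singularValue N τ A s

/-- `φ`, restricted to the linear space `𝓜_{1,∞}(N, τ)`, is a complex linear functional.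
(The values of `φ` off this space play no role.) -/
structure IsLinearFunctional (N : VonNeumannAlgebra H) (τ : (H →L[ℂ] H) → ℝ≥0∞)
    (φ : (H →L[ℂ] H) → ℂ) : Prop where
  map_add : ∀ A ∈ marcinkiewicz N τ, ∀ B ∈ marcinkiewicz N τ, φ (A + B) = φ A + φ B
  map_smul : ∀ c : ℂ, ∀ A ∈ marcinkiewicz N τ, φ (c • A) = c * φ A

/-- `φ` is a fully symmetric functional on `𝓜_{1,∞}(N, τ)`. The inequality is the one of `ℂ`:
the difference of the two sides is a nonnegative real number. -/
structure IsFullySymmetric (N : VonNeumannAlgebra H) (τ : (H →L[ℂ] H) → ℝ≥0∞)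
    (φ : (H →L[ℂ] H) → ℂ) : Prop extends IsLinearFunctional N τ φ where
  mono : ∀ A ∈ marcinkiewicz N τ, ∀ B ∈ marcinkiewicz N τ, 0 ≤ A → 0 ≤ B →
    Majorized N τ B A → φ B ≤ φ A

/-- The operator `exp(-(t A)^{-q})` for positive `A`, by continuous functional calculus. -/
def heatOp (q : ℝ) (A : H →L[ℂ] H) (t : ℝ) : H →L[ℂ] H := cfc (heatFun q) (t • A)

/-- The heat kernel function `t ↦ (1 / t) τ(exp(-(t A)^{-q}))` of a positive operator `A`. -/
def heatTrace (τ : (H →L[ℂ] H) → ℝ≥0∞) (q : ℝ) (A : H →L[ℂ] H) (t : ℝ) : ℝ :=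
  (1 / t) * (τ (heatOp q A t)).toReal

/-- The function `t ↦ (1 / log(1 + t)) ∫_0^t μ(s, A) ds`. -/
def dixmierMean (N : VonNeumannAlgebra H) (τ : (H →L[ℂ] H) → ℝ≥0∞)
    (A : H →L[ℂ] H) (t : ℝ) : ℝ :=
  (1 / Real.log (1 + t)) * ∫ s in (0 : ℝ)..t, singularValue N τ A s

/-- The extension of a functional from positive operators to all operators by
`A = (Re A)_+ - (Re A)_- + i ((Im A)_+ - (Im A)_-)`. -/
def extend (f : (H →L[ℂ] H) → ℝ) (A : H →L[ℂ] H) : ℂ :=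
  ((f ((ℜ A : H →L[ℂ] H)⁺) - f ((ℜ A : H →L[ℂ] H)⁻) : ℝ) : ℂ) +
    Complex.I * ((f ((ℑ A : H →L[ℂ] H)⁺) - f ((ℑ A : H →L[ℂ] H)⁻) : ℝ) : ℂ)

/-- The heat kernel functional `ξ_ω(A) = (ω ∘ M)(t ↦ (1 / t) τ(exp(-(t A)^{-q})))` for positive
`A`, extended to all `A`. -/
def xi (τ : (H →L[ℂ] H) → ℝ≥0∞) (q : ℝ) (ω : Linfty →ₗ[ℝ] ℝ) : (H →L[ℂ] H) → ℂ :=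
  extend fun A => evalAt ω (cesaro (heatTrace τ q A))

/-- The functional `τ_ω(A) = ω(t ↦ (1 / log(1 + t)) ∫_0^t μ(s, A) ds)` for positive `A`,
extended to all `A`; for dilation invariant generalised limits `ω` these are the Dixmier traces. -/
def dixmierTrace (N : VonNeumannAlgebra H) (τ : (H →L[ℂ] H) → ℝ≥0∞) (ω : Linfty →ₗ[ℝ] ℝ) :
    (H →L[ℂ] H) → ℂ :=
  extend fun A => evalAt ω (dixmierMean N τ A)

/-- All the expressions that enter `ξ_ω(A)` and `τ_ω(A)` for a positive operator `A` make sense: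
the traces are finite, the integrals in the Cesaro mean exist, and the functions
to which `ω` is applied belong to `L_∞(0, ∞)`. -/
structure IsWellDefinedAt (N : VonNeumannAlgebra H) (τ : (H →L[ℂ] H) → ℝ≥0∞) (q : ℝ)
    (A : H →L[ℂ] H) : Prop where
  trace_lt_top : ∀ t : ℝ, 0 < t → τ (heatOp q A t) < ∞
  integrable : ∀ t : ℝ, 0 < t →
    IntervalIntegrable (fun s => heatTrace τ q A s / s) volume 1 t
  memLp_cesaro : MemLp (cesaro (heatTrace τ q A)) ∞ halfLine
  memLp_dixmierMean : MemLp (dixmierMean N τ A) ∞ halfLine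

end HeatKernel

end

noncomputable section

namespace HeatKernel

variable {H : Type*} [NormedAddCommGroup H] [InnerProductSpace ℂ H] [CompleteSpace H]

/-! ### Range projections and comparison of projections -/

/-! Write x = μ(·, A), f(u) = exp(-u^{-q}) and dν(r) = f'(r)/r dr. The trace of a positive operator
is the integral of its singular value function, and singular values commute with increasing
functions, so τ(f(sA)) = ∫ f(s x(u)) du: all quantities depend on A only through x. Since f(u) = ∫ r
1_{r<u} dν(r), Tonelli's theorem gives ∫_0^t s^{-2} τ(f(sA)) ds = ∫ E(x, r/t) dν(r), where E(x, c) =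
∫ (x(u) - c)_+ du (`lintegral_heatCount`). Call this function of t the level integral Ψ_x. Up to
O(1/log t) the Cesaro mean of the heat kernel function is Ψ_x(t)/log t. As E(x, c) is the supremum
over a ≥ 0 of ∫_0^a x - ca, it increases under Hardy-Littlewood majorization. Hence a linear
functional of the form cξ_ω or cτ_ω is fully symmetric.

For the converse, the assumption on N supplies an infinite orthogonal sequence of projections of one
common finite trace, and with it diagonal operators with prescribed step functions as singular
values. A fully symmetric φ vanishes on finite sums of these projections, by comparison with the
harmonic sequence, and is therefore insensitive to shifts and bounded errors. It follows that on
positive operators φ(A) = Λ(μ(·, A)) for an additive Λ which is monotone for comparison of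
primitives up to a dilation t ↦ nt, an error ε log(1+t) and a constant
(`IsFullySymmetric.exists_symmetricFunctional`).

Both ∫_0^t x and Ψ_x(t) are additive in x up to dilations of t, and both determine the order seen by
Λ; for Ψ this is `IsLevelWeight.exists_integral_le`. The structure `IsGrowthModel` records these
properties of a growth function N_x(t), and `IsGrowthModel.exists_generalisedLimit` derives ω from
them. To z in L_∞ is assigned the infimum of Λx - Λy over all x, y such that z is asymptotically at
most (N_x(Rt) - N_y(t/R))/log t for some R, modulo differences of dilates. This is sublinear, and a
linear functional below it is, after normalisation, a dilation invariant generalised limit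
recovering Λ. The point to check is that the infimum at z = 0 is not negative: averaging over [t,
nt] against ds/s, an integral to which differences of dilates contribute only boundedly, removes
them and leaves a comparison of N_y with N_x. The two growth functions give the two representations.
If Λ vanishes at 1/(1+t), then φ = 0 and c = 0 serves. -/

lemma mul_apply_vec (S T : H →L[ℂ] H) (v : H) : (S * T) v = S (T v) := rfl

/-- The orthogonal projection onto the closure of the range of `X`. -/
def rangeProj (X : H →L[ℂ] H) : H →L[ℂ] H := X.range.topologicalClosure.starProjection

lemma isStarProjection_rangeProj (X : H →L[ℂ] H) : IsStarProjection (rangeProj X) :=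
  isStarProjection_starProjection

lemma rangeProj_apply_eq_self_iff {X : H →L[ℂ] H} {v : H} :
    rangeProj X v = v ↔ v ∈ closure (Set.range X) := by
  rw [rangeProj, Submodule.starProjection_eq_self_iff, ← SetLike.mem_coe,
    Submodule.topologicalClosure_coe]
  rfl

lemma rangeProj_mul_self (X : H →L[ℂ] H) : rangeProj X * X = X := by
  ext v
  exact rangeProj_apply_eq_self_iff.2 (subset_closure ⟨v, rfl⟩)

lemma mul_rangeProj_eq_zero {X Y : H →L[ℂ] H} (h : Y * X = 0) : Y * rangeProj X = 0 := by
  ext v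
  have hv : rangeProj X v ∈ closure (Set.range X) :=
    rangeProj_apply_eq_self_iff.1 (by
      have := (isStarProjection_rangeProj X).isIdempotentElem
      exact congrArg (fun T : H →L[ℂ] H => T v) this)
  have hc : closure (Set.range X) ⊆ {w | Y w = 0} := by
    refine closure_minimal ?_ (isClosed_eq Y.continuous continuous_const)
    rintro _ ⟨w, rfl⟩
    exact congrArg (fun T : H →L[ℂ] H => T w) h
  exact hc hv

lemma rangeProj_le {X p : H →L[ℂ] H} (hp : IsStarProjection p) (h : p * X = X) :
    rangeProj X ≤ p := by
  rw [(isStarProjection_rangeProj X).le_iff_mul_eq_right hp]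
  have : (1 - p) * rangeProj X = 0 := mul_rangeProj_eq_zero (by rw [sub_mul, h, one_mul, sub_self])
  rw [sub_mul, one_mul, sub_eq_zero] at this
  exact this.symm

/-- An element of the commutant commutes with X, so it leaves the range of X and its closure
invariant. A projection whose range is invariant under the commutant belongs to N. -/
lemma rangeProj_mem {N : VonNeumannAlgebra H} {X : H →L[ℂ] H} (hX : X ∈ N) : rangeProj X ∈ N := by
  rw [VonNeumannAlgebra.IsStarProjection.mem_iff (isStarProjection_rangeProj X)]
  intro y hy
  rw [rangeProj, Submodule.range_starProjection, Module.End.mem_invtSubmodule]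
  intro v hv
  rw [Submodule.mem_comap]
  rw [← SetLike.mem_coe, Submodule.topologicalClosure_coe] at hv ⊢
  refine map_mem_closure y.continuous hv ?_
  rintro _ ⟨w, rfl⟩
  refine ⟨y w, ?_⟩
  have := VonNeumannAlgebra.mem_commutant_iff.1 hy X hX
  exact congrArg (fun T : H →L[ℂ] H => T w) this

lemma isClosed_vonNeumannAlgebra (N : VonNeumannAlgebra H) : IsClosed (N : Set (H →L[ℂ] H)) := by
  rw [← N.centralizer_centralizer]
  exact Set.isClosed_centralizer _

lemma cfc_mem_vonNeumannAlgebra {N : VonNeumannAlgebra H} {A : H →L[ℂ] H} (hA : A ∈ N)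
    (f : ℝ → ℝ) : cfc f A ∈ N := by
  have : IsClosed (N.toStarSubalgebra : Set (H →L[ℂ] H)) := isClosed_vonNeumannAlgebra N
  exact cfc_mem (𝕜' := ℂ) (s := N.toStarSubalgebra) f hA

lemma real_smul_mem {N : VonNeumannAlgebra H} {A : H →L[ℂ] H} (hA : A ∈ N) (c : ℝ) :
    c • A ∈ N := by
  have := N.toStarSubalgebra.smul_mem hA (c : ℂ)
  rwa [Complex.coe_smul] at this

lemma complex_smul_mem {N : VonNeumannAlgebra H} {A : H →L[ℂ] H} (hA : A ∈ N) (c : ℂ) :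
    c • A ∈ N := N.toStarSubalgebra.smul_mem hA c

/-- Positivity is preserved by limits in the strong operator topology. -/
lemma nonneg_of_tendsto_apply {ι : Type*} {l : Filter ι} [l.NeBot] {T : ι → H →L[ℂ] H}
    {S : H →L[ℂ] H} (hT : ∀ i, 0 ≤ T i) (h : ∀ v, Tendsto (fun i => T i v) l (𝓝 (S v))) :
    0 ≤ S := by
  rw [ContinuousLinearMap.nonneg_iff_isPositive, ContinuousLinearMap.isPositive_iff']
  have key : ∀ v, 0 ≤ inner ℂ (S v) v := by
    intro v
    refine ge_of_tendsto' ((h v).inner tendsto_const_nhds) fun i => ?_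
    exact ((ContinuousLinearMap.nonneg_iff_isPositive _).1 (hT i)).inner_nonneg_left v
  refine ⟨?_, key⟩
  have : S.IsPositive := by
    rw [ContinuousLinearMap.isPositive_iff_complex]
    intro v
    have := key v
    rw [Complex.nonneg_iff] at this
    exact ⟨Complex.ext (by simp) (by simpa using this.2), this.1⟩
  exact this.isSelfAdjoint

lemma mul_mul_self_le_of_le_one {h e : H →L[ℂ] H} (he : IsStarProjection e) (h1 : h ≤ 1)
    (hl : e * h * e = h) : h ≤ e := by
  have := he.isSelfAdjoint.conjugate_le_conjugate h1
  rwa [hl, mul_one, he.isIdempotentElem.eq] at this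

/-- If e fixes the range of X*X, then (1-e)X*X(1-e) = 0, and the C*-identity turns this into X(1-e)
= 0. -/
lemma rangeProj_star_mul_self (X : H →L[ℂ] H) : rangeProj (star X * X) = rangeProj (star X) := by
  apply le_antisymm
  · apply rangeProj_le (isStarProjection_rangeProj _)
    rw [← mul_assoc, rangeProj_mul_self]
  · apply rangeProj_le (isStarProjection_rangeProj _)
    set e := rangeProj (star X * X) with he
    have hs : star e = e := (isStarProjection_rangeProj _).isSelfAdjoint
    have h1 : e * (star X * X) = star X * X := rangeProj_mul_self _
    have h2 : X * (1 - e) = 0 := by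
      rw [← CStarRing.star_mul_self_eq_zero_iff]
      have : e * star X * X = star X * X := by rw [mul_assoc, h1]
      rw [star_mul, star_sub, star_one, hs]
      simp only [sub_mul, mul_sub, ← mul_assoc, one_mul, mul_one, this]
      abel
    have h3 := congrArg star h2
    rw [star_mul, star_sub, star_one, hs, star_zero, sub_mul, one_mul, sub_eq_zero] at h3
    exact h3.symm

/-- The regularisation `u ↦ u / (|u| + ε)` of the indicator function of `(0, ∞)`. -/
def regSupport (ε u : ℝ) : ℝ := u / (|u| + ε)

lemma continuous_regSupport {ε : ℝ} (hε : 0 < ε) : Continuous (regSupport ε) := by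
  unfold regSupport
  refine continuous_id.div (by fun_prop) fun u => ?_
  positivity

/-- The operators are contractions, vanish on the orthogonal complement of the range, and move Ty by
at most ε‖y‖ because |u²/(u+ε) - u| ≤ ε for u ≥ 0. Density of the range does the rest. This exhibits
the range projection as a strong limit of functions of T. -/
lemma tendsto_regSupport_apply {T : H →L[ℂ] H} (hT : 0 ≤ T) (v : H) :
    Tendsto (fun n : ℕ => cfc (regSupport (1 / (n + 1 : ℝ))) T v) atTop (𝓝 (rangeProj T v)) := by
  have hsa : IsSelfAdjoint T := hT.isSelfAdjoint
  have hpos : ∀ n : ℕ, (0 : ℝ) < 1 / (n + 1 : ℝ) := fun n => by positivity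
  have hcont : ∀ n : ℕ, Continuous (regSupport (1 / (n + 1 : ℝ))) :=
    fun n => continuous_regSupport (hpos n)
  set e := rangeProj T with he
  have hs : star e = e := (isStarProjection_rangeProj _).isSelfAdjoint
  have hnorm : ∀ n : ℕ, ‖cfc (regSupport (1 / (n + 1 : ℝ))) T‖ ≤ 1 := fun n => by
    refine norm_cfc_le zero_le_one fun x _ => ?_
    rw [regSupport, Real.norm_eq_abs, abs_div, abs_of_pos (a := |x| + _) (by have := hpos n; positivity)]
    rw [div_le_one (by have := hpos n; positivity)]
    linarith [hpos n]
  have hTe : T * (1 - e) = 0 := by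
    have := congrArg star (rangeProj_mul_self T)
    rw [star_mul, ← he, hs, hsa.star_eq] at this
    rw [mul_sub, this, mul_one, sub_self]
  have hmulT : ∀ n : ℕ, ∃ B : H →L[ℂ] H, cfc (regSupport (1 / (n + 1 : ℝ))) T = B * T := fun n => by
    refine ⟨cfc (fun u : ℝ => 1 / (|u| + 1 / (n + 1 : ℝ))) T, ?_⟩
    have hc : Continuous fun u : ℝ => 1 / (|u| + 1 / (n + 1 : ℝ)) := by
      refine continuous_const.div (by fun_prop) fun u => ?_
      have := hpos n; positivity
    nth_rw 3 [← cfc_id' ℝ T]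
    rw [← cfc_mul _ _ T hc.continuousOn]
    refine cfc_congr fun x _ => ?_
    simp only [regSupport]
    ring
  have hz : ∀ n : ℕ, cfc (regSupport (1 / (n + 1 : ℝ))) T * (1 - e) = 0 := fun n => by
    obtain ⟨B, hB⟩ := hmulT n
    rw [hB, mul_assoc, hTe, mul_zero]
  have hdense : ∀ w ∈ closure (Set.range T),
      Tendsto (fun n : ℕ => cfc (regSupport (1 / (n + 1 : ℝ))) T w) atTop (𝓝 w) := by
    intro w hw
    rw [Metric.tendsto_atTop]
    intro ε hε
    obtain ⟨_, ⟨y, rfl⟩, hy⟩ := Metric.mem_closure_iff.1 hw (ε / 3) (by positivity)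
    obtain ⟨n₀, hn₀⟩ := exists_nat_gt (3 * (‖y‖ + 1) / ε)
    refine ⟨n₀, fun n hn => ?_⟩
    have hb : ‖cfc (regSupport (1 / (n + 1 : ℝ))) T (T y) - T y‖ ≤ 1 / (n + 1 : ℝ) * ‖y‖ := by
      have h1 : cfc (regSupport (1 / (n + 1 : ℝ))) T * T - T
          = cfc (fun u : ℝ => regSupport (1 / (n + 1 : ℝ)) u * u - u) T := by
        have hc : Continuous fun u : ℝ => regSupport (1 / (n + 1 : ℝ)) u * u :=
          (hcont n).mul continuous_id
        rw [cfc_sub (fun u : ℝ => regSupport (1 / (n + 1 : ℝ)) u * u) (fun u => u) T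
            hc.continuousOn continuous_id.continuousOn,
          cfc_mul (regSupport (1 / (n + 1 : ℝ))) (fun u => u) T (hcont n).continuousOn
            continuous_id.continuousOn, cfc_id' ℝ T]
      have h2 : ‖cfc (fun u : ℝ => regSupport (1 / (n + 1 : ℝ)) u * u - u) T‖ ≤ 1 / (n + 1 : ℝ) := by
        refine norm_cfc_le (hpos n).le fun x hx => ?_
        have hx0 : 0 ≤ x := spectrum_nonneg_of_nonneg hT hx
        have hp := hpos n
        have : regSupport (1 / (n + 1 : ℝ)) x * x - x
            = -(1 / (n + 1 : ℝ) * (x / (x + 1 / (n + 1 : ℝ)))) := by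
          rw [regSupport, abs_of_nonneg hx0]
          have : x + 1 / (n + 1 : ℝ) ≠ 0 := by positivity
          field_simp
          ring
        rw [this, norm_neg, Real.norm_eq_abs, abs_of_nonneg (by positivity)]
        refine mul_le_of_le_one_right hp.le ?_
        rw [div_le_one (by positivity)]
        linarith
      have h3 : cfc (regSupport (1 / (n + 1 : ℝ))) T (T y) - T y
          = (cfc (regSupport (1 / (n + 1 : ℝ))) T * T - T) y := rfl
      rw [h3, h1]
      exact (ContinuousLinearMap.le_opNorm _ _).trans
        (mul_le_mul_of_nonneg_right h2 (norm_nonneg y))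
    have hb2 : ‖cfc (regSupport (1 / (n + 1 : ℝ))) T (w - T y)‖ ≤ ‖w - T y‖ :=
      ((ContinuousLinearMap.le_opNorm _ _).trans
        (mul_le_mul_of_nonneg_right (hnorm n) (norm_nonneg _))).trans (one_mul _).le
    have hb3 : 1 / (n + 1 : ℝ) * ‖y‖ < ε / 3 := by
      rw [div_mul_eq_mul_div, one_mul, div_lt_iff₀ (by positivity)]
      rw [div_lt_iff₀ hε] at hn₀
      have : (n₀ : ℝ) ≤ n := by exact_mod_cast hn
      nlinarith [norm_nonneg y]
    rw [dist_eq_norm] at hy ⊢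
    have h4 : cfc (regSupport (1 / (n + 1 : ℝ))) T w - w
        = cfc (regSupport (1 / (n + 1 : ℝ))) T (w - T y)
          + (cfc (regSupport (1 / (n + 1 : ℝ))) T (T y) - T y) - (w - T y) := by
      rw [map_sub]; abel
    rw [h4]
    calc _ ≤ ‖cfc (regSupport (1 / (n + 1 : ℝ))) T (w - T y)‖
          + ‖cfc (regSupport (1 / (n + 1 : ℝ))) T (T y) - T y‖ + ‖w - T y‖ :=
        (norm_sub_le _ _).trans (add_le_add (norm_add_le _ _) le_rfl)
      _ < ε := by linarith
  have hev : e v ∈ closure (Set.range T) := rangeProj_apply_eq_self_iff.1 (by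
      have := (isStarProjection_rangeProj T).isIdempotentElem
      exact congrArg (fun T : H →L[ℂ] H => T v) this)
  refine (hdense _ hev).congr fun n => ?_
  have := congrArg (fun T : H →L[ℂ] H => T v) (hz n)
  simp only [mul_apply_vec, sub_apply,
    one_apply_eq_self, map_sub, zero_apply] at this
  exact (sub_eq_zero.1 this).symm

/-! ### Traces of range projections and relative position of projections -/

section Trace

variable {N : VonNeumannAlgebra H} {τ : (H →L[ℂ] H) → ℝ≥0∞}

lemma IsFNSTrace.map_zero (hτ : IsFNSTrace N τ) : τ 0 = 0 := by
  have := hτ.map_smul 0 le_rfl 0 (zero_mem N) le_rfl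
  simpa using this

lemma IsFNSTrace.mono (hτ : IsFNSTrace N τ) {A B : H →L[ℂ] H} (hA : A ∈ N) (hB : B ∈ N)
    (h0 : 0 ≤ A) (h : A ≤ B) : τ A ≤ τ B := by
  have := hτ.map_add A hA (B - A) (sub_mem hB hA) h0 (sub_nonneg.2 h)
  rw [add_sub_cancel] at this
  rw [this]
  exact le_self_add

/-- A replacement for the polar decomposition: the range projection of X* is the increasing limit of
operators Y*Y with Y = X g(X*X). Traciality gives τ(Y*Y) = τ(YY*), the operator YY* lies below the
range projection of X, and normality passes to the limit. -/
lemma IsFNSTrace.rangeProj_star_le (hτ : IsFNSTrace N τ) {X : H →L[ℂ] H} (hX : X ∈ N) :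
    τ (rangeProj (star X)) ≤ τ (rangeProj X) := by
  set T := star X * X with hTdef
  have hTN : T ∈ N := mul_mem (star_mem hX) hX
  have hT : 0 ≤ T := star_mul_self_nonneg X
  have hsa : IsSelfAdjoint T := hT.isSelfAdjoint
  rw [← rangeProj_star_mul_self]
  have hpos : ∀ n : ℕ, (0 : ℝ) < 1 / (n + 1 : ℝ) := fun n => by positivity
  have hcont : ∀ n : ℕ, Continuous (regSupport (1 / (n + 1 : ℝ))) :=
    fun n => continuous_regSupport (hpos n)
  let h : ℕ → H →L[ℂ] H := fun n => cfc (regSupport (1 / (n + 1 : ℝ))) T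
  have hmono : Monotone h := by
    intro m n hmn
    refine cfc_mono (fun x hx => ?_) (hcont m).continuousOn (hcont n).continuousOn
    have hx0 : 0 ≤ x := spectrum_nonneg_of_nonneg hT hx
    simp only [regSupport, abs_of_nonneg hx0]
    have := hpos n
    gcongr
  have h0 : ∀ n, 0 ≤ h n := fun n => cfc_nonneg fun x hx => by
    have hx0 : 0 ≤ x := spectrum_nonneg_of_nonneg hT hx
    have := hpos n
    rw [regSupport]; positivity
  have hlub : IsLUB (Set.range h) (rangeProj T) := by
    constructor
    · rintro _ ⟨n, rfl⟩
      rw [← sub_nonneg]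
      refine nonneg_of_tendsto_apply (l := atTop) (T := fun m => h (max m n) - h n)
        (fun m => sub_nonneg.2 (hmono (le_max_right m n))) fun v => ?_
      simp only [sub_apply]
      refine Tendsto.sub ?_ tendsto_const_nhds
      exact (tendsto_regSupport_apply hT v).comp
        (tendsto_atTop_mono (fun m => le_max_left m n) tendsto_id)
    · intro C hC
      rw [← sub_nonneg]
      refine nonneg_of_tendsto_apply (l := atTop) (T := fun m => C - h m)
        (fun m => sub_nonneg.2 (hC ⟨m, rfl⟩)) fun v => ?_
      exact Tendsto.sub tendsto_const_nhds (tendsto_regSupport_apply hT v)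
  have := hτ.normal (Set.range h) (Set.range_nonempty h)
    (by rintro _ ⟨n, rfl⟩; exact ⟨cfc_mem_vonNeumannAlgebra hTN _, h0 n⟩)
    hmono.directed_le.directedOn_range _ hlub
  refine this.2 ?_
  rintro _ ⟨_, ⟨n, rfl⟩, rfl⟩
  -- With this square root, Y*Y = g(T) T g(T) is exactly the n-th regularised support of T = X*X.
  let g : ℝ → ℝ := fun u => Real.sqrt (1 / (|u| + 1 / (n + 1 : ℝ)))
  have hg : Continuous g := by
    refine Real.continuous_sqrt.comp (continuous_const.div (by fun_prop) fun u => ?_)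
    have := hpos n; positivity
  have hgT : cfc g T ∈ N := cfc_mem_vonNeumannAlgebra hTN _
  have hgs : star (cfc g T) = cfc g T := (cfc_predicate g T : IsSelfAdjoint _)
  set Y := X * cfc g T with hY
  have hYN : Y ∈ N := mul_mem hX hgT
  have hYY : star Y * Y = h n := by
    rw [hY, star_mul, hgs]
    have : cfc g T * star X * (X * cfc g T) = cfc g T * T * cfc g T := by
      simp only [hTdef, mul_assoc]
    rw [this]
    have hid : T = cfc (fun u : ℝ => u) T := (cfc_id' ℝ T).symm
    have hc : Continuous fun u : ℝ => g u * u := hg.mul continuous_id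
    nth_rw 2 [hid]
    rw [← cfc_mul g (fun u => u) T hg.continuousOn continuous_id.continuousOn,
      ← cfc_mul (fun u => g u * u) g T hc.continuousOn hg.continuousOn]
    refine cfc_congr fun x _ => ?_
    have hp : 0 ≤ 1 / (|x| + 1 / (n + 1 : ℝ)) := by have := hpos n; positivity
    simp only [g, regSupport]
    rw [mul_right_comm, Real.mul_self_sqrt hp]
    ring
  rw [← hYY, hτ.tracial Y hYN]
  refine hτ.mono (mul_mem hYN (star_mem hYN)) (rangeProj_mem hX) (mul_star_self_nonneg Y) ?_
  apply mul_mul_self_le_of_le_one (isStarProjection_rangeProj X)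
  · have hn : ‖Y‖ ≤ 1 := by
      have h1 : ‖h n‖ ≤ 1 := norm_cfc_le zero_le_one fun x _ => by
        rw [regSupport, Real.norm_eq_abs, abs_div,
          abs_of_pos (a := |x| + _) (by have := hpos n; positivity)]
        rw [div_le_one (by have := hpos n; positivity)]
        linarith [hpos n]
      rw [← hYY, CStarRing.norm_star_mul_self] at h1
      nlinarith [norm_nonneg Y]
    have h2 : ‖Y * star Y‖ ≤ 1 := by
      rw [CStarRing.norm_self_mul_star]
      nlinarith [norm_nonneg Y]
    exact (CStarAlgebra.norm_le_one_iff_of_nonneg _ (mul_star_self_nonneg Y)).1 h2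
  · have h1 : rangeProj X * Y = Y := by rw [hY, ← mul_assoc, rangeProj_mul_self]
    have h2 : star Y * rangeProj X = star Y := by
      have := congrArg star h1
      rwa [star_mul, (isStarProjection_rangeProj X).isSelfAdjoint.star_eq] at this
    rw [← mul_assoc, h1, mul_assoc, h2]

lemma IsFNSTrace.rangeProj_star (hτ : IsFNSTrace N τ) {X : H →L[ℂ] H} (hX : X ∈ N) :
    τ (rangeProj (star X)) = τ (rangeProj X) :=
  le_antisymm (hτ.rangeProj_star_le hX) (by simpa using hτ.rangeProj_star_le (star_mem hX))

/-- Two projections whose traces leave no room for a disjoint position have a common vector. -/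
lemma IsFNSTrace.exists_common_vector (hτ : IsFNSTrace N τ) {e p : H →L[ℂ] H} (heN : e ∈ N)
    (hpN : p ∈ N) (he : IsStarProjection e) (hp : IsStarProjection p) (h : τ (1 - p) < τ e) :
    ∃ v : H, v ≠ 0 ∧ e v = v ∧ p v = v := by
  by_contra! hcon
  refine absurd h (not_lt.2 ?_)
  -- The range of X lies under 1 - p. Without a common vector X is injective on the range of e, so e
  -- is below the range projection of X*. Equality of the traces of the two range projections then
  -- contradicts `h`.
  set X := (1 - p) * e with hX
  have hXN : X ∈ N := mul_mem (sub_mem (one_mem N) hpN) heN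
  have h1 : rangeProj X ≤ 1 - p := rangeProj_le hp.one_sub (by
    rw [hX, ← mul_assoc, hp.one_sub.isIdempotentElem.eq])
  have h2 : e ≤ rangeProj (star X) := by
    rw [he.le_iff_mul_eq_left (isStarProjection_rangeProj _)]
    set f := rangeProj (star X) with hf
    have hfs : star f = f := (isStarProjection_rangeProj _).isSelfAdjoint
    have h3 : X * (1 - f) = 0 := by
      have := congrArg star (rangeProj_mul_self (star X))
      rw [star_mul, star_star, ← hf, hfs] at this
      rw [mul_sub, mul_one, this, sub_self]
    have hef : e * f = f * e := by
      have : f ≤ e := rangeProj_le he (by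
        rw [hX, star_mul, he.isSelfAdjoint.star_eq, ← mul_assoc, he.isIdempotentElem.eq])
      exact ((isStarProjection_rangeProj _).commute_of_le he this).eq.symm
    ext v
    have h4 := congrArg (fun T : H →L[ℂ] H => T (e v)) h3
    simp only [hX, mul_apply_vec, sub_apply,
      one_apply_eq_self, zero_apply] at h4
    have h5 : e (e v - f (e v)) = e v - f (e v) := by
      have h6 := congrArg (fun T : H →L[ℂ] H => T (e v)) hef
      have h7 := congrArg (fun T : H →L[ℂ] H => T v) he.isIdempotentElem.eq
      simp only [mul_apply_vec] at h6 h7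
      rw [map_sub, h6, h7]
    rw [h5] at h4
    have h8 := hcon (e v - f (e v))
    have h9 : e v - f (e v) = 0 := by
      by_contra hne
      exact h8 hne h5 (sub_eq_zero.1 h4).symm
    have h10 := congrArg (fun T : H →L[ℂ] H => T v) hef
    simp only [mul_apply_vec] at h10 ⊢
    rw [h10]
    exact (sub_eq_zero.1 h9).symm
  calc τ e ≤ τ (rangeProj (star X)) := hτ.mono heN (rangeProj_mem (star_mem hXN)) he.nonneg h2
    _ = τ (rangeProj X) := hτ.rangeProj_star hXN
    _ ≤ τ (1 - p) := hτ.mono (rangeProj_mem hXN) (sub_mem (one_mem N) hpN)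
        (isStarProjection_rangeProj X).nonneg h1

/-- A projection dominating two given projections, with the trace at most the sum of traces. -/
lemma IsFNSTrace.exists_join (hτ : IsFNSTrace N τ) {e f : H →L[ℂ] H} (heN : e ∈ N) (hfN : f ∈ N)
    (he : IsStarProjection e) (hf : IsStarProjection f) :
    ∃ r ∈ N, IsStarProjection r ∧ r * e = e ∧ r * f = f ∧ τ r ≤ τ e + τ f := by
  -- The join is f + g with g the range projection of (1-f)e. The trace of g equals that of the
  -- range projection of X*, which lies under e.
  set X := (1 - f) * e with hX
  have hXN : X ∈ N := mul_mem (sub_mem (one_mem N) hfN) heN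
  set g := rangeProj X with hg
  have hgp : IsStarProjection g := isStarProjection_rangeProj X
  have hg1 : g ≤ 1 - f := rangeProj_le hf.one_sub (by
    rw [hX, ← mul_assoc, hf.one_sub.isIdempotentElem.eq])
  have hfg : g * f = 0 := by
    have := (hgp.le_iff_mul_eq_left hf.one_sub).1 hg1
    rw [mul_sub, mul_one] at this
    simpa using this
  have hgf : f * g = 0 := by
    have := congrArg star hfg
    rwa [star_mul, hgp.isSelfAdjoint.star_eq, hf.isSelfAdjoint.star_eq, star_zero] at this
  refine ⟨f + g, add_mem hfN (rangeProj_mem hXN), ?_, ?_, ?_, ?_⟩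
  · refine ⟨?_, hf.isSelfAdjoint.add hgp.isSelfAdjoint⟩
    rw [IsIdempotentElem, add_mul, mul_add, mul_add, hfg, hgf, hf.isIdempotentElem.eq,
      hgp.isIdempotentElem.eq, add_zero, zero_add]
  · have h1 : g * e = g * X := by
      rw [hX, sub_mul, one_mul, mul_sub, ← mul_assoc, hfg, zero_mul, sub_zero]
    rw [add_mul, h1, hg, rangeProj_mul_self, hX, sub_mul, one_mul, add_sub_cancel]
  · rw [add_mul, hfg, hf.isIdempotentElem.eq, add_zero]
  · rw [hτ.map_add f hfN g (rangeProj_mem hXN) hf.nonneg hgp.nonneg, add_comm]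
    gcongr
    rw [hg, ← hτ.rangeProj_star hXN]
    refine hτ.mono (rangeProj_mem (star_mem hXN)) heN (isStarProjection_rangeProj _).nonneg ?_
    apply rangeProj_le he
    rw [hX, star_mul, he.isSelfAdjoint.star_eq, ← mul_assoc, he.isIdempotentElem.eq]

end Trace

section SingularValue

variable {N : VonNeumannAlgebra H} {τ : (H →L[ℂ] H) → ℝ≥0∞}

/-! ### Elementary properties of singular value functions -/

lemma singularValue_bddBelow (N : VonNeumannAlgebra H) (τ : (H →L[ℂ] H) → ℝ≥0∞)
    (A : H →L[ℂ] H) (t : ℝ) :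
    BddBelow {r : ℝ | ∃ p ∈ N, IsStarProjection p ∧ τ (1 - p) ≤ ENNReal.ofReal t ∧ r = ‖A * p‖} :=
  ⟨0, by rintro _ ⟨p, _, _, _, rfl⟩; exact norm_nonneg _⟩

lemma singularValue_nonneg (N : VonNeumannAlgebra H) (τ : (H →L[ℂ] H) → ℝ≥0∞)
    (A : H →L[ℂ] H) (t : ℝ) : 0 ≤ singularValue N τ A t :=
  Real.sInf_nonneg (by rintro _ ⟨p, _, _, _, rfl⟩; exact norm_nonneg _)

lemma singularValue_le_norm_mul {A p : H →L[ℂ] H} {t : ℝ} (hpN : p ∈ N) (hp : IsStarProjection p)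
    (h : τ (1 - p) ≤ ENNReal.ofReal t) : singularValue N τ A t ≤ ‖A * p‖ :=
  csInf_le (singularValue_bddBelow N τ A t) ⟨p, hpN, hp, h, rfl⟩

lemma IsFNSTrace.singularValue_set_nonempty (hτ : IsFNSTrace N τ) (A : H →L[ℂ] H) (t : ℝ) :
    {r : ℝ | ∃ p ∈ N, IsStarProjection p ∧ τ (1 - p) ≤ ENNReal.ofReal t ∧
      r = ‖A * p‖}.Nonempty :=
  ⟨_, 1, one_mem N, .one _, by rw [sub_self, hτ.map_zero]; exact zero_le, rfl⟩

lemma IsFNSTrace.le_singularValue (hτ : IsFNSTrace N τ) {A : H →L[ℂ] H} {t r : ℝ}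
    (h : ∀ p ∈ N, IsStarProjection p → τ (1 - p) ≤ ENNReal.ofReal t → r ≤ ‖A * p‖) :
    r ≤ singularValue N τ A t :=
  le_csInf (hτ.singularValue_set_nonempty A t) (by
    rintro _ ⟨p, hpN, hp, hpt, rfl⟩; exact h p hpN hp hpt)

lemma IsFNSTrace.exists_of_singularValue_lt (hτ : IsFNSTrace N τ) {A : H →L[ℂ] H} {t s : ℝ}
    (h : singularValue N τ A t < s) :
    ∃ p ∈ N, IsStarProjection p ∧ τ (1 - p) ≤ ENNReal.ofReal t ∧ ‖A * p‖ < s := by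
  obtain ⟨_, ⟨p, hpN, hp, hpt, rfl⟩, hr⟩ :=
    exists_lt_of_csInf_lt (hτ.singularValue_set_nonempty A t) h
  exact ⟨p, hpN, hp, hpt, hr⟩

lemma IsFNSTrace.singularValue_antitone (hτ : IsFNSTrace N τ) (A : H →L[ℂ] H) :
    Antitone (singularValue N τ A) := fun _ _ hst =>
  hτ.le_singularValue fun _ hpN hp hpt =>
    singularValue_le_norm_mul hpN hp (hpt.trans (ENNReal.ofReal_le_ofReal hst))

lemma IsFNSTrace.singularValue_le_norm (hτ : IsFNSTrace N τ) (A : H →L[ℂ] H) (t : ℝ) :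
    singularValue N τ A t ≤ ‖A‖ := by
  have := singularValue_le_norm_mul (N := N) (τ := τ) (A := A) (t := t) (one_mem N) (.one _)
    (by rw [sub_self, hτ.map_zero]; exact zero_le)
  rwa [mul_one] at this

/-! ### Spectral projections -/

lemma norm_apply_le_of_star_mul_self_le {S T : H →L[ℂ] H} (h : star S * S ≤ star T * T) (v : H) :
    ‖S v‖ ≤ ‖T v‖ := by
  have h1 : ∀ R : H →L[ℂ] H, (inner ℂ ((star R * R) v) v).re = ‖R v‖ ^ 2 := fun R => by
    rw [mul_apply_vec, ContinuousLinearMap.star_eq_adjoint,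
      ContinuousLinearMap.adjoint_inner_left, inner_self_eq_norm_sq_to_K]
    norm_cast
  have h2 := ((ContinuousLinearMap.le_def _ _).1 h).re_inner_nonneg_left v
  rw [sub_apply, inner_sub_left, map_sub] at h2
  have h3 : ‖S v‖ ^ 2 ≤ ‖T v‖ ^ 2 := by
    rw [← h1, ← h1]
    exact sub_nonneg.1 h2
  exact le_of_sq_le_sq h3 (norm_nonneg _)

/-- On the closure of the range of `h(A)`, the operator `k(A)` is bounded below by any bound for
`|k|` from below on the set where `h` does not vanish. -/
lemma le_norm_cfc_apply {A : H →L[ℂ] H} {h k : ℝ → ℝ} {r : ℝ} (hr : 0 ≤ r)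
    (hh : Continuous h) (hk : Continuous k)
    (hhk : ∀ x ∈ spectrum ℝ A, h x ≠ 0 → r ≤ |k x|) {v : H}
    (hv : rangeProj (cfc h A) v = v) : r * ‖v‖ ≤ ‖cfc k A v‖ := by
  have hclosed : IsClosed {w : H | r * ‖w‖ ≤ ‖cfc k A w‖} :=
    isClosed_le (by fun_prop) (by fun_prop)
  refine closure_minimal ?_ hclosed (rangeProj_apply_eq_self_iff.1 hv)
  rintro _ ⟨w, rfl⟩
  -- On a vector h(A)w the claim compares r h(A) with k(A)h(A), and r²h² ≤ k²h² holds pointwise on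
  -- the spectrum.
  have h1 : ‖(cfc (fun x => r * h x) A) w‖ ≤ ‖(cfc (fun x => k x * h x) A) w‖ := by
    apply norm_apply_le_of_star_mul_self_le
    have hs : ∀ g : ℝ → ℝ, star (cfc g A) = cfc g A := fun g =>
      (cfc_predicate g A : IsSelfAdjoint _)
    rw [hs, hs, ← cfc_mul _ _ A (by fun_prop) (by fun_prop),
      ← cfc_mul _ _ A (by fun_prop) (by fun_prop)]
    refine cfc_mono (fun x hx => ?_) (by fun_prop) (by fun_prop)
    by_cases h0 : h x = 0
    · simp [h0]
    · have h2 := hhk x hx h0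
      have h3 : r ^ 2 ≤ k x ^ 2 := by
        rw [← sq_abs (k x)]
        gcongr
      nlinarith [mul_le_mul_of_nonneg_right h3 (sq_nonneg (h x))]
  rw [cfc_const_mul _ _ A (by fun_prop), cfc_mul _ _ A (by fun_prop) (by fun_prop),
    mul_apply_vec, _root_.smul_apply, norm_smul, Real.norm_of_nonneg hr] at h1
  exact h1

lemma IsSelfAdjoint.mul_one_sub_rangeProj {T : H →L[ℂ] H} (hT : IsSelfAdjoint T) :
    T * (1 - rangeProj T) = 0 := by
  have := congrArg star (rangeProj_mul_self T)
  rw [star_mul, (isStarProjection_rangeProj T).isSelfAdjoint.star_eq, hT.star_eq] at this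
  rw [mul_sub, this, mul_one, sub_self]

/-- The spectral projection of a self-adjoint operator for the half-line `(s, ∞)`. -/
def specProj (B : H →L[ℂ] H) (s : ℝ) : H →L[ℂ] H := rangeProj (cfc (fun u : ℝ => max (u - s) 0) B)

lemma isStarProjection_specProj (B : H →L[ℂ] H) (s : ℝ) : IsStarProjection (specProj B s) :=
  isStarProjection_rangeProj _

lemma specProj_mem {B : H →L[ℂ] H} (hB : B ∈ N) (s : ℝ) : specProj B s ∈ N :=
  rangeProj_mem (cfc_mem_vonNeumannAlgebra hB _)

/-- In B = min(B, s) + (B - s)_+ the second summand is annihilated by 1 - `specProj B s`, and the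
first has norm at most s. -/
lemma norm_mul_one_sub_specProj_le {B : H →L[ℂ] H} (hB : 0 ≤ B) {s : ℝ} (hs : 0 ≤ s) :
    ‖B * (1 - specProj B s)‖ ≤ s := by
  have hsa : IsSelfAdjoint B := hB.isSelfAdjoint
  have h1 : B = cfc (fun u : ℝ => min u s) B + cfc (fun u : ℝ => max (u - s) 0) B := by
    rw [← cfc_add _ _ _ (by fun_prop) (by fun_prop)]
    conv_lhs => rw [← cfc_id' ℝ B]
    refine cfc_congr fun x _ => ?_
    rcases le_total x s with h | h
    · simp [h]
    · simp [h]
  have h2 : B * (1 - specProj B s) = cfc (fun u : ℝ => min u s) B * (1 - specProj B s) := by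
    conv_lhs => rw [h1]
    rw [add_mul, ← h1, specProj,
      HeatKernel.IsSelfAdjoint.mul_one_sub_rangeProj (cfc_predicate _ _), add_zero]
  rw [h2]
  have h3 : ‖cfc (fun u : ℝ => min u s) B‖ ≤ s := by
    refine norm_cfc_le hs fun x hx => ?_
    have hx0 : 0 ≤ x := spectrum_nonneg_of_nonneg hB hx
    rw [Real.norm_of_nonneg (le_min hx0 hs)]
    exact min_le_right _ _
  calc _ ≤ ‖cfc (fun u : ℝ => min u s) B‖ * ‖1 - specProj B s‖ := norm_mul_le _ _
    _ ≤ s * 1 := by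
        gcongr
        exact (isStarProjection_specProj B s).one_sub.norm_le
    _ = s := mul_one s

lemma singularValue_le_of_trace_specProj_le {B : H →L[ℂ] H} (hBN : B ∈ N) (hB : 0 ≤ B) {s t : ℝ}
    (hs : 0 ≤ s) (h : τ (specProj B s) ≤ ENNReal.ofReal t) : singularValue N τ B t ≤ s :=
  (singularValue_le_norm_mul (sub_mem (one_mem N) (specProj_mem hBN s))
    (isStarProjection_specProj B s).one_sub (by rwa [sub_sub_cancel])).trans
    (norm_mul_one_sub_specProj_le hB hs)

/-- Any projection p admissible in the infimum has a nonzero vector in common with e, and there B is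
bounded below by r, so ‖Bp‖ ≥ r. -/
lemma IsFNSTrace.le_singularValue_of_lt (hτ : IsFNSTrace N τ) {e B : H →L[ℂ] H} {t r : ℝ}
    (heN : e ∈ N) (he : IsStarProjection e) (hv : ∀ v, e v = v → r * ‖v‖ ≤ ‖B v‖)
    (h : ENNReal.ofReal t < τ e) : r ≤ singularValue N τ B t := by
  refine hτ.le_singularValue fun p hpN hp hpt => ?_
  obtain ⟨v, hv0, hev, hpv⟩ := hτ.exists_common_vector heN hpN he hp (hpt.trans_lt h)
  have h1 := hv v hev
  have h2 : ‖B v‖ ≤ ‖B * p‖ * ‖v‖ := by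
    have := (B * p).le_opNorm v
    rwa [mul_apply_vec, hpv] at this
  exact le_of_mul_le_mul_right (h1.trans h2) (norm_pos_iff.2 hv0)

lemma IsFNSTrace.le_singularValue_cfc (hτ : IsFNSTrace N τ) {B : H →L[ℂ] H} (hBN : B ∈ N)
    (hB : 0 ≤ B) {f : ℝ → ℝ} (hf : Continuous f) (hmono : MonotoneOn f (Ici 0)) {s t : ℝ}
    (hs : 0 ≤ s) (hfs : 0 ≤ f s) (h : ENNReal.ofReal t < τ (specProj B s)) :
    f s ≤ singularValue N τ (cfc f B) t := by
  refine hτ.le_singularValue_of_lt (specProj_mem hBN s) (isStarProjection_specProj B s)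
    (fun v hv => ?_) h
  refine le_norm_cfc_apply hfs (by fun_prop) hf (fun x hx hne => ?_) hv
  have hx0 : 0 ≤ x := spectrum_nonneg_of_nonneg hB hx
  have hsx : s ≤ x := by
    by_contra hlt
    exact hne (max_eq_right (by linarith))
  exact (hmono hs hx0 hsx).trans (le_abs_self _)

lemma IsFNSTrace.le_singularValue_of_lt_specProj (hτ : IsFNSTrace N τ) {B : H →L[ℂ] H}
    (hBN : B ∈ N) (hB : 0 ≤ B) {s t : ℝ} (hs : 0 ≤ s)
    (h : ENNReal.ofReal t < τ (specProj B s)) : s ≤ singularValue N τ B t := by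
  have := hτ.le_singularValue_cfc hBN hB continuous_id (monotone_id.monotoneOn _) hs hs h
  have hsa : IsSelfAdjoint B := hB.isSelfAdjoint
  rwa [cfc_id ℝ B] at this

/-- Singular values commute with increasing functions of positive operators. -/
lemma IsFNSTrace.singularValue_cfc (hτ : IsFNSTrace N τ) {A : H →L[ℂ] H} (hAN : A ∈ N)
    (hA : 0 ≤ A) {f : ℝ → ℝ} (hf : Continuous f) (hmono : MonotoneOn f (Ici 0)) (hf0 : f 0 = 0)
    (t : ℝ) : singularValue N τ (cfc f A) t = f (singularValue N τ A t) := by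
  have hsa : IsSelfAdjoint A := hA.isSelfAdjoint
  have hfnn : ∀ x, 0 ≤ x → 0 ≤ f x := fun x hx => hf0 ▸ hmono (mem_Ici.2 le_rfl) hx hx
  have hfA : 0 ≤ cfc f A := cfc_nonneg fun x hx => hfnn x (spectrum_nonneg_of_nonneg hA hx)
  have hfN : cfc f A ∈ N := cfc_mem_vonNeumannAlgebra hAN f
  set m := singularValue N τ A t with hm
  have hm0 : 0 ≤ m := singularValue_nonneg N τ A t
  apply le_antisymm
  -- If the spectral projection of f(A) above f(s) had trace larger than t, it would meet a
  -- projection p with ‖Ap‖ < s. But f(u) > f(s) forces u > s, so A is bounded below by s there.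
  -- Continuity lets s decrease to m, which also covers stretches where f is constant.
  · have key : ∀ s, m < s → singularValue N τ (cfc f A) t ≤ f s := by
      intro s hs
      have hs0 : 0 ≤ s := hm0.trans hs.le
      obtain ⟨p, hpN, hp, hpt, hps⟩ := hτ.exists_of_singularValue_lt hs
      refine singularValue_le_of_trace_specProj_le hfN hfA (hfnn s hs0) ?_
      by_contra! hlt
      obtain ⟨v, hv0, hev, hpv⟩ := hτ.exists_common_vector (specProj_mem hfN _) hpN
        (isStarProjection_specProj _ _) hp (hpt.trans_lt hlt)
      have h1 : rangeProj (cfc (fun u : ℝ => max (f u - f s) 0) A) v = v := by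
        rw [specProj, ← cfc_comp' (fun u : ℝ => max (u - f s) 0) f A (by fun_prop)
          (by fun_prop)] at hev
        exact hev
      have h2 : s * ‖v‖ ≤ ‖cfc (id : ℝ → ℝ) A v‖ := by
        refine le_norm_cfc_apply hs0 (by fun_prop) continuous_id (fun x hx hne => ?_) h1
        have hx0 : 0 ≤ x := spectrum_nonneg_of_nonneg hA hx
        have hsx : s ≤ x := by
          by_contra hlt
          exact hne (max_eq_right (by
            have := hmono hx0 hs0 (not_le.1 hlt).le
            linarith))
        exact hsx.trans (le_abs_self _)
      rw [cfc_id ℝ A] at h2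
      have h3 : ‖A v‖ ≤ ‖A * p‖ * ‖v‖ := by
        have := (A * p).le_opNorm v
        rwa [mul_apply_vec, hpv] at this
      have := le_of_mul_le_mul_right (h2.trans h3) (norm_pos_iff.2 hv0)
      linarith
    refine ge_of_tendsto (hf.tendsto m |>.mono_left (nhdsWithin_le_nhds (s := Ioi m))) ?_
    filter_upwards [self_mem_nhdsWithin] with s hs using key s hs
  · rcases hm0.eq_or_lt with h0 | hpos
    · rw [← h0, hf0]
      exact singularValue_nonneg N τ _ t
    · have key : ∀ s, 0 < s → s < m → f s ≤ singularValue N τ (cfc f A) t := by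
        intro s hs0 hs
        refine hτ.le_singularValue_cfc hAN hA hf hmono hs0.le (hfnn s hs0.le) ?_
        by_contra! hle
        exact absurd (singularValue_le_of_trace_specProj_le hAN hA hs0.le hle) (not_le.2 hs)
      refine le_of_tendsto (hf.tendsto m |>.mono_left (nhdsWithin_le_nhds (s := Iio m))) ?_
      filter_upwards [self_mem_nhdsWithin, (Ioi_mem_nhds hpos : Ioi 0 ∈ 𝓝 m) |>
        mem_nhdsWithin_of_mem_nhds] with s hs hs0 using key s hs0 hs

/-! ### The trace as an integral of singular values -/

/-- The part of `u` between the levels `k ε` and `(k + 1) ε`. -/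
def slice (ε : ℝ) (k : ℕ) (u : ℝ) : ℝ := min (max (u - k * ε) 0) ε

lemma continuous_slice (ε : ℝ) (k : ℕ) : Continuous (slice ε k) := by
  unfold slice; fun_prop

lemma sum_slice {ε : ℝ} (hε : 0 ≤ ε) (K : ℕ) (u : ℝ) :
    ∑ k ∈ Finset.range K, slice ε k u = min (max u 0) (K * ε) := by
  induction K with
  | zero => simp
  | succ n ih =>
    rw [Finset.sum_range_succ, ih, slice]
    have hn : (0 : ℝ) ≤ n * ε := by positivity
    push_cast
    rcases le_total u (n * ε) with h | h
    · have h1 : max u 0 ≤ n * ε := max_le h hn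
      rw [min_eq_left h1, max_eq_right (by linarith : u - n * ε ≤ 0), min_eq_left hε,
        min_eq_left (by linarith), add_zero]
    · rw [max_eq_left (hn.trans h), min_eq_right h, max_eq_left (by linarith : 0 ≤ u - n * ε),
        ← min_add_add_left]
      congr 1 <;> ring

lemma slice_succ (ε : ℝ) (k : ℕ) (u : ℝ) : slice ε (k + 1) u = slice ε k (u - ε) := by
  simp only [slice]
  push_cast
  congr 2
  ring

lemma slice_nonneg {ε : ℝ} (hε : 0 ≤ ε) (k : ℕ) (u : ℝ) : 0 ≤ slice ε k u :=
  le_min (le_max_right _ _) hε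

lemma IsFNSTrace.map_sum (hτ : IsFNSTrace N τ) {ι : Type*} (s : Finset ι) {A : ι → H →L[ℂ] H}
    (hN : ∀ i ∈ s, A i ∈ N) (h0 : ∀ i ∈ s, 0 ≤ A i) : τ (∑ i ∈ s, A i) = ∑ i ∈ s, τ (A i) := by
  classical
  induction s using Finset.induction_on with
  | empty => simp [hτ.map_zero]
  | insert i s hi ih =>
    rw [Finset.sum_insert hi, Finset.sum_insert hi,
      hτ.map_add _ (hN i (Finset.mem_insert_self i s)) _
        (sum_mem fun j hj => hN j (Finset.mem_insert_of_mem hj)) (h0 i (Finset.mem_insert_self i s))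
        (Finset.sum_nonneg fun j hj => h0 j (Finset.mem_insert_of_mem hj)),
      ih (fun j hj => hN j (Finset.mem_insert_of_mem hj))
        (fun j hj => h0 j (Finset.mem_insert_of_mem hj))]

/-- The slice is at most ε and vanishes below the level kε, so the spectral projection there acts as
a unit for it. -/
lemma cfc_slice_le {B : H →L[ℂ] H} (hB : 0 ≤ B) {ε : ℝ} (hε : 0 ≤ ε) (k : ℕ) :
    cfc (slice ε k) B ≤ ε • specProj B (k * ε) := by
  have hsa : IsSelfAdjoint B := hB.isSelfAdjoint
  have he := isStarProjection_specProj B (k * ε)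
  set e := specProj B (k * ε) with hedef
  have hc := continuous_slice ε k
  have hs : IsSelfAdjoint (cfc (slice ε k) B) := cfc_predicate _ _
  have h1 : cfc (slice ε k) B * (1 - e) = 0 := by
    have h2 : cfc (fun u : ℝ => max (u - k * ε) 0) B * (1 - e) = 0 :=
      HeatKernel.IsSelfAdjoint.mul_one_sub_rangeProj (cfc_predicate _ _)
    ext v
    have h3 := norm_apply_le_of_star_mul_self_le (S := cfc (slice ε k) B)
      (T := cfc (fun u : ℝ => max (u - k * ε) 0) B) (by
        rw [hs.star_eq, (cfc_predicate _ B : IsSelfAdjoint (cfc (fun u : ℝ => max (u - k * ε) 0) B)).star_eq,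
          ← cfc_mul _ _ B hc.continuousOn hc.continuousOn,
          ← cfc_mul _ _ B (by fun_prop) (by fun_prop)]
        refine cfc_mono (fun x _ => ?_) (by fun_prop) (by fun_prop)
        exact mul_self_le_mul_self (slice_nonneg hε k x) (min_le_left _ _)) ((1 - e) v)
    rw [← mul_apply_vec, ← mul_apply_vec, h2, zero_apply, norm_zero] at h3
    rw [zero_apply]
    exact norm_le_zero_iff.1 h3
  have h4 : cfc (slice ε k) B * e = cfc (slice ε k) B := by
    rw [mul_sub, mul_one, sub_eq_zero] at h1
    exact h1.symm
  have h5 : e * cfc (slice ε k) B = cfc (slice ε k) B := by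
    have := congrArg star h4
    rwa [star_mul, hs.star_eq, he.isSelfAdjoint.star_eq] at this
  have h6 : cfc (slice ε k) B ≤ ε • (1 : H →L[ℂ] H) := by
    rw [← Algebra.algebraMap_eq_smul_one, ← cfc_const ε B hsa]
    exact cfc_mono (fun x _ => min_le_right _ _) hc.continuousOn (by fun_prop)
  have h7 := he.isSelfAdjoint.conjugate_le_conjugate h6
  rwa [h5, h4, mul_smul_comm, smul_mul_assoc, mul_one, he.isIdempotentElem.eq] at h7

/-- The slice equals ε from the level (k+1)ε on. Compressing to the complement of that spectral
projection leaves the positive remainder. -/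
lemma le_cfc_slice {B : H →L[ℂ] H} (hB : 0 ≤ B) {ε : ℝ} (hε : 0 ≤ ε) (k : ℕ) :
    ε • specProj B ((k + 1 : ℕ) * ε) ≤ cfc (slice ε k) B := by
  have hsa : IsSelfAdjoint B := hB.isSelfAdjoint
  have he := isStarProjection_specProj B ((k + 1 : ℕ) * ε)
  set e := specProj B ((k + 1 : ℕ) * ε) with hedef
  have hc := continuous_slice ε k
  have hs : IsSelfAdjoint (cfc (slice ε k) B) := cfc_predicate _ _
  have h0 : 0 ≤ cfc (slice ε k) B := cfc_nonneg fun x _ => slice_nonneg hε k x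
  have h1 : (cfc (slice ε k) B - ε • (1 : H →L[ℂ] H)) * e = 0 := by
    refine mul_rangeProj_eq_zero ?_
    rw [← Algebra.algebraMap_eq_smul_one, ← cfc_const ε B hsa,
      ← cfc_sub _ _ B hc.continuousOn (by fun_prop), ← cfc_mul _ _ B (by fun_prop) (by fun_prop)]
    rw [← cfc_zero ℝ B]
    refine cfc_congr fun x _ => ?_
    simp only [Pi.zero_apply, mul_eq_zero]
    rcases le_total x ((k + 1 : ℕ) * ε) with h | h
    · exact Or.inr (max_eq_right (by linarith))
    · left
      push_cast at h
      rw [slice, max_eq_left (by nlinarith), min_eq_right (by nlinarith), sub_self]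
  have h2 : cfc (slice ε k) B * e = ε • e := by
    rw [sub_mul, smul_mul_assoc, one_mul, sub_eq_zero] at h1
    exact h1
  have h3 : e * cfc (slice ε k) B = ε • e := by
    have := congrArg star h2
    rwa [star_mul, hs.star_eq, star_smul, he.isSelfAdjoint.star_eq, star_trivial] at this
  have h4 := he.one_sub.isSelfAdjoint.conjugate_nonneg h0
  rw [sub_mul, one_mul, h3, mul_sub, mul_one, sub_mul, h2, smul_mul_assoc,
    he.isIdempotentElem.eq, sub_self, sub_zero] at h4
  exact sub_nonneg.1 h4

/-- Turns the trace of a spectral projection into the Lebesgue measure of the set of t at which the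
singular value exceeds the level. -/
lemma volume_pos_ofReal_lt (a : ℝ≥0∞) : volume {t : ℝ | 0 < t ∧ ENNReal.ofReal t < a} = a := by
  induction a with
  | top =>
    have : {t : ℝ | 0 < t ∧ ENNReal.ofReal t < ⊤} = Ioi 0 := by
      ext t; simp [ENNReal.ofReal_lt_top]
    rw [this, Real.volume_Ioi]
  | coe r =>
    have : {t : ℝ | 0 < t ∧ ENNReal.ofReal t < r} = Ioo 0 (r : ℝ) := by
      ext t
      simp only [mem_ofPred_eq, mem_Ioo, and_congr_right_iff]
      intro ht
      rw [← ENNReal.ofReal_coe_nnreal]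
      exact ENNReal.ofReal_lt_ofReal_iff_of_nonneg ht.le
    rw [this, Real.volume_Ioo, sub_zero, ENNReal.ofReal_coe_nnreal]

lemma IsFNSTrace.measurable_singularValue (hτ : IsFNSTrace N τ) (B : H →L[ℂ] H) :
    Measurable (singularValue N τ B) := (hτ.singularValue_antitone B).measurable

/-- Layer cake with layers of thickness ε. Layer k+1 of B is at most ε times a spectral projection,
whose trace is the measure of a set on which layer k of the singular value function is full. The
loss of one layer accounts for (u - ε)_+ on the left. -/
lemma IsFNSTrace.trace_le_lintegral (hτ : IsFNSTrace N τ) {B : H →L[ℂ] H} (hBN : B ∈ N)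
    (hB : 0 ≤ B) {ε : ℝ} (hε : 0 < ε) :
    τ (cfc (fun u : ℝ => max (u - ε) 0) B)
      ≤ ∫⁻ t in Ioi (0 : ℝ), ENNReal.ofReal (singularValue N τ B t) := by
  have hsa : IsSelfAdjoint B := hB.isSelfAdjoint
  -- Finitely many layers exhaust the spectrum, so only additivity of τ on finite sums is needed.
  obtain ⟨K, hK⟩ := exists_nat_gt (‖B‖ / ε)
  rw [div_lt_iff₀ hε] at hK
  have h1 : cfc (fun u : ℝ => max (u - ε) 0) B
      = ∑ k ∈ Finset.range K, cfc (slice ε (k + 1)) B := by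
    rw [← cfc_sum (fun k => slice ε (k + 1)) B (Finset.range K)
      (fun k _ => (continuous_slice ε _).continuousOn)]
    refine cfc_congr fun x hx => ?_
    have hx1 : |x| ≤ ‖B‖ := (spectrum.norm_le_norm_mul_of_mem hx).trans
      (mul_le_of_le_one_right (norm_nonneg B) ContinuousLinearMap.norm_id_le)
    rw [Finset.sum_apply]
    simp only [slice_succ]
    rw [sum_slice hε.le, min_eq_left]
    exact max_le (by linarith [le_abs_self x]) (by positivity)
  have h2 : ∀ k : ℕ, τ (cfc (slice ε (k + 1)) B)
      ≤ ∫⁻ t in Ioi (0 : ℝ), ENNReal.ofReal (slice ε k (singularValue N τ B t)) := by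
    intro k
    have hk : (0 : ℝ) ≤ (k + 1 : ℕ) * ε := by positivity
    calc τ (cfc (slice ε (k + 1)) B) ≤ τ (ε • specProj B ((k + 1 : ℕ) * ε)) :=
          hτ.mono (cfc_mem_vonNeumannAlgebra hBN _) (real_smul_mem (specProj_mem hBN _) ε)
            (cfc_nonneg fun x _ => slice_nonneg hε.le _ x) (cfc_slice_le hB hε.le (k + 1))
      _ = ENNReal.ofReal ε * τ (specProj B ((k + 1 : ℕ) * ε)) :=
          hτ.map_smul ε hε.le _ (specProj_mem hBN _) (isStarProjection_specProj _ _).nonneg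
      _ = ∫⁻ t in {t : ℝ | 0 < t ∧ ENNReal.ofReal t < τ (specProj B ((k + 1 : ℕ) * ε))},
            ENNReal.ofReal ε := by
          rw [setLIntegral_const, volume_pos_ofReal_lt]
      _ ≤ ∫⁻ t in {t : ℝ | 0 < t ∧ ENNReal.ofReal t < τ (specProj B ((k + 1 : ℕ) * ε))},
            ENNReal.ofReal (slice ε k (singularValue N τ B t)) := by
          refine setLIntegral_mono' ?_ fun t ht => ENNReal.ofReal_le_ofReal ?_
          · exact measurableSet_Ioi.inter
              (ENNReal.measurable_ofReal measurableSet_Iio)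
          · have := hτ.le_singularValue_of_lt_specProj hBN hB hk ht.2
            push_cast at this
            exact le_min (le_max_of_le_left (by linarith)) le_rfl
      _ ≤ _ := lintegral_mono_set fun t ht => ht.1
  rw [h1, hτ.map_sum _ (fun k _ => cfc_mem_vonNeumannAlgebra hBN _)
    (fun k _ => cfc_nonneg fun x _ => slice_nonneg hε.le _ x)]
  calc _ ≤ ∑ k ∈ Finset.range K,
        ∫⁻ t in Ioi (0 : ℝ), ENNReal.ofReal (slice ε k (singularValue N τ B t)) :=
        Finset.sum_le_sum fun k _ => h2 k
    _ = ∫⁻ t in Ioi (0 : ℝ), ∑ k ∈ Finset.range K,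
          ENNReal.ofReal (slice ε k (singularValue N τ B t)) := by
        rw [lintegral_finsetSum']
        intro k _
        exact (((continuous_slice ε k).measurable.comp
          (hτ.measurable_singularValue B)).ennreal_ofReal).aemeasurable
    _ ≤ _ := by
        refine lintegral_mono fun t => ?_
        rw [← ENNReal.ofReal_sum_of_nonneg fun k _ => slice_nonneg hε.le k _, sum_slice hε.le]
        refine ENNReal.ofReal_le_ofReal ((min_le_left _ _).trans ?_)
        rw [max_eq_left (singularValue_nonneg N τ B t)]

/-- The reverse layer comparison: layer k+1 of the singular values is supported where t is less than
the trace of the spectral projection at (k+1)ε, and ε times that projection lies under layer k of B.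
Again one layer is lost. -/
lemma IsFNSTrace.lintegral_le_trace (hτ : IsFNSTrace N τ) {B : H →L[ℂ] H} (hBN : B ∈ N)
    (hB : 0 ≤ B) {ε : ℝ} (hε : 0 < ε) :
    ∫⁻ t in Ioi (0 : ℝ), ENNReal.ofReal (singularValue N τ B t - ε) ≤ τ B := by
  have hsa : IsSelfAdjoint B := hB.isSelfAdjoint
  obtain ⟨K, hK⟩ := exists_nat_gt (‖B‖ / ε)
  rw [div_lt_iff₀ hε] at hK
  have h2 : ∀ k : ℕ, ∫⁻ t in Ioi (0 : ℝ), ENNReal.ofReal (slice ε (k + 1) (singularValue N τ B t))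
      ≤ τ (cfc (slice ε k) B) := by
    intro k
    have hk : (0 : ℝ) ≤ (k + 1 : ℕ) * ε := by positivity
    set S := {t : ℝ | 0 < t ∧ ENNReal.ofReal t < τ (specProj B ((k + 1 : ℕ) * ε))} with hS
    have hSm : MeasurableSet S := measurableSet_Ioi.inter
      (ENNReal.measurable_ofReal measurableSet_Iio)
    calc _ ≤ ∫⁻ t in Ioi (0 : ℝ), S.indicator (fun _ => ENNReal.ofReal ε) t := by
          refine setLIntegral_mono' measurableSet_Ioi fun t ht => ?_
          by_cases htS : t ∈ S
          · rw [indicator_of_mem htS]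
            exact ENNReal.ofReal_le_ofReal (min_le_right _ _)
          · have h3 : τ (specProj B ((k + 1 : ℕ) * ε)) ≤ ENNReal.ofReal t := by
              by_contra! h
              exact htS ⟨ht, h⟩
            have h4 := singularValue_le_of_trace_specProj_le hBN hB hk h3
            rw [indicator_of_notMem htS, slice, max_eq_right (by linarith), min_eq_left hε.le,
              ENNReal.ofReal_zero]
      _ ≤ ∫⁻ t, S.indicator (fun _ => ENNReal.ofReal ε) t := setLIntegral_le_lintegral _ _
      _ = ENNReal.ofReal ε * τ (specProj B ((k + 1 : ℕ) * ε)) := by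
          rw [lintegral_indicator hSm, setLIntegral_const, volume_pos_ofReal_lt]
      _ = τ (ε • specProj B ((k + 1 : ℕ) * ε)) :=
          (hτ.map_smul ε hε.le _ (specProj_mem hBN _) (isStarProjection_specProj _ _).nonneg).symm
      _ ≤ _ := hτ.mono (real_smul_mem (specProj_mem hBN _) ε) (cfc_mem_vonNeumannAlgebra hBN _)
            (smul_nonneg hε.le (isStarProjection_specProj _ _).nonneg) (le_cfc_slice hB hε.le k)
  have h3 : ∑ k ∈ Finset.range K, cfc (slice ε k) B ≤ B := by
    rw [← cfc_sum (fun k => slice ε k) B (Finset.range K)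
      (fun k _ => (continuous_slice ε _).continuousOn)]
    conv_rhs => rw [← cfc_id' ℝ B]
    have hc : Continuous (∑ k ∈ Finset.range K, slice ε k) :=
      (continuous_finsetSum (Finset.range K) fun k _ => continuous_slice ε k).congr
        fun x => (Finset.sum_apply x _ _).symm
    refine cfc_mono (fun x hx => ?_) hc.continuousOn (by fun_prop)
    have hx0 : 0 ≤ x := spectrum_nonneg_of_nonneg hB hx
    rw [Finset.sum_apply, sum_slice hε.le, max_eq_left hx0]
    exact min_le_left _ _
  calc _ ≤ ∫⁻ t in Ioi (0 : ℝ), ∑ k ∈ Finset.range K,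
          ENNReal.ofReal (slice ε (k + 1) (singularValue N τ B t)) := by
        refine lintegral_mono fun t => ?_
        rw [← ENNReal.ofReal_sum_of_nonneg fun k _ => slice_nonneg hε.le _ _]
        refine ENNReal.ofReal_le_ofReal ?_
        simp only [slice_succ]
        rw [sum_slice hε.le]
        refine le_min (le_max_left _ _) ?_
        have := hτ.singularValue_le_norm B t
        linarith
    _ = ∑ k ∈ Finset.range K,
        ∫⁻ t in Ioi (0 : ℝ), ENNReal.ofReal (slice ε (k + 1) (singularValue N τ B t)) := by
        rw [lintegral_finsetSum']
        intro k _
        exact (((continuous_slice ε _).measurable.comp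
          (hτ.measurable_singularValue B)).ennreal_ofReal).aemeasurable
    _ ≤ ∑ k ∈ Finset.range K, τ (cfc (slice ε k) B) := Finset.sum_le_sum fun k _ => h2 k
    _ = τ (∑ k ∈ Finset.range K, cfc (slice ε k) B) :=
        (hτ.map_sum _ (fun k _ => cfc_mem_vonNeumannAlgebra hBN _)
          (fun k _ => cfc_nonneg fun x _ => slice_nonneg hε.le _ x)).symm
    _ ≤ τ B := hτ.mono (sum_mem fun k _ => cfc_mem_vonNeumannAlgebra hBN _) hBN
        (Finset.sum_nonneg fun k _ => cfc_nonneg fun x _ => slice_nonneg hε.le _ x) h3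

/-- The trace of a positive operator is the integral of its singular value function. -/
lemma IsFNSTrace.trace_eq_lintegral (hτ : IsFNSTrace N τ) {B : H →L[ℂ] H} (hBN : B ∈ N)
    (hB : 0 ≤ B) : τ B = ∫⁻ t in Ioi (0 : ℝ), ENNReal.ofReal (singularValue N τ B t) := by
  have hsa : IsSelfAdjoint B := hB.isSelfAdjoint
  have hpos : ∀ n : ℕ, (0 : ℝ) < 1 / (n + 1 : ℝ) := fun n => by positivity
  have hanti : ∀ m n : ℕ, m ≤ n → (1 : ℝ) / (n + 1 : ℝ) ≤ 1 / (m + 1 : ℝ) := fun m n h => by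
    gcongr
  apply le_antisymm
  -- The truncations (B - 1/(n+1))_+ increase to B in norm, so normality removes the lost layer. For
  -- the other inequality monotone convergence does so.
  · let h : ℕ → H →L[ℂ] H := fun n => cfc (fun u : ℝ => max (u - 1 / (n + 1 : ℝ)) 0) B
    have hmono : Monotone h := fun m n hmn =>
      cfc_mono (fun x _ => max_le_max (by linarith [hanti m n hmn]) le_rfl)
        (by fun_prop) (by fun_prop)
    have hlub : IsLUB (Set.range h) B := by
      constructor
      · rintro _ ⟨n, rfl⟩
        conv_rhs => rw [← cfc_id' ℝ B]
        refine cfc_mono (fun x hx => ?_) (by fun_prop) (by fun_prop)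
        have hx0 : 0 ≤ x := spectrum_nonneg_of_nonneg hB hx
        exact max_le (by linarith [hpos n]) hx0
      · intro C hC
        rw [← sub_nonneg]
        refine nonneg_of_tendsto_apply (l := atTop) (T := fun m => C - h m)
          (fun m => sub_nonneg.2 (hC ⟨m, rfl⟩)) fun v => ?_
        have hn : Tendsto h atTop (𝓝 B) := by
          rw [tendsto_iff_norm_sub_tendsto_zero]
          refine squeeze_zero (fun _ => norm_nonneg _) (fun n => ?_)
            tendsto_one_div_add_atTop_nhds_zero_nat
          have : h n - B = cfc (fun u : ℝ => max (u - 1 / (n + 1 : ℝ)) 0 - u) B := by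
            rw [cfc_sub _ _ B (by fun_prop) (by fun_prop), cfc_id' ℝ B]
          rw [this]
          refine norm_cfc_le (hpos n).le fun x hx => ?_
          have hx0 : 0 ≤ x := spectrum_nonneg_of_nonneg hB hx
          rw [Real.norm_eq_abs, abs_le]
          refine ⟨by linarith [le_max_left (x - 1 / (n + 1 : ℝ)) 0], ?_⟩
          rw [sub_le_iff_le_add]
          exact max_le (by linarith [hpos n]) (by linarith [hpos n])
        exact Tendsto.sub tendsto_const_nhds
          (((ContinuousLinearMap.apply ℂ H v).continuous.tendsto B).comp hn)
    have := hτ.normal (Set.range h) (Set.range_nonempty h)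
      (by
        rintro _ ⟨n, rfl⟩
        exact ⟨cfc_mem_vonNeumannAlgebra hBN _, cfc_nonneg fun x _ => le_max_right _ _⟩)
      hmono.directed_le.directedOn_range _ hlub
    refine this.2 ?_
    rintro _ ⟨_, ⟨n, rfl⟩, rfl⟩
    exact hτ.trace_le_lintegral hBN hB (hpos n)
  · have h1 : ∀ t, ENNReal.ofReal (singularValue N τ B t)
        = ⨆ n : ℕ, ENNReal.ofReal (singularValue N τ B t - 1 / (n + 1 : ℝ)) := by
      intro t
      refine (iSup_eq_of_tendsto (fun m n hmn => ?_) ?_).symm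
      · exact ENNReal.ofReal_le_ofReal (by linarith [hanti m n hmn])
      · refine ENNReal.tendsto_ofReal ?_
        simpa using (tendsto_const_nhds (x := singularValue N τ B t)).sub
          (tendsto_one_div_add_atTop_nhds_zero_nat (𝕜 := ℝ))
    simp only [h1]
    rw [lintegral_iSup]
    · exact iSup_le fun n => hτ.lintegral_le_trace hBN hB (hpos n)
    · exact fun n => ((hτ.measurable_singularValue B).sub_const _).ennreal_ofReal
    · exact fun m n hmn t => ENNReal.ofReal_le_ofReal (by linarith [hanti m n hmn])

end SingularValue

section Marcinkiewicz

variable {N : VonNeumannAlgebra H} {τ : (H →L[ℂ] H) → ℝ≥0∞}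

/-! ### The operator space `𝓜_{1,∞}` -/

lemma IsFNSTrace.intervalIntegrable_singularValue (hτ : IsFNSTrace N τ) (A : H →L[ℂ] H)
    (a b : ℝ) : IntervalIntegrable (singularValue N τ A) volume a b :=
  (hτ.singularValue_antitone A).intervalIntegrable

/-- Given p, take q complementary to the range of A(1-p). Then qA = qAp, so ‖A*q‖ ≤ ‖Ap‖, and 1 - q
has trace at most τ(1-p) by the equality of left and right range projections. -/
lemma IsFNSTrace.singularValue_star_le (hτ : IsFNSTrace N τ) {A : H →L[ℂ] H} (hA : A ∈ N)
    (t : ℝ) : singularValue N τ (star A) t ≤ singularValue N τ A t := by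
  refine hτ.le_singularValue fun p hpN hp hpt => ?_
  set X := A * (1 - p) with hX
  have hXN : X ∈ N := mul_mem hA (sub_mem (one_mem N) hpN)
  set q := 1 - rangeProj X with hq
  have hqp : IsStarProjection q := (isStarProjection_rangeProj X).one_sub
  have hqN : q ∈ N := sub_mem (one_mem N) (rangeProj_mem hXN)
  have h1 : τ (1 - q) ≤ ENNReal.ofReal t := by
    rw [hq, sub_sub_cancel, ← hτ.rangeProj_star hXN]
    refine (hτ.mono (rangeProj_mem (star_mem hXN)) (sub_mem (one_mem N) hpN)
      (isStarProjection_rangeProj _).nonneg ?_).trans hpt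
    apply rangeProj_le hp.one_sub
    rw [hX, star_mul, hp.one_sub.isSelfAdjoint.star_eq, ← mul_assoc,
      hp.one_sub.isIdempotentElem.eq]
  have h2 : q * A = q * A * p := by
    have h3 : q * X = 0 := by rw [hq, sub_mul, one_mul, rangeProj_mul_self, sub_self]
    rw [hX, mul_sub, mul_one, mul_sub, sub_eq_zero, ← mul_assoc] at h3
    exact h3
  calc singularValue N τ (star A) t ≤ ‖star A * q‖ := singularValue_le_norm_mul hqN hqp h1
    _ = ‖q * A‖ := by
        rw [← norm_star (q * A), star_mul, hqp.isSelfAdjoint.star_eq]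
    _ = ‖q * (A * p)‖ := by rw [h2, mul_assoc]
    _ ≤ ‖q‖ * ‖A * p‖ := norm_mul_le _ _
    _ ≤ 1 * ‖A * p‖ := by
        gcongr
        exact hqp.norm_le
    _ = ‖A * p‖ := one_mul _

/-- Near-optimal projections for A and B are replaced by the complement of the join of their
complements; the two traces add, hence the argument 2t. -/
lemma IsFNSTrace.singularValue_add_le (hτ : IsFNSTrace N τ) (A B : H →L[ℂ] H) {t : ℝ}
    (ht : 0 ≤ t) : singularValue N τ (A + B) (2 * t)
      ≤ singularValue N τ A t + singularValue N τ B t := by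
  refine le_of_forall_pos_le_add fun ε hε => ?_
  obtain ⟨p, hpN, hp, hpt, hpA⟩ := hτ.exists_of_singularValue_lt
    (lt_add_of_pos_right (singularValue N τ A t) (half_pos hε))
  obtain ⟨q, hqN, hq, hqt, hqB⟩ := hτ.exists_of_singularValue_lt
    (lt_add_of_pos_right (singularValue N τ B t) (half_pos hε))
  obtain ⟨r, hrN, hr, hre, hrf, hrt⟩ := hτ.exists_join (sub_mem (one_mem N) hpN)
    (sub_mem (one_mem N) hqN) hp.one_sub hq.one_sub
  have aux : ∀ {p : H →L[ℂ] H}, IsStarProjection p → r * (1 - p) = 1 - p →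
      p * (1 - r) = 1 - r := by
    intro p hp h
    have h1 := congrArg star h
    rw [star_mul, hp.one_sub.isSelfAdjoint.star_eq, hr.isSelfAdjoint.star_eq, sub_mul, one_mul] at h1
    rw [mul_sub, mul_one]
    have : p * r = r - (1 - p) := by rw [← h1]; abel
    rw [this]; abel
  have h1 : τ (1 - (1 - r)) ≤ ENNReal.ofReal (2 * t) := by
    rw [sub_sub_cancel, two_mul, ENNReal.ofReal_add ht ht]
    exact hrt.trans (add_le_add hpt hqt)
  have hn : ∀ (X p : H →L[ℂ] H), p * (1 - r) = 1 - r → ‖X * (1 - r)‖ ≤ ‖X * p‖ := by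
    intro X p h
    rw [← h, ← mul_assoc]
    exact (norm_mul_le _ _).trans (mul_le_of_le_one_right (norm_nonneg _) hr.one_sub.norm_le)
  calc singularValue N τ (A + B) (2 * t) ≤ ‖(A + B) * (1 - r)‖ :=
        singularValue_le_norm_mul (sub_mem (one_mem N) hrN) hr.one_sub h1
    _ ≤ ‖A * (1 - r)‖ + ‖B * (1 - r)‖ := by rw [add_mul]; exact norm_add_le _ _
    _ ≤ ‖A * p‖ + ‖B * q‖ := add_le_add (hn A p (aux hp hre)) (hn B q (aux hq hrf))
    _ ≤ _ := by linarith

lemma IsFNSTrace.singularValue_le_of_norm_apply_le (hτ : IsFNSTrace N τ) {A B : H →L[ℂ] H} {c : ℝ}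
    (hc : 0 ≤ c) (h : ∀ v, ‖B v‖ ≤ c * ‖A v‖) (t : ℝ) :
    singularValue N τ B t ≤ c * singularValue N τ A t := by
  have key : ∀ p ∈ N, IsStarProjection p → τ (1 - p) ≤ ENNReal.ofReal t →
      singularValue N τ B t ≤ c * ‖A * p‖ := by
    intro p hpN hp hpt
    refine (singularValue_le_norm_mul hpN hp hpt).trans ?_
    refine ContinuousLinearMap.opNorm_le_bound _ (by positivity) fun v => ?_
    rw [mul_apply_vec, mul_assoc]
    refine (h (p v)).trans ?_
    gcongr
    exact (A * p).le_opNorm v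
  rcases hc.eq_or_lt with rfl | hpos
  · have := key 1 (one_mem N) (.one _) (by rw [sub_self, hτ.map_zero]; exact zero_le)
    simpa using this
  · rw [mul_comm, ← div_le_iff₀ hpos]
    refine hτ.le_singularValue fun p hpN hp hpt => ?_
    rw [div_le_iff₀ hpos, mul_comm]
    exact key p hpN hp hpt

lemma log_one_add_pos {t : ℝ} (ht : 0 < t) : 0 < Real.log (1 + t) := Real.log_pos (by linarith)

lemma mem_marcinkiewicz_iff {A : H →L[ℂ] H} : A ∈ marcinkiewicz N τ ↔ A ∈ N ∧ ∃ K : ℝ,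
    ∀ t : ℝ, 0 < t → ∫ s in (0 : ℝ)..t, singularValue N τ A s ≤ K * Real.log (1 + t) := by
  refine and_congr_right fun _ => exists_congr fun K => forall₂_congr fun t ht => ?_
  rw [one_div, inv_mul_le_iff₀ (log_one_add_pos ht), mul_comm]

lemma IsFNSTrace.marcinkiewicz_of_singularValue_le (hτ : IsFNSTrace N τ) {A B : H →L[ℂ] H}
    (hA : A ∈ marcinkiewicz N τ) (hB : B ∈ N) {c : ℝ} (hc : 0 ≤ c)
    (h : ∀ t, singularValue N τ B t ≤ c * singularValue N τ A t) : B ∈ marcinkiewicz N τ := by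
  obtain ⟨-, K, hK⟩ := mem_marcinkiewicz_iff.1 hA
  refine mem_marcinkiewicz_iff.2 ⟨hB, c * K, fun t ht => ?_⟩
  calc ∫ s in (0 : ℝ)..t, singularValue N τ B s
      ≤ ∫ s in (0 : ℝ)..t, c * singularValue N τ A s :=
        intervalIntegral.integral_mono_on ht.le (hτ.intervalIntegrable_singularValue B 0 t)
          ((hτ.intervalIntegrable_singularValue A 0 t).const_mul c) fun s _ => h s
    _ = c * ∫ s in (0 : ℝ)..t, singularValue N τ A s := intervalIntegral.integral_const_mul _ _
    _ ≤ c * K * Real.log (1 + t) := by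
        rw [mul_assoc]
        exact mul_le_mul_of_nonneg_left (hK t ht) hc

lemma IsFNSTrace.star_mem_marcinkiewicz (hτ : IsFNSTrace N τ) {A : H →L[ℂ] H}
    (hA : A ∈ marcinkiewicz N τ) : star A ∈ marcinkiewicz N τ :=
  hτ.marcinkiewicz_of_singularValue_le hA (star_mem hA.1) zero_le_one fun t => by
    rw [one_mul]; exact hτ.singularValue_star_le hA.1 t

lemma IsFNSTrace.smul_mem_marcinkiewicz (hτ : IsFNSTrace N τ) {A : H →L[ℂ] H}
    (hA : A ∈ marcinkiewicz N τ) (c : ℂ) : c • A ∈ marcinkiewicz N τ :=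
  hτ.marcinkiewicz_of_singularValue_le hA (complex_smul_mem hA.1 c) (norm_nonneg c)
    (hτ.singularValue_le_of_norm_apply_le (norm_nonneg c) fun v => by
      rw [_root_.smul_apply, norm_smul])

lemma IsFNSTrace.real_smul_mem_marcinkiewicz (hτ : IsFNSTrace N τ) {A : H →L[ℂ] H}
    (hA : A ∈ marcinkiewicz N τ) (c : ℝ) : c • A ∈ marcinkiewicz N τ := by
  rw [← Complex.coe_smul]
  exact hτ.smul_mem_marcinkiewicz hA c

lemma IsFNSTrace.add_mem_marcinkiewicz (hτ : IsFNSTrace N τ) {A B : H →L[ℂ] H}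
    (hA : A ∈ marcinkiewicz N τ) (hB : B ∈ marcinkiewicz N τ) : A + B ∈ marcinkiewicz N τ := by
  obtain ⟨hAN, K, hK⟩ := mem_marcinkiewicz_iff.1 hA
  obtain ⟨hBN, L, hL⟩ := mem_marcinkiewicz_iff.1 hB
  -- The doubled argument in the subadditivity estimate becomes the factor 2 after substitution.
  -- Absolute values appear because the constants K and L are not assumed nonnegative.
  refine mem_marcinkiewicz_iff.2 ⟨add_mem hAN hBN, 2 * (|K| + |L|), fun t ht => ?_⟩
  have hcomp : ∀ X : H →L[ℂ] H, IntervalIntegrable (fun s => singularValue N τ X (s / 2))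
      volume 0 t := fun X => Antitone.intervalIntegrable fun s r hsr =>
    hτ.singularValue_antitone X (by linarith)
  have hhalf : ∀ X : H →L[ℂ] H, ∫ s in (0 : ℝ)..t, singularValue N τ X (s / 2)
      = 2 * ∫ s in (0 : ℝ)..(t / 2), singularValue N τ X s := fun X => by
    rw [intervalIntegral.integral_comp_div _ two_ne_zero]
    simp
  have hlog : Real.log (1 + t / 2) ≤ Real.log (1 + t) :=
    Real.log_le_log (by linarith) (by linarith)
  have hlog0 := log_one_add_pos (half_pos ht)
  calc ∫ s in (0 : ℝ)..t, singularValue N τ (A + B) s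
      ≤ ∫ s in (0 : ℝ)..t, (singularValue N τ A (s / 2) + singularValue N τ B (s / 2)) := by
        refine intervalIntegral.integral_mono_on ht.le (hτ.intervalIntegrable_singularValue _ 0 t)
          ((hcomp A).add (hcomp B)) fun s hs => ?_
        have := hτ.singularValue_add_le A B (t := s / 2) (by linarith [hs.1])
        rwa [mul_div_cancel₀ s two_ne_zero] at this
    _ = 2 * (∫ s in (0 : ℝ)..(t / 2), singularValue N τ A s)
        + 2 * ∫ s in (0 : ℝ)..(t / 2), singularValue N τ B s := by
        rw [intervalIntegral.integral_add (hcomp A) (hcomp B), hhalf, hhalf]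
    _ ≤ 2 * (|K| * Real.log (1 + t)) + 2 * (|L| * Real.log (1 + t)) := by
        have h1 := hK (t / 2) (half_pos ht)
        have h2 := hL (t / 2) (half_pos ht)
        have h3 : K * Real.log (1 + t / 2) ≤ |K| * Real.log (1 + t) :=
          mul_le_mul (le_abs_self K) hlog hlog0.le (abs_nonneg K)
        have h4 : L * Real.log (1 + t / 2) ≤ |L| * Real.log (1 + t) :=
          mul_le_mul (le_abs_self L) hlog hlog0.le (abs_nonneg L)
        linarith
    _ = _ := by ring

lemma norm_posPart_apply_le {X : H →L[ℂ] H} (hX : IsSelfAdjoint X) (v : H) :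
    ‖(X⁺) v‖ ≤ ‖X v‖ := by
  have h1 : X⁺ = cfc (fun u : ℝ => max u 0) X := by
    rw [CFC.posPart_def, cfcₙ_eq_cfc]
    rfl
  have h2 : X = cfc (fun u : ℝ => u) X := (cfc_id' ℝ X).symm
  apply norm_apply_le_of_star_mul_self_le
  rw [(CFC.posPart_nonneg X).isSelfAdjoint.star_eq, hX.star_eq, h1]
  nth_rw 3 4 [h2]
  rw [← cfc_mul _ _ X (by fun_prop) (by fun_prop), ← cfc_mul _ _ X (by fun_prop) (by fun_prop)]
  refine cfc_mono (fun x _ => ?_) (by fun_prop) (by fun_prop)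
  rcases le_total x 0 with h | h
  · rw [max_eq_right h]; nlinarith
  · rw [max_eq_left h]

lemma posPart_mem_vonNeumannAlgebra {X : H →L[ℂ] H} (hX : X ∈ N) : X⁺ ∈ N := by
  rw [CFC.posPart_def, cfcₙ_eq_cfc]
  exact cfc_mem_vonNeumannAlgebra hX _

lemma IsFNSTrace.posPart_mem_marcinkiewicz (hτ : IsFNSTrace N τ) {X : H →L[ℂ] H}
    (hX : X ∈ marcinkiewicz N τ) (hsa : IsSelfAdjoint X) : X⁺ ∈ marcinkiewicz N τ :=
  hτ.marcinkiewicz_of_singularValue_le hX (posPart_mem_vonNeumannAlgebra hX.1) zero_le_one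
    (hτ.singularValue_le_of_norm_apply_le zero_le_one fun v => by
      rw [one_mul]; exact norm_posPart_apply_le hsa v)

lemma IsFNSTrace.negPart_mem_marcinkiewicz (hτ : IsFNSTrace N τ) {X : H →L[ℂ] H}
    (hX : X ∈ marcinkiewicz N τ) (hsa : IsSelfAdjoint X) : X⁻ ∈ marcinkiewicz N τ := by
  rw [← CFC.posPart_neg]
  refine hτ.posPart_mem_marcinkiewicz ?_ hsa.neg
  have := hτ.smul_mem_marcinkiewicz hX (-1)
  simpa using this

lemma IsFNSTrace.realPart_mem_marcinkiewicz (hτ : IsFNSTrace N τ) {X : H →L[ℂ] H}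
    (hX : X ∈ marcinkiewicz N τ) : (ℜ X : H →L[ℂ] H) ∈ marcinkiewicz N τ := by
  rw [realPart_apply_coe]
  exact hτ.real_smul_mem_marcinkiewicz
    (hτ.add_mem_marcinkiewicz hX (hτ.star_mem_marcinkiewicz hX)) _

lemma IsFNSTrace.imaginaryPart_mem_marcinkiewicz (hτ : IsFNSTrace N τ) {X : H →L[ℂ] H}
    (hX : X ∈ marcinkiewicz N τ) : (ℑ X : H →L[ℂ] H) ∈ marcinkiewicz N τ := by
  rw [imaginaryPart_apply_coe, sub_eq_add_neg, ← neg_one_smul ℂ (star X)]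
  exact hτ.smul_mem_marcinkiewicz (hτ.real_smul_mem_marcinkiewicz
    (hτ.add_mem_marcinkiewicz hX (hτ.smul_mem_marcinkiewicz (hτ.star_mem_marcinkiewicz hX) _)) _) _

end Marcinkiewicz

/-! ### Extension from the positive cone -/

section Extension

variable {N : VonNeumannAlgebra H} {τ : (H →L[ℂ] H) → ℝ≥0∞}

lemma extend_of_nonneg {f : (H →L[ℂ] H) → ℝ} (hf : f 0 = 0) {A : H →L[ℂ] H} (hA : 0 ≤ A) :
    extend f A = f A := by
  have hsa : IsSelfAdjoint A := hA.isSelfAdjoint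
  have h1 : (ℑ A : H →L[ℂ] H) = 0 := by rw [hsa.imaginaryPart]; rfl
  rw [extend, hsa.coe_realPart, h1, CFC.posPart_zero, CFC.negPart_zero,
    (CFC.posPart_eq_self A).2 hA, (CFC.negPart_eq_zero_iff A).2 hA, hf]
  simp

/-- A linear functional which is given by `f` on positive operators is given by the extension
of `f`. -/
lemma IsLinearFunctional.eq_extend (hτ : IsFNSTrace N τ) {φ : (H →L[ℂ] H) → ℂ}
    (hφ : IsLinearFunctional N τ φ) {f : (H →L[ℂ] H) → ℝ} {c : ℝ}
    (h : ∀ A ∈ marcinkiewicz N τ, 0 ≤ A → φ A = c * f A) {A : H →L[ℂ] H}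
    (hA : A ∈ marcinkiewicz N τ) : φ A = c * extend f A := by
  have hself : ∀ X ∈ marcinkiewicz N τ, IsSelfAdjoint X →
      φ X = c * ((f (X⁺) - f (X⁻) : ℝ) : ℂ) := by
    intro X hX hsa
    have h1 : X = X⁺ + (-1 : ℂ) • X⁻ := by
      rw [neg_one_smul, ← sub_eq_add_neg, CFC.posPart_sub_negPart X hsa]
    have hp := hτ.posPart_mem_marcinkiewicz hX hsa
    have hn := hτ.negPart_mem_marcinkiewicz hX hsa
    conv_lhs => rw [h1]
    rw [hφ.map_add _ hp _ (hτ.smul_mem_marcinkiewicz hn _), hφ.map_smul _ _ hn,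
      h _ hp (CFC.posPart_nonneg X), h _ hn (CFC.negPart_nonneg X)]
    push_cast
    ring
  have hr := hτ.realPart_mem_marcinkiewicz hA
  have hi := hτ.imaginaryPart_mem_marcinkiewicz hA
  conv_lhs => rw [← realPart_add_I_smul_imaginaryPart A]
  rw [hφ.map_add _ hr _ (hτ.smul_mem_marcinkiewicz hi _), hφ.map_smul _ _ hi,
    hself _ hr (ℜ A).2, hself _ hi (ℑ A).2, extend]
  ring

end Extension

section Projections

variable {N : VonNeumannAlgebra H} {τ : (H →L[ℂ] H) → ℝ≥0∞}

/-! ### Projections of prescribed trace -/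

lemma rangeProj_eq_self {p : H →L[ℂ] H} (hp : IsStarProjection p) : rangeProj p = p := by
  apply le_antisymm (rangeProj_le hp hp.isIdempotentElem.eq)
  rw [hp.le_iff_mul_eq_right (isStarProjection_rangeProj p)]
  exact rangeProj_mul_self p

lemma isStarProjection_add {p q : H →L[ℂ] H} (hp : IsStarProjection p) (hq : IsStarProjection q)
    (h : p * q = 0) : IsStarProjection (p + q) := by
  have h' : q * p = 0 := by
    have := congrArg star h
    rwa [star_mul, hp.isSelfAdjoint.star_eq, hq.isSelfAdjoint.star_eq, star_zero] at this
  refine ⟨?_, hp.isSelfAdjoint.add hq.isSelfAdjoint⟩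
  rw [IsIdempotentElem, add_mul, mul_add, mul_add, h, h', hp.isIdempotentElem.eq,
    hq.isIdempotentElem.eq, add_zero, zero_add]

lemma mem_of_commute {N : VonNeumannAlgebra H} {x : H →L[ℂ] H}
    (h : ∀ y ∈ N.commutant, y * x = x * y) : x ∈ N := by
  rw [← N.commutant_commutant, VonNeumannAlgebra.mem_commutant_iff]
  exact h

/-- A nonempty chain of projections has a least upper bound, which is a projection. -/
lemma exists_isLUB_chain {c : Set (H →L[ℂ] H)} (hc : IsChain (· ≤ ·) c) (hne : c.Nonempty)
    (hcN : ∀ p ∈ c, p ∈ N) (hcp : ∀ p ∈ c, IsStarProjection p) :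
    ∃ q ∈ N, IsStarProjection q ∧ IsLUB c q := by
  have : Nonempty c := hne.to_subtype
  have hdir : IsDirectedOrder c := ⟨fun a b => by
    rcases hc.total a.2 b.2 with h | h
    · exact ⟨b, h, le_rfl⟩
    · exact ⟨a, le_rfl, h⟩⟩
  let U : c → Submodule ℂ H := fun i => (i : H →L[ℂ] H).range.topologicalClosure
  have hU : ∀ i, (U i).starProjection = i := fun i => rangeProj_eq_self (hcp i i.2)
  have hmono : Monotone U := fun i j hij => by
    rw [← Submodule.starProjection_le_starProjection_iff, hU, hU]
    exact hij
  set q := (⨆ i, U i).topologicalClosure.starProjection with hq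
  have htend : ∀ v, Tendsto (fun i : c => (i : H →L[ℂ] H) v) atTop (𝓝 (q v)) := fun v => by
    have := Submodule.starProjection_tendsto_closure_iSup U hmono v
    simp only [hU] at this
    exact this
  refine ⟨q, ?_, isStarProjection_starProjection, ?_, ?_⟩
  · refine mem_of_commute fun y hy => ?_
    ext v
    refine tendsto_nhds_unique ((y.continuous.tendsto _).comp (htend v)) ?_
    refine (htend (y v)).congr fun i => ?_
    have := VonNeumannAlgebra.mem_commutant_iff.1 hy i (hcN i i.2)
    exact congrArg (fun T : H →L[ℂ] H => T v) this
  · intro p hp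
    have h1 := hU ⟨p, hp⟩
    have h2 : (U ⟨p, hp⟩).starProjection ≤ q := by
      rw [hq, Submodule.starProjection_le_starProjection_iff]
      exact (le_iSup U _).trans (Submodule.le_topologicalClosure _)
    rwa [h1] at h2
  · intro C hC
    rw [← sub_nonneg]
    exact nonneg_of_tendsto_apply (l := atTop) (T := fun i : c => C - (i : H →L[ℂ] H))
      (fun i => sub_nonneg.2 (hC i.2)) fun v => tendsto_const_nhds.sub (htend v)

/-- Semifiniteness gives 0 ≠ B ≤ p of finite trace. Its spectral projection e above ‖B‖/2 satisfies
(‖B‖/2)e ≤ B, so it has finite trace and lies under p. It is nonzero, since otherwise ‖B‖ ≤ ‖B‖/2.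
-/
lemma IsFNSTrace.exists_finite_projection (hτ : IsFNSTrace N τ) {p : H →L[ℂ] H} (hpN : p ∈ N)
    (hp : IsStarProjection p) (hp0 : p ≠ 0) :
    ∃ e ∈ N, IsStarProjection e ∧ e ≤ p ∧ e ≠ 0 ∧ τ e < ∞ := by
  obtain ⟨B, hBN, hB, hBp, hB0, hBt⟩ := hτ.semifinite p hpN hp.nonneg hp0
  have hsa : IsSelfAdjoint B := hB.isSelfAdjoint
  have hn : 0 < ‖B‖ := norm_pos_iff.2 hB0
  set ε := ‖B‖ / 2 with hε
  have hε0 : 0 < ε := by positivity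
  set e := specProj B ε with he
  have hep : IsStarProjection e := isStarProjection_specProj B ε
  have heB : ε • e ≤ B := by
    have h1 := le_cfc_slice hB hε0.le 0
    rw [zero_add, Nat.cast_one, one_mul] at h1
    refine h1.trans ?_
    conv_rhs => rw [← cfc_id' ℝ B]
    refine cfc_mono (fun x hx => ?_) (continuous_slice ε 0).continuousOn (by fun_prop)
    have hx0 : 0 ≤ x := spectrum_nonneg_of_nonneg hB hx
    simp only [slice, Nat.cast_zero, zero_mul, sub_zero, max_eq_left hx0]
    exact min_le_left _ _
  have heN : e ∈ N := specProj_mem hBN ε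
  refine ⟨e, heN, hep, ?_, ?_, ?_⟩
  · have h2 := (hp.mul_right_and_mul_left_of_nonneg_of_le (smul_nonneg hε0.le hep.nonneg)
      (heB.trans hBp)).1
    rw [smul_mul_assoc] at h2
    rw [hep.le_iff_mul_eq_left hp]
    exact smul_right_injective _ hε0.ne' h2
  · intro h0
    have h3 := norm_mul_one_sub_specProj_le hB hε0.le
    rw [← he, h0, sub_zero, mul_one] at h3
    linarith
  · have h4 := hτ.mono (real_smul_mem heN ε) hBN (smul_nonneg hε0.le hep.nonneg) heB
    rw [hτ.map_smul ε hε0.le e heN hep.nonneg] at h4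
    by_contra! htop
    rw [top_le_iff] at htop
    rw [htop, ENNReal.mul_top (by simpa using hε0), top_le_iff] at h4
    exact hBt.ne h4

lemma IsFNSTrace.trace_sub (hτ : IsFNSTrace N τ) {e p : H →L[ℂ] H} (heN : e ∈ N) (hpN : p ∈ N)
    (he : 0 ≤ e) (hep : e ≤ p) : τ e + τ (p - e) = τ p := by
  rw [← hτ.map_add e heN (p - e) (sub_mem hpN heN) he (sub_nonneg.2 hep), add_sub_cancel]

/-- Without minimal projections a finite projection can be split in two, and one of the pieces has
at most half of the trace. Iterating gets below any ε. -/
lemma IsFNSTrace.exists_small_projection (hτ : IsFNSTrace N τ) (hN : IsDiffuse N)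
    {p : H →L[ℂ] H} (hpN : p ∈ N) (hp : IsStarProjection p) (hp0 : p ≠ 0) {ε : ℝ≥0∞}
    (hε : ε ≠ 0) : ∃ e ∈ N, IsStarProjection e ∧ e ≤ p ∧ e ≠ 0 ∧ τ e ≤ ε := by
  obtain ⟨f, hfN, hf, hfp, hf0, hft⟩ := hτ.exists_finite_projection hpN hp hp0
  have key : ∀ n : ℕ, ∃ e ∈ N, IsStarProjection e ∧ e ≤ p ∧ e ≠ 0 ∧ 2 ^ n * τ e ≤ τ f := by
    intro n
    induction n with
    | zero => exact ⟨f, hfN, hf, hfp, hf0, by simp⟩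
    | succ n ih =>
      obtain ⟨e, heN, he, hep, he0, het⟩ := ih
      obtain ⟨g, hgN, hg, hge, hg0, hgne⟩ := hN e heN he he0
      have hsum := hτ.trace_sub hgN heN hg.nonneg hge
      rcases le_total (τ g) (τ (e - g)) with h | h
      · refine ⟨g, hgN, hg, hge.trans hep, hg0, le_trans ?_ het⟩
        rw [pow_succ, mul_assoc, two_mul, ← hsum]
        gcongr
      · refine ⟨e - g, sub_mem heN hgN, (hg.le_iff_sub he).1 hge, ?_, ?_, le_trans ?_ het⟩
        · exact (sub_le_self e hg.nonneg).trans hep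
        · exact sub_ne_zero.2 hgne.symm
        · rw [pow_succ, mul_assoc, two_mul, ← hsum]
          gcongr
  obtain ⟨n, hn⟩ : ∃ n : ℕ, τ f ≤ 2 ^ n * ε := by
    obtain ⟨n, hn⟩ := ENNReal.exists_nat_mul_gt hε hft.ne
    refine ⟨n, hn.le.trans ?_⟩
    gcongr
    exact_mod_cast (Nat.lt_two_pow_self (n := n)).le
  obtain ⟨e, heN, he, hep, he0, het⟩ := key n
  refine ⟨e, heN, he, hep, he0, ?_⟩
  exact (ENNReal.mul_le_mul_iff_right (by positivity) (by finiteness)).1 (het.trans hn)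

/-- Zorn's lemma for subprojections of p of trace at most 1, where normality bounds the traces of
suprema of chains. If a maximal one had smaller trace, the infinite remainder of p would contain a
small projection to add to it. -/
lemma IsFNSTrace.exists_projection_trace_one (hτ : IsFNSTrace N τ) (hN : IsDiffuse N)
    {p : H →L[ℂ] H} (hpN : p ∈ N) (hp : IsStarProjection p) (hpt : τ p = ∞) :
    ∃ e ∈ N, IsStarProjection e ∧ e ≤ p ∧ τ e = 1 := by
  obtain ⟨q, hq⟩ := zorn_le₀ {e : H →L[ℂ] H | e ∈ N ∧ IsStarProjection e ∧ e ≤ p ∧ τ e ≤ 1} (by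
    intro c hc hchain
    rcases c.eq_empty_or_nonempty with rfl | hne
    · exact ⟨0, ⟨zero_mem N, .zero _, hp.nonneg, by rw [hτ.map_zero]; exact zero_le⟩, by simp⟩
    · obtain ⟨q, hqN, hqp, hlub⟩ := exists_isLUB_chain hchain hne (fun e he => (hc he).1)
        (fun e he => (hc he).2.1)
      refine ⟨q, ⟨hqN, hqp, hlub.2 fun e he => (hc he).2.2.1, ?_⟩, fun e he => hlub.1 he⟩
      refine (hτ.normal c hne (fun e he => ⟨(hc he).1, (hc he).2.1.nonneg⟩) hchain.directedOn q
        hlub).2 ?_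
      rintro _ ⟨e, he, rfl⟩
      exact (hc he).2.2.2)
  obtain ⟨⟨hqN, hqp, hqle, hqt⟩, hmax⟩ := hq
  refine ⟨q, hqN, hqp, hqle, le_antisymm hqt ?_⟩
  by_contra! hlt
  have hsum := hτ.trace_sub hqN hpN hqp.nonneg hqle
  have hsub : IsStarProjection (p - q) := (hqp.le_iff_sub hp).1 hqle
  have hne : p - q ≠ 0 := by
    intro h0
    rw [h0, hτ.map_zero, add_zero, hpt] at hsum
    rw [hsum] at hlt
    exact absurd hlt (by simp)
  obtain ⟨e, heN, he, hep, he0, het⟩ := hτ.exists_small_projection hN (sub_mem hpN hqN) hsub hne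
    (ε := 1 - τ q) (tsub_pos_of_lt hlt).ne'
  have hqe : q * e = 0 := by
    have h1 := (he.le_iff_mul_eq_right hsub).1 hep
    rw [← h1, ← mul_assoc, mul_sub, (hqp.le_iff_mul_eq_left hp).1 hqle, hqp.isIdempotentElem.eq,
      sub_self, zero_mul]
  have hle : q + e ≤ q := by
    refine hmax ⟨add_mem hqN heN, isStarProjection_add hqp he hqe, ?_, ?_⟩
      (le_add_of_nonneg_right he.nonneg)
    · have := add_le_add_right hep q
      rwa [add_sub_cancel] at this
    · rw [hτ.map_add q hqN e heN hqp.nonneg he.nonneg]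
      calc τ q + τ e ≤ τ q + (1 - τ q) := by gcongr
        _ = 1 := add_tsub_cancel_of_le hqt
  have h2 : e ≤ 0 := by simpa using hle
  exact he0 (le_antisymm h2 he.nonneg)

lemma exists_unit_vector_of_ne_zero {p : H →L[ℂ] H} (hp : IsStarProjection p) (hp0 : p ≠ 0) :
    ∃ v : H, ‖v‖ = 1 ∧ p v = v := by
  obtain ⟨w, hw⟩ : ∃ w, p w ≠ 0 := by
    by_contra! h
    exact hp0 (by ext w; exact h w)
  refine ⟨((‖p w‖⁻¹ : ℝ) : ℂ) • p w, ?_, ?_⟩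
  · rw [norm_smul, Complex.norm_real, norm_inv, norm_norm, inv_mul_cancel₀ (norm_ne_zero_iff.2 hw)]
  · rw [map_smul, ← mul_apply_vec, hp.isIdempotentElem.eq]

open InnerProductSpace in
lemma rankOne_le_of_apply_eq {p : H →L[ℂ] H} (hp : IsStarProjection p) {v : H} (hv : ‖v‖ = 1)
    (hpv : p v = v) : rankOne ℂ v v ≤ p := by
  rw [(isStarProjection_rankOne_self hv).le_iff_mul_eq_right hp]
  ext w
  rw [mul_apply_vec, rankOne_apply, map_smul, hpv]

open InnerProductSpace in
-- The rank one operator taking v to w is a partial isometry between the two lines; traciality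
-- applies to it.
lemma IsFNSTrace.trace_rankOne_eq (hτ : IsFNSTrace N τ) (hN : ∀ A : H →L[ℂ] H, A ∈ N) {v w : H}
    (hv : ‖v‖ = 1) (hw : ‖w‖ = 1) : τ (rankOne ℂ v v) = τ (rankOne ℂ w w) := by
  have h := hτ.tracial (rankOne ℂ w v) (hN _)
  have h1 : star (rankOne ℂ w v) = rankOne ℂ v w := adjoint_rankOne w v
  have h2 : rankOne ℂ v w * rankOne ℂ w v = rankOne ℂ v v := by
    have := rankOne_comp_rankOne (𝕜 := ℂ) v w w v
    rw [inner_self_eq_norm_sq_to_K, hw, RCLike.ofReal_one, one_pow, one_smul] at this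
    exact this
  have h3 : rankOne ℂ w v * rankOne ℂ v w = rankOne ℂ w w := by
    have := rankOne_comp_rankOne (𝕜 := ℂ) w v v w
    rw [inner_self_eq_norm_sq_to_K, hv, RCLike.ofReal_one, one_pow, one_smul] at this
    exact this
  rwa [h1, h2, h3] at h

/-- There is room for projections of some fixed trace below every projection of finite cotrace. -/
lemma IsFNSTrace.exists_step (hτ : IsFNSTrace N τ) (hinf : τ 1 = ∞)
    (hN : IsDiffuse N ∨ ∀ A : H →L[ℂ] H, A ∈ N) :
    ∃ α : ℝ, 0 < α ∧ ∀ s ∈ N, IsStarProjection s → τ s < ∞ →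
      ∃ p ∈ N, IsStarProjection p ∧ s * p = 0 ∧ τ p = ENNReal.ofReal α := by
  have hcompl : ∀ s ∈ N, IsStarProjection s → τ s < ∞ → τ (1 - s) = ∞ := by
    intro s hsN hs hst
    have := hτ.trace_sub hsN (one_mem N) hs.nonneg hs.le_one
    rw [hinf, ENNReal.add_eq_top] at this
    exact this.resolve_left hst.ne
  have horth : ∀ s p : H →L[ℂ] H, IsStarProjection s → IsStarProjection p → p ≤ 1 - s →
      s * p = 0 := by
    intro s p hs hp h
    rw [← (hp.le_iff_mul_eq_right hs.one_sub).1 h, ← mul_assoc, hs.mul_one_sub_self, zero_mul]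
  rcases hN with hN | hN
  · refine ⟨1, one_pos, fun s hsN hs hst => ?_⟩
    obtain ⟨e, heN, he, hle, het⟩ := hτ.exists_projection_trace_one hN
      (sub_mem (one_mem N) hsN) hs.one_sub (hcompl s hsN hs hst)
    exact ⟨e, heN, he, horth s e hs he hle, by simpa using het⟩
  · have h1 : (1 : H →L[ℂ] H) ≠ 0 := by
      intro h
      rw [h, hτ.map_zero] at hinf
      exact absurd hinf (by simp)
    obtain ⟨e, heN, he, -, he0, het⟩ := hτ.exists_finite_projection (one_mem N) (.one _) h1
    obtain ⟨v, hv, hev⟩ := exists_unit_vector_of_ne_zero he he0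
    have hvp := InnerProductSpace.isStarProjection_rankOne_self (𝕜 := ℂ) hv
    have hfin : τ (InnerProductSpace.rankOne ℂ v v) < ∞ :=
      (hτ.mono (hN _) heN hvp.nonneg (rankOne_le_of_apply_eq he hv hev)).trans_lt het
    have hpos : τ (InnerProductSpace.rankOne ℂ v v) ≠ 0 := by
      intro h0
      have h2 := hτ.faithful _ (hN _) hvp.nonneg h0
      have hv0 : v ≠ 0 := by
        rintro rfl
        simp at hv
      exact InnerProductSpace.rankOne_ne_zero hv0 hv0 h2
    -- In B(H) the step is the common trace of all rank one projections, positive by faithfulness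
    -- and finite by semifiniteness.
    refine ⟨(τ (InnerProductSpace.rankOne ℂ v v)).toReal, ENNReal.toReal_pos hpos hfin.ne,
      fun s hsN hs hst => ?_⟩
    have hne : 1 - s ≠ 0 := by
      intro h0
      have := hcompl s hsN hs hst
      rw [h0, hτ.map_zero] at this
      exact absurd this (by simp)
    obtain ⟨w, hw, hsw⟩ := exists_unit_vector_of_ne_zero hs.one_sub hne
    have hwp := InnerProductSpace.isStarProjection_rankOne_self (𝕜 := ℂ) hw
    refine ⟨InnerProductSpace.rankOne ℂ w w, hN _, hwp,
      horth s _ hs hwp (rankOne_le_of_apply_eq hs.one_sub hw hsw), ?_⟩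
    rw [ENNReal.ofReal_toReal hfin.ne, hτ.trace_rankOne_eq hN hw hv]

/-- An orthogonal sequence of projections in `N` of trace `α`. -/
structure IsTraceSequence (N : VonNeumannAlgebra H) (τ : (H →L[ℂ] H) → ℝ≥0∞) (α : ℝ)
    (p : ℕ → H →L[ℂ] H) : Prop where
  mem : ∀ k, p k ∈ N
  proj : ∀ k, IsStarProjection (p k)
  orth : ∀ j k, j ≠ k → p j * p k = 0
  trace : ∀ k, τ (p k) = ENNReal.ofReal α

/-- The recursion carries the sum of the projections chosen so far. It has finite trace, so there is
always room for one more below its complement. -/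
lemma IsFNSTrace.exists_traceSequence (hτ : IsFNSTrace N τ) (hinf : τ 1 = ∞)
    (hN : IsDiffuse N ∨ ∀ A : H →L[ℂ] H, A ∈ N) :
    ∃ (α : ℝ) (p : ℕ → H →L[ℂ] H), 0 < α ∧ IsTraceSequence N τ α p := by
  obtain ⟨α, hα, hstep⟩ := hτ.exists_step hinf hN
  let S := {s : H →L[ℂ] H // s ∈ N ∧ IsStarProjection s ∧ τ s < ∞}
  choose! g hgN hgp hgs hgt using hstep
  have hnext : ∀ s : S, (s.1 + g s.1) ∈ N ∧ IsStarProjection (s.1 + g s.1) ∧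
      τ (s.1 + g s.1) < ∞ := fun s => by
    obtain ⟨s, hsN, hs, hst⟩ := s
    refine ⟨add_mem hsN (hgN s hsN hs hst), isStarProjection_add hs (hgp s hsN hs hst)
      (hgs s hsN hs hst), ?_⟩
    rw [hτ.map_add s hsN _ (hgN s hsN hs hst) hs.nonneg (hgp s hsN hs hst).nonneg,
      hgt s hsN hs hst]
    exact ENNReal.add_lt_top.2 ⟨hst, ENNReal.ofReal_lt_top⟩
  let σ : ℕ → S := fun n => Nat.rec ⟨0, zero_mem N, .zero _, by rw [hτ.map_zero]; simp⟩
    (fun _ s => ⟨s.1 + g s.1, hnext s⟩) n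
  have hσ : ∀ n, (σ (n + 1)).1 = (σ n).1 + g (σ n).1 := fun n => rfl
  have hP := fun n => hgp (σ n).1 (σ n).2.1 (σ n).2.2.1 (σ n).2.2.2
  have hO := fun n => hgs (σ n).1 (σ n).2.1 (σ n).2.2.1 (σ n).2.2.2
  have hmono : Monotone fun n => (σ n).1 := monotone_nat_of_le_succ fun n => by
    rw [hσ]
    exact le_add_of_nonneg_right (hP n).nonneg
  have horth : ∀ j k, j < k → g (σ j).1 * g (σ k).1 = 0 := by
    intro j k hjk
    have h1 : g (σ j).1 ≤ (σ k).1 := by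
      refine le_trans ?_ (hmono (Nat.succ_le_of_lt hjk))
      change _ ≤ (σ (j + 1)).1
      rw [hσ]
      exact le_add_of_nonneg_left (σ j).2.2.1.nonneg
    rw [← ((hP j).le_iff_mul_eq_left (σ k).2.2.1).1 h1, mul_assoc, hO k, mul_zero]
  refine ⟨α, fun n => g (σ n).1, hα, ⟨fun n => hgN _ (σ n).2.1 (σ n).2.2.1 (σ n).2.2.2, hP,
    fun j k hjk => ?_, fun n => hgt _ (σ n).2.1 (σ n).2.2.1 (σ n).2.2.2⟩⟩
  rcases lt_or_gt_of_ne hjk with h | h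
  · exact horth j k h
  · have := congrArg star (horth k j h)
    rwa [star_mul, (hP k).isSelfAdjoint.star_eq, (hP j).isSelfAdjoint.star_eq, star_zero] at this

end Projections

section Diagonal

variable {N : VonNeumannAlgebra H} {τ : (H →L[ℂ] H) → ℝ≥0∞} {α : ℝ} {p : ℕ → H →L[ℂ] H}

/-! ### Diagonal operators -/

lemma IsTraceSequence.comp (hp : IsTraceSequence N τ α p) {σ : ℕ → ℕ}
    (hσ : Function.Injective σ) : IsTraceSequence N τ α (p ∘ σ) :=
  ⟨fun _ => hp.mem _, fun _ => hp.proj _, fun _ _ h => hp.orth _ _ (hσ.ne h), fun _ => hp.trace _⟩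

/-- Partial sums of a sequence of projections. -/
def partialSum (p : ℕ → H →L[ℂ] H) (m : ℕ) : H →L[ℂ] H := ∑ k ∈ Finset.range m, p k

lemma IsTraceSequence.partialSum_mem (hp : IsTraceSequence N τ α p) (m : ℕ) :
    partialSum p m ∈ N := sum_mem fun k _ => hp.mem k

lemma IsTraceSequence.partialSum_mul (hp : IsTraceSequence N τ α p) {m n : ℕ} (h : m ≤ n) :
    partialSum p n * partialSum p m = partialSum p m := by
  rw [partialSum, partialSum, Finset.sum_mul_sum, Finset.sum_comm]
  refine Finset.sum_congr rfl fun j hj => ?_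
  rw [Finset.sum_eq_single j]
  · exact (hp.proj j).isIdempotentElem.eq
  · exact fun k _ hk => hp.orth k j hk
  · intro hn
    exact absurd (Finset.mem_range.2 ((Finset.mem_range.1 hj).trans_le h)) hn

lemma IsTraceSequence.isStarProjection_partialSum (hp : IsTraceSequence N τ α p) (m : ℕ) :
    IsStarProjection (partialSum p m) := by
  refine ⟨hp.partialSum_mul le_rfl, ?_⟩
  rw [IsSelfAdjoint, partialSum, star_sum]
  exact Finset.sum_congr rfl fun k _ => (hp.proj k).isSelfAdjoint

lemma IsTraceSequence.trace_partialSum (hp : IsTraceSequence N τ α p) (hτ : IsFNSTrace N τ)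
    (m : ℕ) : τ (partialSum p m) = ENNReal.ofReal (m * α) := by
  rw [partialSum, hτ.map_sum _ (fun k _ => hp.mem k) (fun k _ => (hp.proj k).nonneg)]
  simp only [hp.trace, Finset.sum_const, Finset.card_range, nsmul_eq_mul]
  rw [ENNReal.ofReal_mul (by positivity), ENNReal.ofReal_natCast]

lemma IsTraceSequence.partialSum_mono (hp : IsTraceSequence N τ α p) : Monotone (partialSum p) :=
  fun _ _ h => ((hp.isStarProjection_partialSum _).le_iff_mul_eq_right
    (hp.isStarProjection_partialSum _)).2 (hp.partialSum_mul h)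

/-- The operator `∑ x_k p_k` for a decreasing null sequence `x`, written by Abel summation as an
absolutely convergent series. -/
def diag (p : ℕ → H →L[ℂ] H) (x : ℕ → ℝ) : H →L[ℂ] H :=
  ∑' m, (x m - x (m + 1)) • partialSum p (m + 1)

/-- A decreasing null sequence. -/
def IsNullSeq (x : ℕ → ℝ) : Prop := Antitone x ∧ Tendsto x atTop (𝓝 0)

lemma IsNullSeq.nonneg {x : ℕ → ℝ} (hx : IsNullSeq x) (k : ℕ) : 0 ≤ x k :=
  hx.1.le_of_tendsto hx.2 k

lemma IsNullSeq.add {x y : ℕ → ℝ} (hx : IsNullSeq x) (hy : IsNullSeq y) : IsNullSeq (x + y) :=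
  ⟨hx.1.add hy.1, by have := hx.2.add hy.2; rwa [add_zero] at this⟩

lemma IsNullSeq.smul {x : ℕ → ℝ} (hx : IsNullSeq x) {c : ℝ} (hc : 0 ≤ c) : IsNullSeq (c • x) :=
  ⟨fun _ _ h => mul_le_mul_of_nonneg_left (hx.1 h) hc,
    by have := hx.2.const_mul c; rwa [mul_zero] at this⟩

lemma IsNullSeq.hasSum {x : ℕ → ℝ} (hx : IsNullSeq x) (m : ℕ) :
    HasSum (fun j => x (j + m) - x (j + m + 1)) (x m) := by
  rw [hasSum_iff_tendsto_nat_of_nonneg fun j => sub_nonneg.2 (hx.1 (Nat.le_succ _))]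
  have h : ∀ n, ∑ j ∈ Finset.range n, (x (j + m) - x (j + m + 1)) = x m - x (n + m) := by
    intro n
    have := Finset.sum_range_sub' (fun j => x (j + m)) n
    simp only [zero_add] at this
    rw [← this]
    exact Finset.sum_congr rfl fun j _ => by rw [add_right_comm]
  simp only [h]
  simpa using tendsto_const_nhds.sub (hx.2.comp (tendsto_add_atTop_nat m))

lemma IsTraceSequence.summable_diag (hp : IsTraceSequence N τ α p) {x : ℕ → ℝ}
    (hx : IsNullSeq x) : Summable fun m => (x m - x (m + 1)) • partialSum p (m + 1) := by
  refine Summable.of_norm_bounded (hx.hasSum 0).summable fun m => ?_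
  rw [norm_smul, Real.norm_of_nonneg (sub_nonneg.2 (hx.1 (Nat.le_succ _)))]
  exact mul_le_of_le_one_right (sub_nonneg.2 (hx.1 (Nat.le_succ _)))
    (hp.isStarProjection_partialSum _).norm_le

lemma IsTraceSequence.hasSum_diag (hp : IsTraceSequence N τ α p) {x : ℕ → ℝ}
    (hx : IsNullSeq x) :
    HasSum (fun m => (x m - x (m + 1)) • partialSum p (m + 1)) (diag p x) :=
  (hp.summable_diag hx).hasSum

lemma IsTraceSequence.diag_mem (hp : IsTraceSequence N τ α p) {x : ℕ → ℝ}
    (hx : IsNullSeq x) : diag p x ∈ N := by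
  refine (isClosed_vonNeumannAlgebra N).mem_of_tendsto (hp.hasSum_diag hx) ?_
  exact Eventually.of_forall fun s => sum_mem fun m _ => real_smul_mem (hp.partialSum_mem _) _

lemma IsTraceSequence.diag_nonneg (hp : IsTraceSequence N τ α p) {x : ℕ → ℝ}
    (hx : IsNullSeq x) : 0 ≤ diag p x :=
  (hp.hasSum_diag hx).nonneg fun _ => smul_nonneg (sub_nonneg.2 (hx.1 (Nat.le_succ _)))
    (hp.isStarProjection_partialSum _).nonneg

lemma IsTraceSequence.diag_add (hp : IsTraceSequence N τ α p) {x y : ℕ → ℝ}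
    (hx : IsNullSeq x) (hy : IsNullSeq y) : diag p (x + y) = diag p x + diag p y := by
  refine (hp.hasSum_diag (hx.add hy)).unique ?_
  refine ((hp.hasSum_diag hx).add (hp.hasSum_diag hy)).congr_fun fun m => ?_
  rw [← add_smul]
  congr 1
  simp only [Pi.add_apply]
  ring

lemma diag_smul (p : ℕ → H →L[ℂ] H) (c : ℝ) (x : ℕ → ℝ) : diag p (c • x) = c • diag p x := by
  rw [diag, diag, ← tsum_const_smul'']
  refine tsum_congr fun m => ?_
  rw [smul_smul]
  simp only [Pi.smul_apply, smul_eq_mul, mul_sub]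

/-- The factor 1 - P_m annihilates the terms of index below m in the Abel series, and the
coefficients of the others sum to x_m. -/
lemma IsTraceSequence.norm_diag_mul_le (hp : IsTraceSequence N τ α p) {x : ℕ → ℝ}
    (hx : IsNullSeq x) (m : ℕ) : ‖diag p x * (1 - partialSum p m)‖ ≤ x m := by
  have h1 := (hp.hasSum_diag hx).mul_right (1 - partialSum p m)
  have h2 : ∀ j < m, (x j - x (j + 1)) • partialSum p (j + 1) * (1 - partialSum p m) = 0 := by
    intro j hj
    have h3 := (hp.isStarProjection_partialSum (j + 1)).le_iff_mul_eq_left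
      (hp.isStarProjection_partialSum m) |>.1 (hp.partialSum_mono hj)
    rw [smul_mul_assoc, mul_sub, mul_one, h3, sub_self, smul_zero]
  have h4 := (hasSum_nat_add_iff' m).2 h1
  rw [Finset.sum_eq_zero (fun j hj => h2 j (Finset.mem_range.1 hj)), sub_zero] at h4
  refine h4.norm_le_of_bounded (hx.hasSum m) fun j => ?_
  have h5 : 0 ≤ x (j + m) - x (j + m + 1) := sub_nonneg.2 (hx.1 (Nat.le_succ _))
  rw [smul_mul_assoc, norm_smul, Real.norm_of_nonneg h5]
  refine mul_le_of_le_one_right h5 ((norm_mul_le _ _).trans ?_)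
  exact mul_le_one₀ (hp.isStarProjection_partialSum _).norm_le (norm_nonneg _)
    (hp.isStarProjection_partialSum _).one_sub.norm_le

/-- Each partial sum from index m on dominates P_{m+1}, and the corresponding coefficients sum to
x_m. -/
lemma IsTraceSequence.smul_partialSum_le_diag (hp : IsTraceSequence N τ α p) {x : ℕ → ℝ}
    (hx : IsNullSeq x) (m : ℕ) : x m • partialSum p (m + 1) ≤ diag p x := by
  have h1 := (hasSum_nat_add_iff' m).2 (hp.hasSum_diag hx)
  have h2 := (hx.hasSum m).smul_const (partialSum p (m + 1))
  have h3 := hasSum_le (fun j => by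
    refine smul_le_smul_of_nonneg_left ?_ (sub_nonneg.2 (hx.1 (Nat.le_succ _)))
    exact hp.partialSum_mono (by omega)) h2 h1
  refine h3.trans (sub_le_self _ (Finset.sum_nonneg fun j _ => smul_nonneg
    (sub_nonneg.2 (hx.1 (Nat.le_succ _))) (hp.isStarProjection_partialSum _).nonneg))

lemma IsTraceSequence.le_norm_diag_apply (hp : IsTraceSequence N τ α p) {x : ℕ → ℝ}
    (hx : IsNullSeq x) (m : ℕ) {v : H} (hv : partialSum p (m + 1) v = v) :
    x m * ‖v‖ ≤ ‖diag p x v‖ := by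
  rcases eq_or_ne v 0 with rfl | hv0
  · simp
  have h1 := ((ContinuousLinearMap.le_def _ _).1
    (hp.smul_partialSum_le_diag hx m)).re_inner_nonneg_left v
  rw [sub_apply, inner_sub_left, map_sub, _root_.smul_apply, hv,
    ← Complex.coe_smul, inner_smul_left, inner_self_eq_norm_sq_to_K] at h1
  have h2 : RCLike.re (inner ℂ (diag p x v) v) ≤ ‖diag p x v‖ * ‖v‖ :=
    (RCLike.re_le_norm _).trans (norm_inner_le_norm _ _)
  have h3 : RCLike.re ((starRingEnd ℂ) (x m : ℂ) * ((‖v‖ : ℂ) ^ 2)) = x m * ‖v‖ ^ 2 := by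
    rw [Complex.conj_ofReal]
    norm_cast
  have h4 : x m * ‖v‖ * ‖v‖ ≤ ‖diag p x v‖ * ‖v‖ := by
    have : x m * ‖v‖ * ‖v‖ = x m * ‖v‖ ^ 2 := by ring
    rw [this, ← h3]
    exact (sub_nonneg.1 h1).trans h2
  exact le_of_mul_le_mul_right h4 (norm_pos_iff.2 hv0)

/-- The singular value function of a diagonal operator. -/
lemma IsTraceSequence.singularValue_diag (hp : IsTraceSequence N τ α p) (hτ : IsFNSTrace N τ)
    (hα : 0 < α) {x : ℕ → ℝ} (hx : IsNullSeq x) (t : ℝ) :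
    singularValue N τ (diag p x) t = x ⌊t / α⌋₊ := by
  set m := ⌊t / α⌋₊ with hm
  apply le_antisymm
  -- The projection P_m has trace mα ≤ t and can be discarded, whereas P_{m+1}, of trace (m+1)α > t,
  -- cannot; the two bounds meet at x_m.
  · refine le_trans ?_ (hp.norm_diag_mul_le hx m)
    refine singularValue_le_norm_mul (sub_mem (one_mem N) (hp.partialSum_mem m))
      (hp.isStarProjection_partialSum m).one_sub ?_
    rw [sub_sub_cancel, hp.trace_partialSum hτ]
    rcases le_total 0 t with ht | ht
    · refine ENNReal.ofReal_le_ofReal ?_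
      rw [← le_div_iff₀ hα]
      exact Nat.floor_le (by positivity)
    · have : m = 0 := Nat.floor_of_nonpos (div_nonpos_of_nonpos_of_nonneg ht hα.le)
      rw [this]
      simp
  · refine hτ.le_singularValue_of_lt (hp.partialSum_mem (m + 1))
      (hp.isStarProjection_partialSum (m + 1)) (fun v hv => hp.le_norm_diag_apply hx m hv) ?_
    rw [hp.trace_partialSum hτ]
    refine (ENNReal.ofReal_lt_ofReal_iff (by positivity)).2 ?_
    rw [← div_lt_iff₀ hα]
    push_cast
    exact Nat.lt_floor_add_one _

end Diagonal

/-! ### Marcinkiewicz sequences and functions -/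

/-- Decreasing null sequences with logarithmically bounded partial sums. -/
def IsMarcinkiewiczSeq (x : ℕ → ℝ) : Prop :=
  IsNullSeq x ∧ ∃ K : ℝ, ∀ m : ℕ, ∑ k ∈ Finset.range m, x k ≤ K * Real.log (1 + m)

/-- Decreasing nonnegative functions with logarithmically bounded integrals. -/
def IsMarcinkiewiczFun (x : ℝ → ℝ) : Prop :=
  Antitone x ∧ (∀ t, 0 ≤ x t) ∧
    ∃ K : ℝ, ∀ t : ℝ, 0 < t → ∫ s in (0 : ℝ)..t, x s ≤ K * Real.log (1 + t)

lemma log_one_add_nat_mul_le (n : ℕ) {s : ℝ} (hs : 0 ≤ s) :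
    Real.log (1 + n * s) ≤ n * Real.log (1 + s) := by
  rw [← Real.log_pow]
  exact Real.log_le_log (by positivity) (one_add_mul_le_pow (by linarith) n)

lemma log_one_add_nonneg {t : ℝ} (ht : 0 ≤ t) : 0 ≤ Real.log (1 + t) :=
  Real.log_nonneg (by linarith)

lemma log_one_add_mono {s t : ℝ} (hs : 0 ≤ s) (h : s ≤ t) : Real.log (1 + s) ≤ Real.log (1 + t) :=
  Real.log_le_log (by linarith) (by linarith)

lemma exists_log_one_add_mul_le {c : ℝ} (hc : 0 ≤ c) :
    ∃ C : ℝ, 0 ≤ C ∧ ∀ s : ℝ, 0 ≤ s → Real.log (1 + c * s) ≤ C * Real.log (1 + s) := by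
  obtain ⟨n, hn⟩ := exists_nat_ge c
  refine ⟨n, by positivity, fun s hs => ?_⟩
  refine (log_one_add_mono (by positivity) ?_).trans (log_one_add_nat_mul_le n hs)
  gcongr

lemma IsMarcinkiewiczSeq.add {x y : ℕ → ℝ} (hx : IsMarcinkiewiczSeq x)
    (hy : IsMarcinkiewiczSeq y) : IsMarcinkiewiczSeq (x + y) := by
  obtain ⟨hx, K, hK⟩ := hx
  obtain ⟨hy, L, hL⟩ := hy
  refine ⟨hx.add hy, K + L, fun m => ?_⟩
  simp only [Pi.add_apply, Finset.sum_add_distrib]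
  linarith [hK m, hL m]

lemma IsMarcinkiewiczSeq.smul {x : ℕ → ℝ} (hx : IsMarcinkiewiczSeq x) {c : ℝ} (hc : 0 ≤ c) :
    IsMarcinkiewiczSeq (c • x) := by
  obtain ⟨hx, K, hK⟩ := hx
  refine ⟨hx.smul hc, c * K, fun m => ?_⟩
  simp only [Pi.smul_apply, smul_eq_mul, ← Finset.mul_sum]
  rw [mul_assoc]
  exact mul_le_mul_of_nonneg_left (hK m) hc

lemma IsMarcinkiewiczSeq.of_le {x y : ℕ → ℝ} (hx : IsMarcinkiewiczSeq x) (hy : Antitone y)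
    (hy0 : ∀ k, 0 ≤ y k) (h : ∀ k, y k ≤ x k) : IsMarcinkiewiczSeq y := by
  obtain ⟨hx, K, hK⟩ := hx
  exact ⟨⟨hy, squeeze_zero hy0 h hx.2⟩, K, fun m => (Finset.sum_le_sum fun k _ => h k).trans (hK m)⟩

lemma isMarcinkiewiczSeq_one_div : IsMarcinkiewiczSeq fun k : ℕ => 1 / ((k : ℝ) + 1) := by
  refine ⟨⟨fun m n h => ?_, tendsto_one_div_add_atTop_nhds_zero_nat⟩, 2, fun m => ?_⟩
  · dsimp only
    gcongr
  · induction m with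
    | zero => simp
    | succ n ih =>
      rw [Finset.sum_range_succ]
      -- The bound 1 - 1/u ≤ log u at u = (n+2)/(n+1) gives 1/(n+2); the factor 2 covers the passage
      -- to 1/(n+1).
      have h1 : (1 : ℝ) / (n + 1) ≤ 2 * (Real.log (1 + (n + 1 : ℕ)) - Real.log (1 + n)) := by
        rw [← Real.log_div (by positivity) (by positivity)]
        have h2 := Real.one_sub_inv_le_log_of_pos
          (show (0 : ℝ) < (1 + (n + 1 : ℕ)) / (1 + n) by positivity)
        refine le_trans ?_ (mul_le_mul_of_nonneg_left h2 zero_le_two)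
        push_cast
        rw [inv_div]
        have : (1 : ℝ) - (1 + n) / (1 + (n + 1)) = 1 / (n + 2) := by
          field_simp
          ring
        rw [this, mul_one_div, div_le_div_iff₀ (by positivity) (by positivity)]
        linarith [(Nat.cast_nonneg n : (0 : ℝ) ≤ n)]
      linarith

/-- The sequence `(1, 0, 0, …)`. -/
def unitSeq : ℕ → ℝ := fun k => if k = 0 then 1 else 0

lemma isMarcinkiewiczSeq_unitSeq : IsMarcinkiewiczSeq unitSeq := by
  refine isMarcinkiewiczSeq_one_div.of_le (fun m n h => ?_) (fun k => ?_) fun k => ?_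
  · unfold unitSeq
    split_ifs with h1 h2
    · exact le_rfl
    · omega
    · exact zero_le_one
    · exact le_rfl
  · unfold unitSeq
    split_ifs <;> simp
  · unfold unitSeq
    split_ifs with h
    · simp [h]
    · positivity

lemma IsMarcinkiewiczSeq.shift {x : ℕ → ℝ} (hx : IsMarcinkiewiczSeq x) :
    IsMarcinkiewiczSeq fun k => x (k + 1) :=
  hx.of_le (fun _ _ h => hx.1.1 (Nat.succ_le_succ h)) (fun _ => hx.1.nonneg _)
    fun k => hx.1.1 (Nat.le_succ k)

lemma IsMarcinkiewiczSeq.subseq {x : ℕ → ℝ} (hx : IsMarcinkiewiczSeq x) {n : ℕ} (hn : 0 < n) :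
    IsMarcinkiewiczSeq fun k => x (n * (k + 1)) :=
  hx.of_le (fun _ _ h => hx.1.1 (by gcongr)) (fun _ => hx.1.nonneg _)
    fun k => hx.1.1 (by nlinarith)

lemma sum_range_mul {M : Type*} [AddCommMonoid M] (f : ℕ → M) (n m : ℕ) :
    ∑ j ∈ Finset.range (n * m), f j
      = ∑ k ∈ Finset.range m, ∑ i ∈ Finset.range n, f (n * k + i) := by
  induction m with
  | zero => simp
  | succ m ih => rw [Nat.mul_succ, Finset.sum_range_add, ih, Finset.sum_range_succ]

/-- Partial sums of block sums are partial sums of x with n times as many terms. This is the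
discrete form of dilating the upper limit of a primitive, and it costs at most a factor n in the
logarithm. -/
lemma IsMarcinkiewiczSeq.blockSum {x : ℕ → ℝ} (hx : IsMarcinkiewiczSeq x) (n : ℕ) :
    IsMarcinkiewiczSeq fun k => ∑ i ∈ Finset.range n, x (n * k + i) := by
  rcases Nat.eq_zero_or_pos n with rfl | hn
  · simp only [Finset.range_zero, Finset.sum_empty]
    have := hx.smul (le_refl (0 : ℝ))
    rw [zero_smul] at this
    exact this
  obtain ⟨hx, K, hK⟩ := hx
  refine ⟨⟨fun a b h => Finset.sum_le_sum fun i _ => hx.1 (by gcongr), ?_⟩, |K| * n, fun m => ?_⟩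
  · rw [← Finset.sum_const_zero (s := Finset.range n)]
    refine tendsto_finsetSum _ fun i _ => hx.2.comp ?_
    exact tendsto_atTop_mono
      (fun k => (Nat.le_mul_of_pos_left k hn).trans (Nat.le_add_right _ _)) tendsto_id
  · rw [← sum_range_mul]
    refine (hK _).trans ?_
    rw [mul_assoc]
    refine mul_le_mul (le_abs_self K) ?_ (log_one_add_nonneg (by positivity)) (abs_nonneg K)
    push_cast
    exact log_one_add_nat_mul_le n (by positivity)

lemma IsMarcinkiewiczSeq.blockConst {x : ℕ → ℝ} (hx : IsMarcinkiewiczSeq x) {n : ℕ} (hn : 0 < n) :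
    IsMarcinkiewiczSeq fun j => x (j / n) := by
  obtain ⟨hx, K, hK⟩ := hx
  have hanti : Antitone fun j => x (j / n) := fun a b h => hx.1 (Nat.div_le_div_right h)
  refine ⟨⟨hanti, hx.2.comp (Nat.tendsto_div_const_atTop hn.ne')⟩, n * |K|, fun m => ?_⟩
  have h1 : ∑ j ∈ Finset.range m, x (j / n) ≤ ∑ j ∈ Finset.range (n * m), x (j / n) :=
    Finset.sum_le_sum_of_subset_of_nonneg
      (Finset.range_mono (Nat.le_mul_of_pos_left m hn)) fun j _ _ => hx.nonneg _
  refine h1.trans ?_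
  rw [sum_range_mul]
  have h2 : ∀ k, ∑ i ∈ Finset.range n, x ((n * k + i) / n) = n * x k := fun k => by
    rw [Finset.sum_congr rfl fun i hi => by
      rw [Nat.mul_add_div hn, Nat.div_eq_of_lt (Finset.mem_range.1 hi), add_zero]]
    simp
  simp only [h2, ← Finset.mul_sum]
  rw [mul_assoc]
  refine mul_le_mul_of_nonneg_left ((hK m).trans ?_) (by positivity)
  exact mul_le_mul_of_nonneg_right (le_abs_self K) (log_one_add_nonneg (by positivity))

lemma IsMarcinkiewiczFun.intervalIntegrable {x : ℝ → ℝ} (hx : IsMarcinkiewiczFun x) (a b : ℝ) :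
    IntervalIntegrable x volume a b := hx.1.intervalIntegrable

lemma IsMarcinkiewiczFun.exists_bound {x : ℝ → ℝ} (hx : IsMarcinkiewiczFun x) :
    ∃ K : ℝ, 0 ≤ K ∧ ∀ t : ℝ, 0 ≤ t → ∫ s in (0 : ℝ)..t, x s ≤ K * Real.log (1 + t) := by
  obtain ⟨-, -, K, hK⟩ := hx
  refine ⟨|K|, abs_nonneg K, fun t ht => ?_⟩
  rcases ht.eq_or_lt with rfl | ht
  · simp
  · exact (hK t ht).trans (mul_le_mul_of_nonneg_right (le_abs_self K) (log_one_add_nonneg ht.le))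

lemma IsMarcinkiewiczFun.add {x y : ℝ → ℝ} (hx : IsMarcinkiewiczFun x)
    (hy : IsMarcinkiewiczFun y) : IsMarcinkiewiczFun (x + y) := by
  refine ⟨hx.1.add hy.1, fun t => add_nonneg (hx.2.1 t) (hy.2.1 t), ?_⟩
  obtain ⟨K, hK⟩ := hx.2.2
  obtain ⟨L, hL⟩ := hy.2.2
  refine ⟨K + L, fun t ht => ?_⟩
  simp only [Pi.add_apply]
  rw [intervalIntegral.integral_add (hx.intervalIntegrable _ _) (hy.intervalIntegrable _ _)]
  linarith [hK t ht, hL t ht]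

lemma IsMarcinkiewiczFun.smul {x : ℝ → ℝ} (hx : IsMarcinkiewiczFun x) {c : ℝ} (hc : 0 ≤ c) :
    IsMarcinkiewiczFun (c • x) := by
  refine ⟨fun s t h => mul_le_mul_of_nonneg_left (hx.1 h) hc,
    fun t => mul_nonneg hc (hx.2.1 t), ?_⟩
  obtain ⟨K, hK⟩ := hx.2.2
  refine ⟨c * K, fun t ht => ?_⟩
  simp only [Pi.smul_apply, smul_eq_mul]
  rw [intervalIntegral.integral_const_mul, mul_assoc]
  exact mul_le_mul_of_nonneg_left (hK t ht) hc

/-- The function `t ↦ 1 / (1 + t)`, whose integral over `(0, t)` is `log (1 + t)`. -/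
def logDensity (t : ℝ) : ℝ := 1 / (1 + max t 0)

lemma integral_logDensity {t : ℝ} (ht : 0 ≤ t) :
    ∫ s in (0 : ℝ)..t, logDensity s = Real.log (1 + t) := by
  have h1 : ∫ s in (0 : ℝ)..t, logDensity s = ∫ s in (0 : ℝ)..t, (1 + s)⁻¹ := by
    refine intervalIntegral.integral_congr fun s hs => ?_
    rw [uIcc_of_le ht] at hs
    simp only [logDensity, max_eq_left hs.1, one_div]
  rw [h1, intervalIntegral.integral_comp_add_left (fun u : ℝ => u⁻¹) 1,
    integral_inv_of_pos (by norm_num) (by linarith)]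
  simp

lemma isMarcinkiewiczFun_logDensity : IsMarcinkiewiczFun logDensity := by
  refine ⟨fun s t h => ?_, fun t => ?_, 1, fun t ht => ?_⟩
  · unfold logDensity
    gcongr
  · unfold logDensity
    positivity
  · rw [one_mul, integral_logDensity ht.le]

lemma Antitone.sum_le_integral_mul {x : ℝ → ℝ} (hx : Antitone x) {α : ℝ} (hα : 0 < α) (m : ℕ) :
    α * ∑ k ∈ Finset.range m, x ((k + 1 : ℕ) * α) ≤ ∫ s in (0 : ℝ)..(m * α), x s := by
  have h1 := AntitoneOn.sum_le_integral (x₀ := 0) (a := m) (f := fun u => x (u * α))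
    (fun a _ b _ h => hx (by gcongr))
  simp only [zero_add] at h1
  rw [intervalIntegral.integral_comp_mul_right x hα.ne', zero_mul, smul_eq_mul,
    le_inv_mul_iff₀ hα] at h1
  exact h1

lemma Antitone.integral_le_sum_mul {x : ℝ → ℝ} (hx : Antitone x) {α : ℝ} (hα : 0 < α) (m : ℕ) :
    ∫ s in (0 : ℝ)..(m * α), x s ≤ α * ∑ k ∈ Finset.range m, x (k * α) := by
  have h1 := AntitoneOn.integral_le_sum (x₀ := 0) (a := m) (f := fun u => x (u * α))
    (fun a _ b _ h => hx (by gcongr))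
  simp only [zero_add] at h1
  rw [intervalIntegral.integral_comp_mul_right x hα.ne', zero_mul, smul_eq_mul,
    inv_mul_le_iff₀ hα] at h1
  exact h1

lemma sum_range_le_add_shift {x : ℕ → ℝ} (hx : ∀ k, 0 ≤ x k) (m : ℕ) :
    ∑ k ∈ Finset.range m, x k ≤ x 0 + ∑ k ∈ Finset.range m, x (k + 1) := by
  have h1 : ∑ k ∈ Finset.range m, x k ≤ ∑ k ∈ Finset.range (m + 1), x k := by
    rw [Finset.sum_range_succ]
    linarith [hx m]
  rw [Finset.sum_range_succ'] at h1
  linarith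

/-- The samples at right endpoints are controlled by the integral. The remaining term x(0) is
absorbed because log(1+m) ≥ log 2 for m ≥ 1. -/
lemma IsMarcinkiewiczFun.sample {x : ℝ → ℝ} (hx : IsMarcinkiewiczFun x) {α : ℝ} (hα : 0 < α) :
    IsMarcinkiewiczSeq fun k => x (k * α) := by
  obtain ⟨K, hK0, hK⟩ := hx.exists_bound
  have hanti : Antitone fun k : ℕ => x (k * α) := fun a b h => hx.1 (by gcongr)
  obtain ⟨C, hC0, hC⟩ := exists_log_one_add_mul_le hα.le
  have hlog2 : 0 < Real.log 2 := Real.log_pos one_lt_two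
  have hbound : ∀ m : ℕ, ∑ k ∈ Finset.range m, x (k * α)
      ≤ (x 0 / Real.log 2 + α⁻¹ * (K * C)) * Real.log (1 + m) := by
    intro m
    rcases Nat.eq_zero_or_pos m with rfl | hm
    · simp
    have h1 := sum_range_le_add_shift (x := fun k : ℕ => x (k * α)) (fun k => hx.2.1 _) m
    have h2 := Antitone.sum_le_integral_mul hx.1 hα m
    have h3 := hK (m * α) (by positivity)
    have h4 := hC m (by positivity)
    have h5 : Real.log 2 ≤ Real.log (1 + m) := by
      refine Real.log_le_log two_pos ?_
      have : (1 : ℝ) ≤ m := by exact_mod_cast hm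
      linarith
    have h6 : x 0 ≤ x 0 / Real.log 2 * Real.log (1 + m) := by
      rw [div_mul_eq_mul_div, le_div_iff₀ hlog2]
      exact mul_le_mul_of_nonneg_left h5 (hx.2.1 0)
    have h7 : ∑ k ∈ Finset.range m, x ((k + 1 : ℕ) * α) ≤ α⁻¹ * (K * (C * Real.log (1 + m))) := by
      rw [le_inv_mul_iff₀ hα]
      refine h2.trans (h3.trans ?_)
      rw [mul_comm (m : ℝ) α]
      exact mul_le_mul_of_nonneg_left h4 hK0
    simp only [Nat.cast_zero, zero_mul] at h1
    nlinarith
  refine ⟨⟨hanti, ?_⟩, _, hbound⟩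
  set D := x 0 / Real.log 2 + α⁻¹ * (K * C) with hD
  -- By monotonicity m x(mα) is at most the partial sum, hence O(log m), which forces the samples to
  -- tend to 0.
  have hlim : Tendsto (fun m : ℕ => D * (Real.log (1 + m) / (1 + m)) * 2) atTop (𝓝 0) := by
    have h8 : Tendsto (fun u : ℝ => Real.log u / u) atTop (𝓝 0) :=
      Real.isLittleO_log_id_atTop.tendsto_div_nhds_zero
    have h9 : Tendsto (fun m : ℕ => (1 : ℝ) + m) atTop atTop :=
      tendsto_atTop_add_const_left _ _ tendsto_natCast_atTop_atTop
    have := ((h8.comp h9).const_mul D).mul_const 2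
    simpa using this
  refine squeeze_zero' (Eventually.of_forall fun k => hx.2.1 _) ?_ hlim
  filter_upwards [eventually_ge_atTop 1] with m hm
  have hm1 : (1 : ℝ) ≤ m := by exact_mod_cast hm
  have h10 : m * x (m * α) ≤ ∑ k ∈ Finset.range m, x (k * α) := by
    have := Finset.sum_le_sum (s := Finset.range m) (f := fun _ => x (m * α))
      (g := fun k : ℕ => x (k * α)) fun k hk => hanti (Finset.mem_range.1 hk).le
    simpa using this
  have h11 := h10.trans (hbound m)
  rw [mul_div_assoc', div_mul_eq_mul_div, le_div_iff₀ (by positivity)]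
  nlinarith [hx.2.1 (m * α)]

/-! ### Integrals of step functions -/

lemma antitone_step {x : ℕ → ℝ} (hx : Antitone x) {α : ℝ} (hα : 0 < α) :
    Antitone fun s : ℝ => x ⌊s / α⌋₊ := fun a b h => hx (Nat.floor_mono (by gcongr))

lemma integral_step_aux {x : ℕ → ℝ} {α : ℝ} (hα : 0 < α) {m : ℕ} {t : ℝ} (h1 : m * α ≤ t)
    (h2 : t ≤ (m + 1 : ℕ) * α) : ∫ s in (m * α)..t, x ⌊s / α⌋₊ = (t - m * α) * x m := by
  have h : ∫ s in (m * α)..t, x ⌊s / α⌋₊ = ∫ s in (m * α)..t, x m := by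
    refine intervalIntegral.integral_congr_Ioo_of_le h1 fun s hs => ?_
    have : ⌊s / α⌋₊ = m := by
      rw [Nat.floor_eq_iff (by have := hs.1; have : 0 ≤ m * α := by positivity
                               exact div_nonneg (by linarith) hα.le)]
      rw [le_div_iff₀ hα, div_lt_iff₀ hα]
      refine ⟨hs.1.le, hs.2.trans_le ?_⟩
      exact_mod_cast h2
    simp only [this]
  rw [h, intervalIntegral.integral_const, smul_eq_mul]

lemma integral_step_nat {x : ℕ → ℝ} (hx : Antitone x) {α : ℝ} (hα : 0 < α) (m : ℕ) :
    ∫ s in (0 : ℝ)..(m * α), x ⌊s / α⌋₊ = α * ∑ k ∈ Finset.range m, x k := by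
  induction m with
  | zero => simp
  | succ m ih =>
    have hInt : ∀ a b, IntervalIntegrable (fun s : ℝ => x ⌊s / α⌋₊) volume a b :=
      fun a b => (antitone_step hx hα).intervalIntegrable
    rw [← intervalIntegral.integral_add_adjacent_intervals (hInt 0 (m * α)) (hInt _ _), ih,
      integral_step_aux hα (by push_cast; nlinarith) le_rfl, Finset.sum_range_succ]
    push_cast
    ring

lemma integral_step {x : ℕ → ℝ} (hx : Antitone x) {α : ℝ} (hα : 0 < α) {t : ℝ} (ht : 0 ≤ t) :
    ∫ s in (0 : ℝ)..t, x ⌊s / α⌋₊ = α * ∑ k ∈ Finset.range ⌊t / α⌋₊, x k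
      + (t - ⌊t / α⌋₊ * α) * x ⌊t / α⌋₊ := by
  have hInt : ∀ a b, IntervalIntegrable (fun s : ℝ => x ⌊s / α⌋₊) volume a b :=
    fun a b => (antitone_step hx hα).intervalIntegrable
  have h1 : ⌊t / α⌋₊ * α ≤ t := by
    rw [← le_div_iff₀ hα]
    exact Nat.floor_le (by positivity)
  have h2 : t ≤ (⌊t / α⌋₊ + 1 : ℕ) * α := by
    rw [← div_le_iff₀ hα]
    push_cast
    exact (Nat.lt_floor_add_one _).le
  rw [← intervalIntegral.integral_add_adjacent_intervals (hInt 0 (⌊t / α⌋₊ * α)) (hInt _ _),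
    integral_step_nat hx hα, integral_step_aux hα h1 h2]

/-- Both primitives are affine between consecutive multiples of α, so comparison at these nodes
suffices. -/
lemma integral_step_le {x y : ℕ → ℝ} (hx : Antitone x) (hy : Antitone y) {α : ℝ} (hα : 0 < α)
    (h : ∀ m, ∑ k ∈ Finset.range m, x k ≤ ∑ k ∈ Finset.range m, y k) {t : ℝ} (ht : 0 ≤ t) :
    ∫ s in (0 : ℝ)..t, x ⌊s / α⌋₊ ≤ ∫ s in (0 : ℝ)..t, y ⌊s / α⌋₊ := by
  rw [integral_step hx hα ht, integral_step hy hα ht]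
  set m := ⌊t / α⌋₊ with hm
  have h1 : m * α ≤ t := by
    rw [← le_div_iff₀ hα]
    exact Nat.floor_le (by positivity)
  have h2 : t ≤ (m + 1) * α := by
    rw [← div_le_iff₀ hα]
    exact (Nat.lt_floor_add_one _).le
  have h3 := h m
  have h4 := h (m + 1)
  rw [Finset.sum_range_succ, Finset.sum_range_succ] at h4
  nlinarith

/-! ### Diagonal operators in the Marcinkiewicz space -/

section Diagonal

variable {N : VonNeumannAlgebra H} {τ : (H →L[ℂ] H) → ℝ≥0∞} {α : ℝ} {p : ℕ → H →L[ℂ] H}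

lemma IsTraceSequence.majorized_diag {p' : ℕ → H →L[ℂ] H} (hp : IsTraceSequence N τ α p)
    (hp' : IsTraceSequence N τ α p') (hτ : IsFNSTrace N τ) (hα : 0 < α) {x y : ℕ → ℝ}
    (hx : IsNullSeq x) (hy : IsNullSeq y)
    (h : ∀ m, ∑ k ∈ Finset.range m, x k ≤ ∑ k ∈ Finset.range m, y k) :
    Majorized N τ (diag p x) (diag p' y) := by
  intro t ht
  simp only [hp.singularValue_diag hτ hα hx, hp'.singularValue_diag hτ hα hy]
  exact integral_step_le hx.1 hy.1 hα h ht

lemma IsTraceSequence.diag_mem_marcinkiewicz (hp : IsTraceSequence N τ α p)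
    (hτ : IsFNSTrace N τ) (hα : 0 < α) {x : ℕ → ℝ} (hx : IsMarcinkiewiczSeq x) :
    diag p x ∈ marcinkiewicz N τ := by
  obtain ⟨hx, K, hK⟩ := hx
  obtain ⟨C, hC0, hC⟩ := exists_log_one_add_mul_le (inv_nonneg.2 hα.le)
  refine mem_marcinkiewicz_iff.2 ⟨hp.diag_mem hx, x 0 * (1 + α) + 2 * α * |K| * C, fun t ht => ?_⟩
  simp only [hp.singularValue_diag hτ hα hx]
  have hx0 := hx.nonneg 0
  have hlog := log_one_add_pos ht
  -- For t < α the primitive is x_0 t, and t ≤ (1+t) log(1+t) ≤ (1+α) log(1+t). For t ≥ α it is at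
  -- most a partial sum with ⌊t/α⌋ + 1 terms.
  rcases lt_or_ge t α with htα | htα
  · have h1 : ∫ s in (0 : ℝ)..t, x ⌊s / α⌋₊ ≤ x 0 * t := by
      rw [integral_step hx.1 hα ht.le]
      have : ⌊t / α⌋₊ = 0 := by
        rw [Nat.floor_eq_zero, div_lt_one hα]
        exact htα
      rw [this]
      simp [mul_comm]
    have h2 : t ≤ (1 + α) * Real.log (1 + t) := by
      have h3 := Real.one_sub_inv_le_log_of_pos (show 0 < 1 + t by linarith)
      have h4 : 1 - (1 + t)⁻¹ = t / (1 + t) := by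
        field_simp
        ring
      rw [h4, div_le_iff₀ (by linarith)] at h3
      nlinarith
    have h5 : x 0 * t ≤ x 0 * ((1 + α) * Real.log (1 + t)) := mul_le_mul_of_nonneg_left h2 hx0
    have h6 : 0 ≤ 2 * α * |K| * C * Real.log (1 + t) := by positivity
    nlinarith
  · set m := ⌊t / α⌋₊ with hm
    have hm1 : 1 ≤ m := Nat.one_le_floor_iff _ |>.2 ((one_le_div hα).2 htα)
    have hmle : (m : ℝ) ≤ α⁻¹ * t := by
      rw [inv_mul_eq_div]
      exact Nat.floor_le (by positivity)
    have h1 : ∫ s in (0 : ℝ)..t, x ⌊s / α⌋₊ ≤ α * ∑ k ∈ Finset.range (m + 1), x k := by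
      rw [integral_step hx.1 hα ht.le, Finset.sum_range_succ]
      have h2 : t ≤ (m + 1) * α := by
        rw [← div_le_iff₀ hα]
        exact (Nat.lt_floor_add_one _).le
      nlinarith [hx.nonneg m]
    have h3 : Real.log (1 + (m + 1 : ℕ)) ≤ 2 * (C * Real.log (1 + t)) := by
      have hm1' : (1 : ℝ) ≤ m := by exact_mod_cast hm1
      calc Real.log (1 + (m + 1 : ℕ)) ≤ Real.log (1 + (2 : ℕ) * m) := by
            refine log_one_add_mono (by positivity) ?_
            push_cast
            linarith
        _ ≤ (2 : ℕ) * Real.log (1 + m) := log_one_add_nat_mul_le 2 (by positivity)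
        _ ≤ 2 * (C * Real.log (1 + t)) := by
            push_cast
            refine mul_le_mul_of_nonneg_left ?_ zero_le_two
            exact (log_one_add_mono (by positivity) hmle).trans (hC t ht.le)
    have h4 : ∑ k ∈ Finset.range (m + 1), x k ≤ |K| * (2 * (C * Real.log (1 + t))) :=
      (hK _).trans (mul_le_mul (le_abs_self K) h3 (log_one_add_nonneg (by positivity))
        (abs_nonneg K))
    have h5 := mul_le_mul_of_nonneg_left h4 hα.le
    have h6 : 0 ≤ x 0 * (1 + α) * Real.log (1 + t) := by positivity
    nlinarith

lemma sum_partialSum_residue (p : ℕ → H →L[ℂ] H) (n m : ℕ) :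
    ∑ i ∈ Finset.range n, partialSum (p ∘ fun k => n * k + i) m = partialSum p (n * m) := by
  simp only [partialSum, Function.comp_apply]
  rw [Finset.sum_comm, sum_range_mul]

/-- A diagonal operator with entries constant on blocks of length `n` is the sum of `n` diagonal
operators along the residue classes. -/
lemma IsTraceSequence.diag_blockConst (hp : IsTraceSequence N τ α p) {x : ℕ → ℝ}
    (hx : IsMarcinkiewiczSeq x) {n : ℕ} (hn : 0 < n) :
    diag p (fun j => x (j / n)) = ∑ i ∈ Finset.range n, diag (p ∘ fun k => n * k + i) x := by
  have hinj : ∀ i, Function.Injective fun k => n * k + i := fun i a b h =>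
    Nat.eq_of_mul_eq_mul_left hn (Nat.add_right_cancel h)
  have h1 := hp.hasSum_diag (hx.blockConst hn).1
  have h2 := hasSum_sum (s := Finset.range n) fun i _ => (hp.comp (hinj i)).hasSum_diag hx.1
  simp only [← Finset.smul_sum, sum_partialSum_residue] at h2
  refine h1.unique ?_
  -- The coefficient x(j/n) - x((j+1)/n) vanishes unless n divides j+1, so the series may be
  -- reindexed by j = n(m+1) - 1.
  have hg : Function.Injective fun m => n * (m + 1) - 1 := fun a b h => by
    have ha : 0 < n * (a + 1) := by positivity
    have hb : 0 < n * (b + 1) := by positivity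
    have h' : n * (a + 1) = n * (b + 1) := by
      simp only at h
      omega
    exact Nat.succ_injective (Nat.eq_of_mul_eq_mul_left hn h')
  refine (hg.hasSum_iff ?_).1 ?_
  · intro j hj
    have h3 : (j + 1) / n = j / n := by
      rw [Nat.succ_div, if_neg, add_zero]
      rintro ⟨k, hk⟩
      refine hj ⟨k - 1, ?_⟩
      have hk0 : k ≠ 0 := by
        rintro rfl
        simp at hk
      have : k - 1 + 1 = k := by omega
      simp only [this, ← hk, Nat.add_sub_cancel]
    simp only [h3, sub_self, zero_smul]
  · convert h2 using 2 with m
    have ha : 0 < n * (m + 1) := by positivity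
    have h4 : n * (m + 1) - 1 + 1 = n * (m + 1) := by omega
    have h5 : (n * (m + 1) - 1) / n = m := by
      rw [Nat.div_eq_iff hn]
      constructor
      · rw [mul_comm, Nat.mul_succ]
        omega
      · rw [mul_comm m n, Nat.mul_succ]
    simp only [Function.comp_apply, h4, h5, Nat.mul_div_cancel_left _ hn]

end Diagonal

section FullySymmetric

variable {N : VonNeumannAlgebra H} {τ : (H →L[ℂ] H) → ℝ≥0∞} {α : ℝ} {p : ℕ → H →L[ℂ] H}
  {φ : (H →L[ℂ] H) → ℂ}

/-! ### Fully symmetric functionals on diagonal operators -/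

lemma IsFNSTrace.zero_mem_marcinkiewicz (hτ : IsFNSTrace N τ) :
    (0 : H →L[ℂ] H) ∈ marcinkiewicz N τ := by
  refine mem_marcinkiewicz_iff.2 ⟨zero_mem N, 0, fun t ht => ?_⟩
  have h0 : ∀ s, singularValue N τ (0 : H →L[ℂ] H) s = 0 := fun s =>
    le_antisymm (by simpa using hτ.singularValue_le_norm 0 s) (singularValue_nonneg N τ 0 s)
  simp [h0]

lemma IsFullySymmetric.nonneg (hφ : IsFullySymmetric N τ φ) (hτ : IsFNSTrace N τ)
    {A : H →L[ℂ] H} (hA : A ∈ marcinkiewicz N τ) (hA0 : 0 ≤ A) : 0 ≤ φ A := by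
  have h0 : φ 0 = 0 := by
    have := hφ.map_smul 0 A hA
    rwa [zero_smul, zero_mul] at this
  rw [← h0]
  refine hφ.mono A hA 0 hτ.zero_mem_marcinkiewicz hA0 le_rfl fun t ht => ?_
  refine intervalIntegral.integral_mono_on ht (hτ.intervalIntegrable_singularValue 0 0 t)
    (hτ.intervalIntegrable_singularValue A 0 t) fun s _ => ?_
  refine le_trans ?_ (singularValue_nonneg N τ A s)
  simpa using hτ.singularValue_le_norm 0 s

lemma IsFullySymmetric.eq_ofReal_re (hφ : IsFullySymmetric N τ φ) (hτ : IsFNSTrace N τ)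
    {A : H →L[ℂ] H} (hA : A ∈ marcinkiewicz N τ) (hA0 : 0 ≤ A) : φ A = ((φ A).re : ℂ) := by
  have := (Complex.nonneg_iff.1 (hφ.nonneg hτ hA hA0)).2
  exact Complex.ext rfl this.symm

/-- The functional on sequences induced by a functional on operators. -/
def seqFunctional (φ : (H →L[ℂ] H) → ℂ) (p : ℕ → H →L[ℂ] H) (x : ℕ → ℝ) : ℝ := (φ (diag p x)).re

lemma IsFullySymmetric.seqFunctional_nonneg (hφ : IsFullySymmetric N τ φ) (hτ : IsFNSTrace N τ)
    (hα : 0 < α) (hp : IsTraceSequence N τ α p) {x : ℕ → ℝ} (hx : IsMarcinkiewiczSeq x) :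
    0 ≤ seqFunctional φ p x :=
  (Complex.nonneg_iff.1 (hφ.nonneg hτ (hp.diag_mem_marcinkiewicz hτ hα hx)
    (hp.diag_nonneg hx.1))).1

lemma IsFullySymmetric.seqFunctional_add (hφ : IsFullySymmetric N τ φ) (hτ : IsFNSTrace N τ)
    (hα : 0 < α) (hp : IsTraceSequence N τ α p) {x y : ℕ → ℝ} (hx : IsMarcinkiewiczSeq x)
    (hy : IsMarcinkiewiczSeq y) :
    seqFunctional φ p (x + y) = seqFunctional φ p x + seqFunctional φ p y := by
  rw [seqFunctional, hp.diag_add hx.1 hy.1, hφ.map_add _ (hp.diag_mem_marcinkiewicz hτ hα hx) _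
    (hp.diag_mem_marcinkiewicz hτ hα hy), Complex.add_re]
  rfl

lemma IsFullySymmetric.seqFunctional_smul (hφ : IsFullySymmetric N τ φ) (hτ : IsFNSTrace N τ)
    (hα : 0 < α) (hp : IsTraceSequence N τ α p) {x : ℕ → ℝ} (hx : IsMarcinkiewiczSeq x) (c : ℝ) :
    seqFunctional φ p (c • x) = c * seqFunctional φ p x := by
  rw [seqFunctional, diag_smul, ← Complex.coe_smul,
    hφ.map_smul _ _ (hp.diag_mem_marcinkiewicz hτ hα hx), Complex.re_ofReal_mul]
  rfl

lemma IsFullySymmetric.seqFunctional_le (hφ : IsFullySymmetric N τ φ) (hτ : IsFNSTrace N τ)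
    (hα : 0 < α) {p' : ℕ → H →L[ℂ] H} (hp : IsTraceSequence N τ α p)
    (hp' : IsTraceSequence N τ α p') {x y : ℕ → ℝ} (hx : IsMarcinkiewiczSeq x)
    (hy : IsMarcinkiewiczSeq y)
    (h : ∀ m, ∑ k ∈ Finset.range m, x k ≤ ∑ k ∈ Finset.range m, y k) :
    seqFunctional φ p x ≤ seqFunctional φ p' y :=
  (Complex.le_def.1 (hφ.mono _ (hp'.diag_mem_marcinkiewicz hτ hα hy) _
    (hp.diag_mem_marcinkiewicz hτ hα hx) (hp'.diag_nonneg hy.1) (hp.diag_nonneg hx.1)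
    (hp.majorized_diag hp' hτ hα hx.1 hy.1 h))).1

/-- Along each residue class modulo n the diagonal operator with entries x has the same singular
values as `diag p x`, so φ takes the same value on all n summands. -/
lemma IsFullySymmetric.seqFunctional_blockConst (hφ : IsFullySymmetric N τ φ)
    (hτ : IsFNSTrace N τ) (hα : 0 < α) (hp : IsTraceSequence N τ α p) {x : ℕ → ℝ}
    (hx : IsMarcinkiewiczSeq x) {n : ℕ} (hn : 0 < n) :
    seqFunctional φ p (fun j => x (j / n)) = n * seqFunctional φ p x := by
  have hinj : ∀ i, Function.Injective fun k => n * k + i := fun i a b h =>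
    Nat.eq_of_mul_eq_mul_left hn (Nat.add_right_cancel h)
  have hsum : ∀ s : Finset ℕ, (∑ i ∈ s, diag (p ∘ fun k => n * k + i) x) ∈ marcinkiewicz N τ ∧
      (φ (∑ i ∈ s, diag (p ∘ fun k => n * k + i) x)).re
        = ∑ i ∈ s, seqFunctional φ (p ∘ fun k => n * k + i) x := by
    intro s
    induction s using Finset.induction_on with
    | empty =>
      refine ⟨by simpa using hτ.zero_mem_marcinkiewicz, ?_⟩
      have := hφ.map_smul 0 0 hτ.zero_mem_marcinkiewicz
      rw [zero_smul, zero_mul] at this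
      simp [this]
    | insert i s hi ih =>
      have h1 := (hp.comp (hinj i)).diag_mem_marcinkiewicz hτ hα hx
      rw [Finset.sum_insert hi, Finset.sum_insert hi]
      refine ⟨hτ.add_mem_marcinkiewicz h1 ih.1, ?_⟩
      rw [hφ.map_add _ h1 _ ih.1, Complex.add_re, ih.2]
      rfl
  rw [seqFunctional, hp.diag_blockConst hx hn, (hsum _).2]
  have heq : ∀ i, seqFunctional φ (p ∘ fun k => n * k + i) x = seqFunctional φ p x := fun i =>
    le_antisymm (hφ.seqFunctional_le hτ hα (hp.comp (hinj i)) hp hx hx fun _ => le_rfl)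
      (hφ.seqFunctional_le hτ hα hp (hp.comp (hinj i)) hx hx fun _ => le_rfl)
  simp [heq]

lemma unitSeq_div (n j : ℕ) (hn : 0 < n) : unitSeq (j / n) = if j < n then 1 else 0 := by
  unfold unitSeq
  congr 1
  rw [Nat.div_eq_zero_iff_lt hn]

/-- Fully symmetric functionals vanish on operators of finite rank. -/
lemma IsFullySymmetric.seqFunctional_unitSeq (hφ : IsFullySymmetric N τ φ) (hτ : IsFNSTrace N τ)
    (hα : 0 < α) (hp : IsTraceSequence N τ α p) : seqFunctional φ p unitSeq = 0 := by
  set v := seqFunctional φ p unitSeq with hv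
  have hv0 : 0 ≤ v := hφ.seqFunctional_nonneg hτ hα hp isMarcinkiewiczSeq_unitSeq
  let ρ : ℕ → ℝ := fun k => 1 / ((k : ℝ) + 1)
  -- The harmonic sequence lowered by ρ_J and cut off at 0, written as a combination of indicators
  -- of initial segments. On the indicator of length n+1 the functional takes the value (n+1)v.
  let y : ℕ → ℕ → ℝ := fun J => ∑ n ∈ Finset.range J,
    (ρ n - ρ (n + 1)) • fun j : ℕ => unitSeq (j / (n + 1))
  have hρ : ∀ n, 0 ≤ ρ n - ρ (n + 1) := fun n =>
    sub_nonneg.2 (isMarcinkiewiczSeq_one_div.1.1 (Nat.le_succ n))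
  have hsum : ∀ J, IsMarcinkiewiczSeq (y J) ∧
      seqFunctional φ p (y J) = (∑ n ∈ Finset.range J, (ρ n - ρ (n + 1)) * (n + 1)) * v := by
    intro J
    induction J with
    | zero =>
      have h0 := isMarcinkiewiczSeq_unitSeq.smul (le_refl (0 : ℝ))
      have h1 := hφ.seqFunctional_smul hτ hα hp isMarcinkiewiczSeq_unitSeq 0
      rw [zero_smul] at h0 h1
      simp only [y, Finset.range_zero, Finset.sum_empty]
      exact ⟨h0, by rw [h1]⟩
    | succ J ih =>
      have hb := isMarcinkiewiczSeq_unitSeq.blockConst (Nat.succ_pos J)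
      have h1 : y (J + 1) = y J + (ρ J - ρ (J + 1)) • fun j : ℕ => unitSeq (j / (J + 1)) :=
        Finset.sum_range_succ _ _
      rw [h1]
      refine ⟨ih.1.add (hb.smul (hρ J)), ?_⟩
      rw [hφ.seqFunctional_add hτ hα hp ih.1 (hb.smul (hρ J)),
        hφ.seqFunctional_smul hτ hα hp hb, ih.2,
        hφ.seqFunctional_blockConst hτ hα hp isMarcinkiewiczSeq_unitSeq (Nat.succ_pos J),
        Finset.sum_range_succ]
      push_cast
      ring
  have hle : ∀ J k, y J k = max 0 (ρ k - ρ J) := by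
    intro J k
    induction J with
    | zero =>
      have : ρ k ≤ ρ 0 := isMarcinkiewiczSeq_one_div.1.1 (Nat.zero_le k)
      simp only [y, Finset.range_zero, Finset.sum_empty, Pi.zero_apply]
      exact (max_eq_left (by linarith)).symm
    | succ J ih =>
      have h1 : y (J + 1) = y J + (ρ J - ρ (J + 1)) • fun j : ℕ => unitSeq (j / (J + 1)) :=
        Finset.sum_range_succ _ _
      rw [h1, Pi.add_apply, ih, Pi.smul_apply, unitSeq_div _ _ (Nat.succ_pos J), smul_eq_mul]
      have hd := hρ J
      rcases lt_or_ge k (J + 1) with h | h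
      · have h2 : ρ J ≤ ρ k := isMarcinkiewiczSeq_one_div.1.1 (Nat.lt_succ_iff.1 h)
        rw [if_pos h, max_eq_right (by linarith), max_eq_right (by linarith)]
        ring
      · have h2 : ρ k ≤ ρ (J + 1) := isMarcinkiewiczSeq_one_div.1.1 h
        rw [if_neg (not_lt.2 h), max_eq_left (by linarith), max_eq_left (by linarith)]
        ring
  have hρ0 : ∀ k, 0 ≤ ρ k := fun k => isMarcinkiewiczSeq_one_div.1.nonneg k
  have hbound : ∀ J, (∑ n ∈ Finset.range J, (ρ n - ρ (n + 1)) * (n + 1)) * v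
      ≤ seqFunctional φ p ρ := fun J => by
    rw [← (hsum J).2]
    refine hφ.seqFunctional_le hτ hα hp hp (hsum J).1 isMarcinkiewiczSeq_one_div fun m =>
      Finset.sum_le_sum fun k _ => ?_
    rw [hle]
    exact max_le (hρ0 k) (by linarith [hρ0 J])
  by_contra hne
  have hvpos : 0 < v := lt_of_le_of_ne hv0 (Ne.symm hne)
  obtain ⟨J, hJ⟩ := (Real.tendsto_sum_range_one_div_nat_succ_atTop.eventually_gt_atTop
    (2 * (seqFunctional φ p ρ / v))).exists
  -- The weights are (ρ_n - ρ_{n+1})(n+1) = 1/(n+2), so the lower bounds for the value at the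
  -- harmonic sequence diverge unless v = 0.
  have h1 : ∑ n ∈ Finset.range J, 1 / ((n : ℝ) + 1)
      ≤ 2 * ∑ n ∈ Finset.range J, (ρ n - ρ (n + 1)) * (n + 1) := by
    rw [Finset.mul_sum]
    refine Finset.sum_le_sum fun n _ => ?_
    simp only [ρ]
    push_cast
    have : (1 / ((n : ℝ) + 1) - 1 / (n + 1 + 1)) * (n + 1) = 1 / (n + 2) := by
      field_simp
      ring
    rw [this, mul_one_div, div_le_div_iff₀ (by positivity) (by positivity)]
    linarith [(Nat.cast_nonneg n : (0 : ℝ) ≤ n)]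
  have h2 := hbound J
  rw [← le_div_iff₀ hvpos] at h2
  linarith

/-- As `seqFunctional` annihilates `unitSeq`, adding x_0 + b to the first entry of y costs nothing.
That entry pays for the missing term x_0 and for the bounded error. -/
lemma IsFullySymmetric.seqFunctional_le_shift (hφ : IsFullySymmetric N τ φ) (hτ : IsFNSTrace N τ)
    (hα : 0 < α) (hp : IsTraceSequence N τ α p) {x y : ℕ → ℝ} {b : ℝ} (hb : 0 ≤ b)
    (hx : IsMarcinkiewiczSeq x) (hy : IsMarcinkiewiczSeq y)
    (h : ∀ m, ∑ k ∈ Finset.range m, x (k + 1) ≤ ∑ k ∈ Finset.range m, y k + b) :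
    seqFunctional φ p x ≤ seqFunctional φ p y := by
  have hc : 0 ≤ x 0 + b := add_nonneg (hx.1.nonneg 0) hb
  have hu := isMarcinkiewiczSeq_unitSeq.smul hc
  have h1 : seqFunctional φ p ((x 0 + b) • unitSeq + y) = seqFunctional φ p y := by
    rw [hφ.seqFunctional_add hτ hα hp hu hy, hφ.seqFunctional_smul hτ hα hp
      isMarcinkiewiczSeq_unitSeq, hφ.seqFunctional_unitSeq hτ hα hp, mul_zero, zero_add]
  rw [← h1]
  refine hφ.seqFunctional_le hτ hα hp hp hx (hu.add hy) fun m => ?_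
  rcases Nat.eq_zero_or_pos m with rfl | hm
  · simp
  simp only [Pi.add_apply, Pi.smul_apply, smul_eq_mul, Finset.sum_add_distrib, ← Finset.mul_sum]
  have h2 : ∑ k ∈ Finset.range m, unitSeq k = 1 := by
    unfold unitSeq
    rw [Finset.sum_ite_eq' (Finset.range m) 0 (fun _ => (1 : ℝ)), if_pos (Finset.mem_range.2 hm)]
  rw [h2, mul_one]
  have h3 := sum_range_le_add_shift (fun k => hx.1.nonneg k) m
  linarith [h m]

/-- After a free shift, a block sum is at most n x(n(k+1)). The factor n becomes repetition in
blocks of length n, and the repeated sequence is below x because n(j/n + 1) > j. -/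
lemma IsFullySymmetric.seqFunctional_blockSum_le (hφ : IsFullySymmetric N τ φ)
    (hτ : IsFNSTrace N τ) (hα : 0 < α) (hp : IsTraceSequence N τ α p) {x : ℕ → ℝ}
    (hx : IsMarcinkiewiczSeq x) {n : ℕ} (hn : 0 < n) :
    seqFunctional φ p (fun k => ∑ i ∈ Finset.range n, x (n * k + i)) ≤ seqFunctional φ p x := by
  have hs := hx.subseq hn
  calc _ ≤ seqFunctional φ p ((n : ℝ) • fun k => x (n * (k + 1))) := by
        refine hφ.seqFunctional_le_shift hτ hα hp le_rfl (hx.blockSum n)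
          (hs.smul (Nat.cast_nonneg n)) fun m => ?_
        rw [add_zero]
        refine Finset.sum_le_sum fun k _ => ?_
        rw [Pi.smul_apply, smul_eq_mul]
        have := Finset.sum_le_sum (s := Finset.range n) (f := fun i => x (n * (k + 1) + i))
          (g := fun _ => x (n * (k + 1))) fun i _ => hx.1.1 (Nat.le_add_right _ _)
        simpa using this
    _ = seqFunctional φ p (fun j => x (n * (j / n + 1))) := by
        rw [hφ.seqFunctional_smul hτ hα hp hs,
          ← hφ.seqFunctional_blockConst hτ hα hp hs hn]
    _ ≤ seqFunctional φ p x := by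
        refine hφ.seqFunctional_le hτ hα hp hp (hs.blockConst hn) hx fun m =>
          Finset.sum_le_sum fun j _ => hx.1.1 ?_
        have := Nat.lt_mul_div_succ j hn
        omega

lemma isMarcinkiewiczFun_singularValue (hτ : IsFNSTrace N τ) {A : H →L[ℂ] H}
    (hA : A ∈ marcinkiewicz N τ) : IsMarcinkiewiczFun (singularValue N τ A) :=
  ⟨hτ.singularValue_antitone A, singularValue_nonneg N τ A, (mem_marcinkiewicz_iff.1 hA).2⟩

/-- A functional on Marcinkiewicz functions that is linear on the cone and monotone with respect
to Hardy-Littlewood majorization up to dilations and bounded perturbations. -/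
structure IsSymmetricFunctional (Λ : (ℝ → ℝ) → ℝ) : Prop where
  nonneg : ∀ x, IsMarcinkiewiczFun x → 0 ≤ Λ x
  map_add : ∀ x y, IsMarcinkiewiczFun x → IsMarcinkiewiczFun y → Λ (x + y) = Λ x + Λ y
  map_smul : ∀ (c : ℝ) x, 0 ≤ c → IsMarcinkiewiczFun x → Λ (c • x) = c * Λ x
  mono : ∀ x y, IsMarcinkiewiczFun x → IsMarcinkiewiczFun y → ∀ (n : ℕ) (ε b : ℝ), 0 < n →
    0 ≤ ε → 0 ≤ b → (∀ s : ℝ, 0 ≤ s → ∫ u in (0 : ℝ)..s, x u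
      ≤ (∫ u in (0 : ℝ)..(n * s), y u) + ε * Real.log (1 + s) + b) →
    Λ x ≤ Λ y + ε * Λ logDensity

/-- Every fully symmetric functional is given by a symmetric functional of the singular values. -/
lemma IsFullySymmetric.exists_symmetricFunctional (hφ : IsFullySymmetric N τ φ)
    (hτ : IsFNSTrace N τ) (hα : 0 < α) (hp : IsTraceSequence N τ α p) :
    ∃ Λ : (ℝ → ℝ) → ℝ, IsSymmetricFunctional Λ ∧
      ∀ A ∈ marcinkiewicz N τ, 0 ≤ A → φ A = Λ (singularValue N τ A) := by
  -- Λ evaluates φ on the diagonal operator whose entries are the samples of x at the multiples of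
  -- α.
  refine ⟨fun x => seqFunctional φ p fun k => x (k * α), ⟨?_, ?_, ?_, ?_⟩, ?_⟩
  · exact fun x hx => hφ.seqFunctional_nonneg hτ hα hp (hx.sample hα)
  · exact fun x y hx hy => hφ.seqFunctional_add hτ hα hp (hx.sample hα) (hy.sample hα)
  · exact fun c x _ hx => hφ.seqFunctional_smul hτ hα hp (hx.sample hα) c
  · intro x y hx hy n ε b hn hε hb h
    have hρ := isMarcinkiewiczFun_logDensity
    have hyb := (hy.sample hα).blockSum n
    have hρε := (hρ.sample hα).smul hε
    calc seqFunctional φ p (fun k => x (k * α))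
        ≤ seqFunctional φ p ((fun k => ∑ i ∈ Finset.range n, y ((n * k + i : ℕ) * α))
            + ε • fun k : ℕ => logDensity (k * α)) := by
          -- Right-endpoint sums of x are below its integral and left-endpoint sums of y and
          -- `logDensity` are above theirs. The dilation by n becomes block sums of y, and dividing
          -- by the mesh α turns b into b/α.
          refine hφ.seqFunctional_le_shift hτ hα hp (b := b / α) (by positivity)
            (hx.sample hα) (hyb.add hρε) fun m => ?_
          have h1 := Antitone.sum_le_integral_mul hx.1 hα m
          have h2 := h (m * α) (by positivity)
          have h3 := Antitone.integral_le_sum_mul hy.1 hα (n * m)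
          have h4 := Antitone.integral_le_sum_mul hρ.1 hα m
          rw [integral_logDensity (by positivity)] at h4
          rw [sum_range_mul] at h3
          simp only [Pi.add_apply, Pi.smul_apply, smul_eq_mul, Finset.sum_add_distrib,
            ← Finset.mul_sum]
          have h5 : ((n * m : ℕ) : ℝ) * α = n * (m * α) := by push_cast; ring
          rw [h5] at h3
          rw [← mul_le_mul_iff_of_pos_left hα]
          have h6 : α * (b / α) = b := mul_div_cancel₀ b hα.ne'
          have h7 := mul_le_mul_of_nonneg_left h4 hε
          rw [mul_add, mul_add, h6]
          linarith
      _ = seqFunctional φ p (fun k => ∑ i ∈ Finset.range n, y ((n * k + i : ℕ) * α))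
            + ε * seqFunctional φ p (fun k => logDensity (k * α)) := by
          rw [hφ.seqFunctional_add hτ hα hp hyb hρε,
            hφ.seqFunctional_smul hτ hα hp (hρ.sample hα)]
      _ ≤ _ := by
          gcongr
          exact hφ.seqFunctional_blockSum_le hτ hα hp (hy.sample hα) hn
  · intro A hA hA0
    have hμ := isMarcinkiewiczFun_singularValue hτ hA
    set x : ℕ → ℝ := fun k => singularValue N τ A (k * α) with hx
    have hxM : IsMarcinkiewiczSeq x := hμ.sample hα
    rw [hφ.eq_ofReal_re hτ hA hA0]
    congr 1
    have hfl : ∀ s : ℝ, 0 ≤ s → ⌊s / α⌋₊ * α ≤ s := fun s hs => by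
      rw [← le_div_iff₀ hα]
      exact Nat.floor_le (by positivity)
    have hfl' : ∀ s : ℝ, s ≤ (⌊s / α⌋₊ + 1 : ℕ) * α := fun s => by
      rw [← div_le_iff₀ hα]
      push_cast
      exact (Nat.lt_floor_add_one _).le
    -- On each interval of length α the singular value function lies between two consecutive
    -- samples. This gives majorization of A by the sampled operator and of the shifted sampled
    -- operator by A, and the shift does not change the value.
    apply le_antisymm
    · refine (Complex.le_def.1 (hφ.mono _ (hp.diag_mem_marcinkiewicz hτ hα hxM) _ hA
        (hp.diag_nonneg hxM.1) hA0 fun t ht => ?_)).1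
      refine intervalIntegral.integral_mono_on ht (hτ.intervalIntegrable_singularValue _ _ _)
        (hτ.intervalIntegrable_singularValue _ _ _) fun s hs => ?_
      rw [hp.singularValue_diag hτ hα hxM.1]
      exact hμ.1 (hfl s hs.1)
    · have hsh := hxM.shift
      calc seqFunctional φ p x ≤ seqFunctional φ p (fun k => x (k + 1)) :=
            hφ.seqFunctional_le_shift hτ hα hp le_rfl hxM hsh fun m => by rw [add_zero]
        _ ≤ (φ A).re := by
            refine (Complex.le_def.1 (hφ.mono _ hA _ (hp.diag_mem_marcinkiewicz hτ hα hsh)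
              hA0 (hp.diag_nonneg hsh.1) fun t ht => ?_)).1
            refine intervalIntegral.integral_mono_on ht
              (hτ.intervalIntegrable_singularValue _ _ _)
              (hτ.intervalIntegrable_singularValue _ _ _) fun s hs => ?_
            rw [hp.singularValue_diag hτ hα hsh.1]
            exact hμ.1 (hfl' s)

end FullySymmetric

/-! ### Generalised limits from logarithmically growing functions -/

/-- The map z ↦ inf S(z) is sublinear, finite because S(z) + S(-z) ⊆ S(0) ⊆ [0, ∞). Hahn-Banach
extends the zero map on the zero subspace below it. -/
lemma exists_linearMap_le {E : Type*} [AddCommGroup E] [Module ℝ E] (S : E → Set ℝ)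
    (hne : ∀ z, (S z).Nonempty) (hadd : ∀ z w, ∀ a ∈ S z, ∀ b ∈ S w, a + b ∈ S (z + w))
    (hsmul : ∀ c : ℝ, 0 < c → ∀ z, ∀ a ∈ S z, c * a ∈ S (c • z)) (h0 : ∀ a ∈ S 0, 0 ≤ a) :
    ∃ L : E →ₗ[ℝ] ℝ, ∀ z, ∀ a ∈ S z, L z ≤ a := by
  have hbdd : ∀ z, BddBelow (S z) := fun z => by
    obtain ⟨b, hb⟩ := hne (-z)
    refine ⟨-b, fun a ha => ?_⟩
    have := h0 _ (by simpa using hadd z (-z) a ha b hb)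
    linarith
  have hle : ∀ c : ℝ, 0 < c → ∀ z, sInf (S (c • z)) ≤ c * sInf (S z) := fun c hc z => by
    rw [← div_le_iff₀' hc]
    refine le_csInf (hne z) fun a ha => ?_
    rw [div_le_iff₀' hc]
    exact csInf_le (hbdd _) (hsmul c hc z a ha)
  have hhom : ∀ c : ℝ, 0 < c → ∀ z, sInf (S (c • z)) = c * sInf (S z) := fun c hc z => by
    refine le_antisymm (hle c hc z) ?_
    have := hle c⁻¹ (inv_pos.2 hc) (c • z)
    rw [smul_smul, inv_mul_cancel₀ hc.ne', one_smul] at this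
    calc c * sInf (S z) ≤ c * (c⁻¹ * sInf (S (c • z))) := by gcongr
      _ = sInf (S (c • z)) := by rw [mul_inv_cancel_left₀ hc.ne']
  have hsub : ∀ z w, sInf (S (z + w)) ≤ sInf (S z) + sInf (S w) := fun z w => by
    have h1 : ∀ a ∈ S z, sInf (S (z + w)) - a ≤ sInf (S w) := fun a ha =>
      le_csInf (hne w) fun b hb => by
        linarith [csInf_le (hbdd _) (hadd z w a ha b hb)]
    have h2 : sInf (S (z + w)) - sInf (S w) ≤ sInf (S z) :=
      le_csInf (hne z) fun a ha => by linarith [h1 a ha]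
    linarith
  obtain ⟨g, -, hg⟩ := exists_extension_of_le_sublinear (E := E) ⟨⊥, 0⟩ (fun z => sInf (S z))
    hhom hsub fun z => by
      rw [(Submodule.mem_bot ℝ).1 z.2]
      exact Real.sInf_nonneg h0
  exact ⟨g, fun z a ha => (hg z).trans (csInf_le (hbdd z) ha)⟩

/-- The linear span of the differences of functions in `L_∞(0, ∞)` and their dilations. -/
def dilationDifferences : Submodule ℝ Linfty :=
  Submodule.span ℝ {w | ∃ s : ℝ, 0 < s ∧ ∃ u v : Linfty,
    (v =ᵐ[halfLine] fun t => u (t / s)) ∧ w = v - u}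

lemma ae_norm_le_norm (u : Linfty) : ∀ᵐ t ∂halfLine, |u t| ≤ ‖u‖ := by
  have h := ae_le_eLpNormEssSup (f := u) (μ := halfLine)
  have hfin := Lp.eLpNorm_lt_top u
  rw [eLpNorm_exponent_top] at hfin
  filter_upwards [h] with t ht
  rw [Lp.norm_def, eLpNorm_exponent_top, ← Real.norm_eq_abs, ← toReal_enorm]
  exact ENNReal.toReal_mono hfin.ne ht

lemma intervalIntegrable_div_self (u : Linfty) {a b : ℝ} (ha : 0 < a) (hb : 0 < b) :
    IntervalIntegrable (fun s => u s / s) volume a b := by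
  have h0 : IntervalIntegrable (fun s : ℝ => ‖u‖ * s⁻¹) volume a b := by
    refine (ContinuousOn.intervalIntegrable fun s hs => ?_)
    have : s ≠ 0 := by
      rcases le_total a b with h | h
      · rw [uIcc_of_le h] at hs
        linarith [hs.1]
      · rw [uIcc_of_ge h] at hs
        linarith [hs.1]
    fun_prop (disch := assumption)
  have hsub : Set.uIoc a b ⊆ Ioi 0 := fun s hs => by
    rcases mem_uIoc.1 hs with h | h
    · exact ha.trans h.1
    · exact hb.trans h.1
  have hle : volume.restrict (Set.uIoc a b) ≤ halfLine := Measure.restrict_mono hsub le_rfl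
  refine h0.mono_fun' ?_ ?_
  · exact (((Lp.aestronglyMeasurable u).mono_measure hle).aemeasurable.div
      measurable_id.aemeasurable).aestronglyMeasurable
  · filter_upwards [ae_mono hle (ae_norm_le_norm u), ae_restrict_mem measurableSet_uIoc] with s hs hs'
    have : 0 < s := hsub hs'
    rw [Real.norm_eq_abs, abs_div, abs_of_pos this, div_eq_mul_inv]
    gcongr

lemma abs_integral_div_self_le (u : Linfty) {a b : ℝ} (ha : 0 < a) (hb : 0 < b) :
    |∫ s in a..b, u s / s| ≤ ‖u‖ * |Real.log (b / a)| := by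
  have hmain : ∀ a b : ℝ, 0 < a → 0 < b → a ≤ b →
      |∫ s in a..b, u s / s| ≤ ‖u‖ * |Real.log (b / a)| := fun a b ha hb hab => by
    have hInt : IntervalIntegrable (fun s : ℝ => ‖u‖ * s⁻¹) volume a b := by
      refine (ContinuousOn.intervalIntegrable fun s hs => ?_)
      rw [uIcc_of_le hab] at hs
      have : s ≠ 0 := by linarith [hs.1]
      fun_prop (disch := assumption)
    have hsub : Ioc a b ⊆ Ioi 0 := fun s hs => ha.trans hs.1
    have h := intervalIntegral.norm_integral_le_of_norm_le hab (f := fun s => u s / s)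
      (g := fun s : ℝ => ‖u‖ * s⁻¹) (μ := volume) ?_ hInt
    · rw [intervalIntegral.integral_const_mul, integral_inv_of_pos ha hb] at h
      rw [abs_of_nonneg (Real.log_nonneg ((one_le_div ha).2 hab))]
      exact h
    · rw [← ae_restrict_iff' measurableSet_Ioc]
      filter_upwards [ae_mono (Measure.restrict_mono hsub le_rfl) (ae_norm_le_norm u),
        ae_restrict_mem measurableSet_Ioc] with s hs hs'
      have : 0 < s := hsub hs'
      rw [Real.norm_eq_abs, abs_div, abs_of_pos this, div_eq_mul_inv]
      gcongr
  rcases le_total a b with h | h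
  · exact hmain a b ha hb h
  · rw [intervalIntegral.integral_symm, abs_neg, ← inv_div, Real.log_inv, abs_neg]
    exact hmain b a hb ha h

/-- The measure ds/s is dilation invariant, so for a difference of u and its dilate by s the
integral over [a, b] reduces to two end pieces, each of mass |log s|. The bound does not depend on a
and b. -/
lemma exists_abs_integral_le_of_mem_dilationDifferences {w : Linfty}
    (hw : w ∈ dilationDifferences) :
    ∃ C : ℝ, ∀ a b : ℝ, 0 < a → 0 < b → |∫ s in a..b, w s / s| ≤ C := by
  have hae : ∀ {a b : ℝ}, 0 < a → 0 < b → ∀ {p : ℝ → Prop}, (∀ᵐ t ∂halfLine, p t) →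
      ∀ᵐ t, t ∈ Set.uIoc a b → p t := fun {a b} ha hb p hp => by
    have hsub : Set.uIoc a b ⊆ Ioi 0 := fun s hs => by
      rcases mem_uIoc.1 hs with h | h
      · exact ha.trans h.1
      · exact hb.trans h.1
    rw [ae_restrict_iff' measurableSet_Ioi] at hp
    filter_upwards [hp] with t ht hs using ht (hsub hs)
  induction hw using Submodule.span_induction with
  | mem w hw =>
    obtain ⟨s, hs, u, v, hv, rfl⟩ := hw
    refine ⟨‖u‖ * |Real.log s| + ‖u‖ * |Real.log s|, fun a b ha hb => ?_⟩
    have h1 : ∫ r in a..b, (v - u : Linfty) r / r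
        = (∫ r in a..b, u (r / s) / r) - ∫ r in a..b, u r / r := by
      have hi : IntervalIntegrable (fun r => u (r / s) / r) volume a b := by
        refine (intervalIntegrable_div_self v ha hb).congr_ae ?_
        rw [EventuallyEq, ae_restrict_iff' measurableSet_uIoc]
        filter_upwards [hae ha hb hv] with r hr hr'
        rw [hr hr']
      rw [← intervalIntegral.integral_sub hi (intervalIntegrable_div_self u ha hb)]
      refine intervalIntegral.integral_congr_ae ?_
      filter_upwards [hae ha hb hv, hae ha hb (Lp.coeFn_sub v u)] with r h1 h2 hr
      rw [h2 hr, Pi.sub_apply, h1 hr, sub_div]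
    have h2 : ∫ r in a..b, u (r / s) / r = ∫ r in (a / s)..(b / s), u r / r := by
      have h := intervalIntegral.integral_comp_div (a := a) (b := b) (fun r => u r / r) hs.ne'
      have h3 : (∫ r in a..b, u (r / s) / (r / s)) = s * ∫ r in a..b, u (r / s) / r := by
        rw [← intervalIntegral.integral_const_mul]
        refine intervalIntegral.integral_congr fun r _ => ?_
        rw [div_div_eq_mul_div]
        ring
      rw [h3, smul_eq_mul] at h
      exact mul_left_cancel₀ hs.ne' h
    have has : 0 < a / s := by positivity
    have hbs : 0 < b / s := by positivity
    rw [h1, h2, intervalIntegral.integral_interval_sub_interval_comm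
      (intervalIntegrable_div_self u has hbs) (intervalIntegrable_div_self u ha hb)
      (intervalIntegrable_div_self u has ha)]
    refine (abs_sub _ _).trans ?_
    have e1 := abs_integral_div_self_le u has ha
    have e2 := abs_integral_div_self_le u hbs hb
    rw [div_div_cancel₀ ha.ne'] at e1
    rw [div_div_cancel₀ hb.ne'] at e2
    exact add_le_add e1 e2
  | zero =>
    refine ⟨0, fun a b ha hb => ?_⟩
    have := abs_integral_div_self_le 0 ha hb
    simpa using this
  | add x y _ _ hx hy =>
    obtain ⟨C, hC⟩ := hx
    obtain ⟨D, hD⟩ := hy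
    refine ⟨C + D, fun a b ha hb => ?_⟩
    have : ∫ s in a..b, (x + y : Linfty) s / s
        = (∫ s in a..b, x s / s) + ∫ s in a..b, y s / s := by
      rw [← intervalIntegral.integral_add (intervalIntegrable_div_self x ha hb)
        (intervalIntegrable_div_self y ha hb)]
      refine intervalIntegral.integral_congr_ae ?_
      filter_upwards [hae ha hb (Lp.coeFn_add x y)] with r h hr
      rw [h hr, Pi.add_apply, add_div]
    rw [this]
    exact (abs_add_le _ _).trans (add_le_add (hC a b ha hb) (hD a b ha hb))
  | smul c x _ hx =>
    obtain ⟨C, hC⟩ := hx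
    refine ⟨|c| * C, fun a b ha hb => ?_⟩
    have : ∫ s in a..b, (c • x : Linfty) s / s = c * ∫ s in a..b, x s / s := by
      rw [← intervalIntegral.integral_const_mul]
      refine intervalIntegral.integral_congr_ae ?_
      filter_upwards [hae ha hb (Lp.coeFn_smul c x)] with r h hr
      rw [h hr, Pi.smul_apply, smul_eq_mul, mul_div_assoc]
    rw [this, abs_mul]
    exact mul_le_mul_of_nonneg_left (hC a b ha hb) (abs_nonneg c)

/-- A cone `P` with a growth function `N x` of order `O(log t)` for each element `x`, additive up
to dilations, and a positive additive functional `Λ` that respects the growth order, normalised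
at an element `e` of exact logarithmic growth rate `β`. -/
structure IsGrowthModel {E : Type*} [AddCommGroup E] [Module ℝ E] (P : E → Prop)
    (N : E → ℝ → ℝ) (Λ : E → ℝ) (e : E) (β : ℝ) : Prop where
  add : ∀ x y, P x → P y → P (x + y)
  smul : ∀ c : ℝ, 0 ≤ c → ∀ x, P x → P (c • x)
  nonneg : ∀ x, P x → ∀ t, 0 < t → 0 ≤ N x t
  mono : ∀ x, P x → ∀ s t, 0 < s → s ≤ t → N x s ≤ N x t
  growth_zero : ∀ t, 0 < t → N 0 t = 0
  growth : ∀ x, P x → ∃ C : ℝ, ∀ᶠ t in atTop, N x t ≤ C * Real.log t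
  add_le : ∀ x y, P x → P y → ∀ t, 0 < t → N (x + y) (t / 2) ≤ N x t + N y t
  le_add : ∀ x y, P x → P y → ∀ t, 0 < t → N x t + N y t ≤ N (x + y) (2 * t)
  growth_smul : ∀ c : ℝ, 0 < c → ∀ x, P x → ∃ R : ℝ, 1 ≤ R ∧ ∀ t, 0 < t →
    N (c • x) (t / R) ≤ c * N x t ∧ c * N x t ≤ N (c • x) (R * t)
  map_add : ∀ x y, P x → P y → Λ (x + y) = Λ x + Λ y
  map_smul : ∀ c : ℝ, 0 ≤ c → ∀ x, P x → Λ (c • x) = c * Λ x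
  key : ∀ x y, P x → P y → (∀ ε : ℝ, 0 < ε → ∃ R : ℝ, 1 ≤ R ∧
    ∀ᶠ t in atTop, N x t ≤ N y (R * t) + ε * Real.log t) → Λ x ≤ Λ y
  unit_mem : P e
  unit_growth : Tendsto (fun t => N e t / Real.log t) atTop (𝓝 β)
  rate_pos : 0 < β
  unit_pos : 0 < Λ e

lemma eventually_pos_log : ∀ᶠ t : ℝ in atTop, 0 < Real.log t := by
  filter_upwards [eventually_gt_atTop 1] with t ht using Real.log_pos ht

lemma eventually_le_mul_log (C : ℝ) {ε : ℝ} (hε : 0 < ε) :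
    ∀ᶠ t : ℝ in atTop, C ≤ ε * Real.log t := by
  filter_upwards [Real.tendsto_log_atTop.eventually_ge_atTop (C / ε)] with t ht
  rwa [div_le_iff₀' hε] at ht

/-! ### Hahn-Banach construction of the generalised limit -/

section GrowthModel

variable {E : Type*} [AddCommGroup E] [Module ℝ E] {P : E → Prop}
  {N : E → ℝ → ℝ} {Λ : E → ℝ} {e : E} {β : ℝ}

/-- The values `Λ x - Λ y` where `(N x (R t) - N y (t / R)) / log t` dominates `z` asymptotically,
up to differences of dilations. -/
def upperValues (P : E → Prop) (N : E → ℝ → ℝ) (Λ : E → ℝ) (z : Linfty) : Set ℝ :=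
  {v | ∃ x y, P x ∧ P y ∧ v = Λ x - Λ y ∧ ∃ R : ℝ, 1 ≤ R ∧ ∃ w ∈ dilationDifferences,
    ∀ ε : ℝ, 0 < ε → ∀ᶠ t in atTop ⊓ ae halfLine,
      z t ≤ (N x (R * t) - N y (t / R)) / Real.log t + w t + ε}

lemma IsGrowthModel.zero_mem (h : IsGrowthModel P N Λ e β) : P 0 := by
  simpa using h.smul 0 le_rfl e h.unit_mem

lemma IsGrowthModel.map_zero (h : IsGrowthModel P N Λ e β) : Λ 0 = 0 := by
  simpa using h.map_smul 0 le_rfl e h.unit_mem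

lemma IsGrowthModel.mono_dilation (h : IsGrowthModel P N Λ e β) {x : E} (hx : P x) {t R : ℝ}
    (ht : 0 < t) (hR : 1 ≤ R) : N x t ≤ N x (R * t) :=
  h.mono x hx _ _ ht (le_mul_of_one_le_left ht.le hR)

lemma IsGrowthModel.mono_dilation_div (h : IsGrowthModel P N Λ e β) {x : E} (hx : P x) {t R : ℝ}
    (ht : 0 < t) (hR : 1 ≤ R) : N x (t / R) ≤ N x t :=
  h.mono x hx _ _ (by positivity) (div_le_self ht.le hR)

lemma eventually_inf_of_atTop {p : ℝ → Prop} (h : ∀ᶠ t in atTop, p t) :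
    ∀ᶠ t in atTop ⊓ ae halfLine, p t := h.filter_mono inf_le_left

lemma eventually_inf_of_ae {p : ℝ → Prop} (h : ∀ᵐ t ∂halfLine, p t) :
    ∀ᶠ t in atTop ⊓ ae halfLine, p t := h.filter_mono inf_le_right

/-- Additivity of the growth functions up to a factor 2 in the argument, together with their
monotonicity, is the reason for the free dilation parameter R in `upperValues`; here it becomes
2R₁R₂. -/
lemma IsGrowthModel.upperValues_add (h : IsGrowthModel P N Λ e β) (z₁ z₂ : Linfty) (a : ℝ)
    (ha : a ∈ upperValues P N Λ z₁) (b : ℝ) (hb : b ∈ upperValues P N Λ z₂) :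
    a + b ∈ upperValues P N Λ (z₁ + z₂) := by
  obtain ⟨x₁, y₁, hx₁, hy₁, rfl, R₁, hR₁, w₁, hw₁, H₁⟩ := ha
  obtain ⟨x₂, y₂, hx₂, hy₂, rfl, R₂, hR₂, w₂, hw₂, H₂⟩ := hb
  refine ⟨x₁ + x₂, y₁ + y₂, h.add _ _ hx₁ hx₂, h.add _ _ hy₁ hy₂, ?_, 2 * (R₁ * R₂), ?_,
    w₁ + w₂, add_mem hw₁ hw₂, fun ε hε => ?_⟩
  · rw [h.map_add _ _ hx₁ hx₂, h.map_add _ _ hy₁ hy₂]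
    ring
  · nlinarith
  filter_upwards [H₁ (ε / 2) (half_pos hε), H₂ (ε / 2) (half_pos hε),
    eventually_inf_of_ae (Lp.coeFn_add z₁ z₂), eventually_inf_of_ae (Lp.coeFn_add w₁ w₂),
    eventually_inf_of_atTop (eventually_gt_atTop 0),
    eventually_inf_of_atTop eventually_pos_log] with t e₁ e₂ e₃ e₄ ht hlog
  rw [e₃, e₄, Pi.add_apply, Pi.add_apply]
  have hR₁0 : 0 < R₁ := by linarith
  have hR₂0 : 0 < R₂ := by linarith
  have hx := h.le_add _ _ hx₁ hx₂ (R₁ * R₂ * t) (by positivity)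
  have hy := h.add_le _ _ hy₁ hy₂ (t / (R₁ * R₂)) (by positivity)
  have hx1 := h.mono_dilation hx₁ (show 0 < R₁ * t by positivity) hR₂
  have hx2 := h.mono_dilation hx₂ (show 0 < R₂ * t by positivity) hR₁
  have hy1 := h.mono_dilation_div hy₁ (show 0 < t / R₁ by positivity) hR₂
  have hy2 := h.mono_dilation_div hy₂ (show 0 < t / R₂ by positivity) hR₁
  rw [show R₂ * (R₁ * t) = R₁ * R₂ * t by ring] at hx1
  rw [show R₁ * (R₂ * t) = R₁ * R₂ * t by ring] at hx2
  rw [show 2 * (R₁ * R₂ * t) = 2 * (R₁ * R₂) * t by ring] at hx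
  rw [div_div, show R₁ * R₂ * 2 = 2 * (R₁ * R₂) by ring] at hy
  rw [div_div] at hy1 hy2
  rw [mul_comm R₂ R₁] at hy2
  have key : (N x₁ (R₁ * t) - N y₁ (t / R₁)) / Real.log t
      + (N x₂ (R₂ * t) - N y₂ (t / R₂)) / Real.log t
      ≤ (N (x₁ + x₂) (2 * (R₁ * R₂) * t) - N (y₁ + y₂) (t / (2 * (R₁ * R₂)))) / Real.log t := by
    rw [← add_div]
    gcongr
    linarith
  linarith

lemma IsGrowthModel.upperValues_smul (h : IsGrowthModel P N Λ e β) (c : ℝ) (hc : 0 < c)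
    (z : Linfty) (a : ℝ) (ha : a ∈ upperValues P N Λ z) :
    c * a ∈ upperValues P N Λ (c • z) := by
  obtain ⟨x, y, hx, hy, rfl, R, hR, w, hw, H⟩ := ha
  obtain ⟨R₁, hR₁, H₁⟩ := h.growth_smul c hc x hx
  obtain ⟨R₂, hR₂, H₂⟩ := h.growth_smul c hc y hy
  refine ⟨c • x, c • y, h.smul c hc.le x hx, h.smul c hc.le y hy, ?_, R * (R₁ * R₂), ?_,
    c • w, dilationDifferences.smul_mem c hw, fun ε hε => ?_⟩
  · rw [h.map_smul c hc.le x hx, h.map_smul c hc.le y hy, mul_sub]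
  · nlinarith [mul_le_mul hR₁ hR₂ zero_le_one (by linarith)]
  filter_upwards [H (ε / c) (by positivity), eventually_inf_of_ae (Lp.coeFn_smul c z),
    eventually_inf_of_ae (Lp.coeFn_smul c w), eventually_inf_of_atTop (eventually_gt_atTop 0),
    eventually_inf_of_atTop eventually_pos_log] with t e₁ e₂ e₃ ht hlog
  rw [e₂, e₃, Pi.smul_apply, Pi.smul_apply, smul_eq_mul, smul_eq_mul]
  have hR0 : 0 < R := by linarith
  have hR₁0 : 0 < R₁ := by linarith
  have hR₂0 : 0 < R₂ := by linarith
  have hx1 := (H₁ (R * t) (by positivity)).2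
  have hy1 := (H₂ (t / R) (by positivity)).1
  have hx2 := h.mono_dilation (h.smul c hc.le x hx) (show 0 < R₁ * (R * t) by positivity) hR₂
  have hy2 := h.mono_dilation_div (h.smul c hc.le y hy) (show 0 < t / R / R₂ by positivity) hR₁
  rw [show R₂ * (R₁ * (R * t)) = R * (R₁ * R₂) * t by ring] at hx2
  rw [show t / R / R₂ / R₁ = t / (R * (R₁ * R₂)) by field_simp] at hy2
  have key : c * ((N x (R * t) - N y (t / R)) / Real.log t)
      ≤ (N (c • x) (R * (R₁ * R₂) * t) - N (c • y) (t / (R * (R₁ * R₂)))) / Real.log t := by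
    rw [← mul_div_assoc]
    gcongr
    linarith
  have := mul_le_mul_of_nonneg_left e₁ hc.le
  have h3 : c * (ε / c) = ε := mul_div_cancel₀ _ hc.ne'
  linarith

lemma mem_upperValues {x y : E} (hx : P x) (hy : P y)
    {z : Linfty} (hz : ∀ ε : ℝ, 0 < ε → ∀ᶠ t in atTop ⊓ ae halfLine,
      z t ≤ (N x t - N y t) / Real.log t + ε) :
    Λ x - Λ y ∈ upperValues P N Λ z := by
  refine ⟨x, y, hx, hy, rfl, 1, le_rfl, 0, dilationDifferences.zero_mem, fun ε hε => ?_⟩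
  filter_upwards [hz ε hε, eventually_inf_of_ae (Lp.coeFn_zero ℝ ∞ halfLine)] with t e₁ e₂
  rw [e₂, Pi.zero_apply, one_mul, div_one]
  linarith

lemma IsGrowthModel.upperValues_nonempty (h : IsGrowthModel P N Λ e β) (z : Linfty) :
    (upperValues P N Λ z).Nonempty := by
  have hβ := h.rate_pos
  -- Eventually N_e(t) > (β/2) log t, so this multiple of e has growth rate at least ‖z‖ + 1.
  set c : ℝ := 2 * (‖z‖ + 1) / β with hc
  have hc0 : 0 < c := by positivity
  obtain ⟨R, hR, H⟩ := h.growth_smul c hc0 e h.unit_mem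
  refine ⟨_, c • e, 0, h.smul c hc0.le e h.unit_mem, h.zero_mem, rfl, R, hR, 0,
    dilationDifferences.zero_mem, fun ε hε => ?_⟩
  filter_upwards [eventually_inf_of_ae (ae_norm_le_norm z),
    eventually_inf_of_ae (Lp.coeFn_zero ℝ ∞ halfLine),
    eventually_inf_of_atTop (h.unit_growth.eventually_const_lt (half_lt_self hβ)),
    eventually_inf_of_atTop (eventually_gt_atTop 0),
    eventually_inf_of_atTop eventually_pos_log] with t e₁ e₂ e₃ ht hlog
  rw [e₂, Pi.zero_apply, h.growth_zero _ (by positivity), sub_zero]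
  have h1 : c * (β / 2) ≤ N (c • e) (R * t) / Real.log t := by
    calc c * (β / 2) ≤ c * (N e t / Real.log t) := by gcongr
      _ = c * N e t / Real.log t := by rw [mul_div_assoc]
      _ ≤ _ := by
        have := (H t ht).2
        gcongr
  have h2 : c * (β / 2) = ‖z‖ + 1 := by
    rw [hc]
    field_simp
  linarith [le_abs_self (z t)]

/-- Consistency of the construction. The inequality 0 ≤ (N_x(Rs) - N_y(s/R))/log s + w(s) + δ is
integrated over [t, nt] against ds/s. Monotonicity replaces the growth terms by their values at the
ends, while w contributes at most a constant C against the total mass log n. For large n the term w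
disappears, N_y is dominated by a dilate of N_x up to ε log t, and `key` applies. -/
lemma IsGrowthModel.upperValues_zero_nonneg (h : IsGrowthModel P N Λ e β) (a : ℝ)
    (ha : a ∈ upperValues P N Λ 0) : 0 ≤ a := by
  obtain ⟨x, y, hx, hy, rfl, R, hR, w, hw, H⟩ := ha
  rw [sub_nonneg]
  refine h.key y x hy hx fun ε hε => ?_
  obtain ⟨C, hC⟩ := exists_abs_integral_le_of_mem_dilationDifferences hw
  obtain ⟨D, hD⟩ := h.growth x hx
  have hR0 : 0 < R := by linarith
  -- At the end the error is 2δ(log n + log(Rt)) ≤ 8δ log t = (ε/2) log t. The other half of ε pays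
  -- for replacing log(nRt) by log(Rt) in a denominator.
  set δ : ℝ := ε / 16 with hδ
  have hδ0 : 0 < δ := by positivity
  obtain ⟨n, hn1, hn⟩ := ((eventually_gt_atTop (1 : ℝ)).and
    (eventually_le_mul_log C hδ0)).exists
  have hn0 : 0 < n := by linarith
  have hlogn : 0 < Real.log n := Real.log_pos hn1
  obtain ⟨T, hT⟩ : ∃ T : ℝ, ∀ᵐ s ∂halfLine, T ≤ s →
      0 ≤ (N x (R * s) - N y (s / R)) / Real.log s + w s + δ := by
    have h1 := H δ hδ0
    obtain ⟨U, hU, V, hV, hUV⟩ := mem_inf_iff_superset.1 h1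
    obtain ⟨T, hT⟩ := mem_atTop_sets.1 hU
    refine ⟨T, ?_⟩
    filter_upwards [hV, Lp.coeFn_zero ℝ ∞ halfLine] with s hs h0 hTs
    have := hUV ⟨hT s hTs, hs⟩
    rw [mem_ofPred_eq, h0] at this
    exact this
  -- The averaged inequality is used at Rt in place of t, which makes the left side N_y(t) and the
  -- right side N_x(R·n·Rt).
  refine ⟨R * R * n, by nlinarith [mul_le_mul hR hR zero_le_one hR0.le], ?_⟩
  have hav : ∀ t, max T 2 ≤ t → N y (t / R) / Real.log (n * t)
      ≤ N x (R * (n * t)) / Real.log t + 2 * δ := fun t ht => by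
    have ht2 : 2 ≤ t := (le_max_right _ _).trans ht
    have htT : T ≤ t := (le_max_left _ _).trans ht
    have ht0 : 0 < t := by linarith
    have htn : t ≤ n * t := le_mul_of_one_le_left ht0.le hn1.le
    have hlt : 0 < Real.log t := Real.log_pos (by linarith)
    set B : ℝ := N x (R * (n * t)) / Real.log t - N y (t / R) / Real.log (n * t) + δ with hB
    have hpt : ∀ᵐ s, s ∈ Icc t (n * t) → -(w s / s) ≤ B * s⁻¹ := by
      rw [ae_restrict_iff' measurableSet_Ioi] at hT
      filter_upwards [hT] with s hs hst
      have hs0 : 0 < s := ht0.trans_le hst.1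
      have h1 := hs hs0 (htT.trans hst.1)
      have hls : Real.log t ≤ Real.log s := Real.log_le_log ht0 hst.1
      have hls' : Real.log s ≤ Real.log (n * t) := Real.log_le_log hs0 hst.2
      have h2 : N x (R * s) / Real.log s ≤ N x (R * (n * t)) / Real.log t := by
        refine div_le_div₀ (h.nonneg x hx _ (by positivity)) ?_ hlt hls
        exact h.mono x hx _ _ (by positivity) (by gcongr; exact hst.2)
      have h3 : N y (t / R) / Real.log (n * t) ≤ N y (s / R) / Real.log s := by
        refine div_le_div₀ (h.nonneg y hy _ (by positivity)) ?_ (hlt.trans_le hls) hls'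
        exact h.mono y hy _ _ (by positivity) (by gcongr; exact hst.1)
      rw [sub_div] at h1
      rw [← neg_div, div_eq_mul_inv]
      gcongr
      linarith
    have hnt0 : 0 < n * t := by positivity
    have hinv : IntervalIntegrable (fun s : ℝ => B * s⁻¹) volume t (n * t) := by
      refine (ContinuousOn.intervalIntegrable fun s hs => ?_)
      rw [uIcc_of_le htn] at hs
      have : s ≠ 0 := by linarith [hs.1]
      fun_prop (disch := assumption)
    have h4 := intervalIntegral.integral_mono_ae_restrict htn
      (intervalIntegrable_div_self w ht0 hnt0).neg hinv
      ((ae_restrict_iff' measurableSet_Icc).2 hpt)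
    have h5 : ∫ s in t..n * t, (-fun s => w s / s) s = -∫ s in t..n * t, w s / s :=
      intervalIntegral.integral_neg
    rw [h5, intervalIntegral.integral_const_mul, integral_inv_of_pos ht0 hnt0,
      mul_div_cancel_right₀ _ ht0.ne'] at h4
    have h6 := (abs_le.1 (hC t (n * t) ht0 hnt0)).2
    have h7 : 0 ≤ (B + δ) * Real.log n := by linarith
    have h8 : 0 ≤ B + δ := nonneg_of_mul_nonneg_left h7 hlogn
    linarith
  have hscale : Tendsto (fun t : ℝ => R * t) atTop atTop := tendsto_id.const_mul_atTop hR0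
  have hscale' : Tendsto (fun t : ℝ => R * (n * (R * t))) atTop atTop :=
    (hscale.const_mul_atTop hn0).const_mul_atTop hR0
  filter_upwards [eventually_ge_atTop (2 : ℝ), hscale.eventually_ge_atTop (max T 2),
    hscale'.eventually hD, eventually_le_mul_log (Real.log n) one_pos,
    eventually_le_mul_log (Real.log R) one_pos,
    eventually_le_mul_log (4 * |D| * Real.log n) (half_pos hε)] with t ht htT hDt hlt1 hlt2 hlt3
  have ht0 : 0 < t := by linarith
  have hRt2 : 2 ≤ R * t := (le_max_right _ _).trans htT
  have h1 := hav (R * t) htT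
  rw [mul_div_cancel_left₀ _ hR0.ne'] at h1
  have hlR : 0 ≤ Real.log R := Real.log_nonneg hR
  have hlt : 0 < Real.log t := Real.log_pos (by linarith)
  set ℓ := Real.log (R * t) with hℓ
  have hℓ0 : 0 < ℓ := Real.log_pos (by linarith)
  have hℓ1 : ℓ = Real.log R + Real.log t := Real.log_mul hR0.ne' ht0.ne'
  have hnℓ : Real.log (n * (R * t)) = Real.log n + ℓ :=
    Real.log_mul hn0.ne' (by positivity)
  have hRnℓ : Real.log (R * (n * (R * t))) = Real.log R + (Real.log n + ℓ) := by
    rw [Real.log_mul hR0.ne' (by positivity), hnℓ]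
  rw [hnℓ, div_le_iff₀ (by positivity)] at h1
  rw [hRnℓ] at hDt
  rw [show R * R * n * t = R * (n * (R * t)) by ring]
  set X := N x (R * (n * (R * t))) with hX
  have hX0 : 0 ≤ X := h.nonneg x hx _ (by positivity)
  have h2 : X / ℓ * Real.log n ≤ 4 * |D| * Real.log n := by
    gcongr
    rw [div_le_iff₀ hℓ0]
    calc X ≤ D * (Real.log R + (Real.log n + ℓ)) := hDt
      _ ≤ |D| * (4 * ℓ) := by
        refine mul_le_mul (le_abs_self D) (by linarith) (by positivity) (abs_nonneg D)
      _ = 4 * |D| * ℓ := by ring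
  have h3 : (X / ℓ + 2 * δ) * (Real.log n + ℓ) = X + X / ℓ * Real.log n
      + 2 * δ * (Real.log n + ℓ) := by
    field_simp
    ring
  have h4 : 2 * δ * (Real.log n + ℓ) ≤ 2 * δ * (4 * Real.log t) := by
    gcongr
    linarith
  have h5 : 2 * δ * (4 * Real.log t) = ε / 2 * Real.log t := by
    rw [hδ]
    ring
  linarith

/-- A growth model yields a dilation invariant generalised limit that computes `Λ` from the
growth rates. -/
theorem IsGrowthModel.exists_generalisedLimit (h : IsGrowthModel P N Λ e β) :
    ∃ ω : Linfty →ₗ[ℝ] ℝ, IsGeneralisedLimit ω ∧ IsDilationInvariant ω ∧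
      ∀ x, P x → ∀ a, MemLp a ∞ halfLine →
        Tendsto (fun t => a t - N x t / Real.log t) atTop (𝓝 0) →
        Λ x = Λ e / β * evalAt ω a := by
  obtain ⟨L, hL⟩ := exists_linearMap_le (upperValues P N Λ) h.upperValues_nonempty
    (fun z w a ha b hb => h.upperValues_add z w a ha b hb)
    (fun c hc z a ha => h.upperValues_smul c hc z a ha) h.upperValues_zero_nonneg
  have hβ := h.rate_pos
  have he := h.unit_pos
  have hle0 : ∀ z : Linfty, (∀ ε : ℝ, 0 < ε → ∀ᶠ t in atTop ⊓ ae halfLine, z t ≤ ε) → L z ≤ 0 :=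
    fun z hz => by
      have := hL z _ (mem_upperValues h.zero_mem h.zero_mem fun ε hε => by
        filter_upwards [hz ε hε] with t ht
        simpa using ht)
      simpa using this
  -- If a(t) and N_x(t)/log t have the same asymptotics, then Λx is an upper value of a and -Λx is
  -- one of -a, so L is determined at a.
  have hval : ∀ x, P x → ∀ a, ∀ ha : MemLp a ∞ halfLine,
      Tendsto (fun t => a t - N x t / Real.log t) atTop (𝓝 0) → L ha.toLp = Λ x :=
    fun x hx a ha hlim => by
      refine le_antisymm ?_ ?_
      · have := hL ha.toLp _ (mem_upperValues hx h.zero_mem fun ε hε => by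
          filter_upwards [eventually_inf_of_ae ha.coeFn_toLp,
            eventually_inf_of_atTop (hlim.eventually_lt_const hε),
            eventually_inf_of_atTop (eventually_gt_atTop 0)] with t e₁ e₂ ht
          rw [e₁, h.growth_zero t ht, sub_zero]
          linarith)
        rwa [h.map_zero, sub_zero] at this
      · have := hL (-ha.toLp) _ (mem_upperValues h.zero_mem hx fun ε hε => by
          filter_upwards [eventually_inf_of_ae ha.coeFn_toLp,
            eventually_inf_of_ae (Lp.coeFn_neg ha.toLp),
            eventually_inf_of_atTop (hlim.eventually_const_lt (neg_lt_zero.2 hε)),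
            eventually_inf_of_atTop (eventually_gt_atTop 0)] with t e₁ e₂ e₃ ht
          rw [e₂, Pi.neg_apply, e₁, h.growth_zero t ht, zero_sub, neg_div]
          linarith)
        rw [h.map_zero, zero_sub, map_neg] at this
        linarith
  have hmul : ∀ z, ((β / Λ e) • L) z = β / Λ e * L z := fun z => rfl
  -- The constant β has the asymptotics of N_e/log t, so L(β) = Λe; this factor normalises L at 1.
  refine ⟨(β / Λ e) • L, ⟨fun z hz => ?_, ?_, fun z hz => ?_⟩, fun s hs z w hw => ?_,
    fun x hx a ha hlim => ?_⟩
  · have h1 := hle0 (-z) fun ε hε => by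
      filter_upwards [eventually_inf_of_ae (Lp.coeFn_neg z),
        eventually_inf_of_ae ((Lp.coeFn_nonneg z).2 hz)] with t e₁ e₂
      rw [e₁, Pi.neg_apply]
      have : 0 ≤ z t := e₂
      linarith
    rw [map_neg] at h1
    rw [hmul]
    have : 0 ≤ L z := by linarith
    positivity
  · have h1 := hval e h.unit_mem (fun _ => β) (memLp_top_const β) (by
      simpa using (tendsto_const_nhds (x := β)).sub h.unit_growth)
    have h2 : (memLp_top_const β : MemLp (fun _ : ℝ => β) ∞ halfLine).toLp = β • oneLinfty := by
      rw [oneLinfty, ← MemLp.toLp_const_smul]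
      congr 1
      ext
      simp
    rw [h2, _root_.map_smul, smul_eq_mul] at h1
    rw [hmul, ← h1]
    have : L oneLinfty ≠ 0 := fun h0 => by
      rw [h0, mul_zero] at h1
      linarith
    field_simp
  · have h1 := hle0 z fun ε hε => by
      filter_upwards [hz.eventually_lt_const hε] with t ht using ht.le
    have h2 := hle0 (-z) fun ε hε => by
      filter_upwards [hz.eventually_const_lt (neg_lt_zero.2 hε),
        eventually_inf_of_ae (Lp.coeFn_neg z)] with t ht e₁
      rw [e₁, Pi.neg_apply]
      linarith
    rw [map_neg] at h2
    rw [hmul, show L z = 0 by linarith, mul_zero]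
  -- With x = y = 0 and w = v, the number 0 is an upper value of v, and likewise of -v.
  · have hd : ∀ v ∈ dilationDifferences, L v ≤ 0 := fun v hv => by
      have := hL v (Λ 0 - Λ 0) ⟨0, 0, h.zero_mem, h.zero_mem, rfl, 1, le_rfl, v, hv,
        fun ε hε => by
          filter_upwards [eventually_inf_of_atTop (eventually_gt_atTop 0)] with t ht
          rw [h.growth_zero _ (by positivity), h.growth_zero _ (by positivity)]
          simpa using hε.le⟩
      rwa [sub_self] at this
    have hmem : w - z ∈ dilationDifferences :=
      Submodule.subset_span ⟨s, hs, z, w, hw, rfl⟩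
    have h1 := hd _ hmem
    have h2 := hd _ (neg_mem hmem)
    rw [map_neg] at h2
    rw [map_sub] at h1 h2
    rw [hmul, hmul, show L w = L z by linarith]
  · rw [evalAt, dif_pos ha, hmul, hval x hx a ha hlim]
    field_simp

end GrowthModel

/-! ### The growth models of the Dixmier mean -/

lemma tendsto_div_log_of_abs_sub_le {g : ℝ → ℝ} {β C : ℝ}
    (h : ∀ᶠ t in atTop, |g t - β * Real.log t| ≤ C) :
    Tendsto (fun t => g t / Real.log t) atTop (𝓝 β) := by
  have h1 : Tendsto (fun t => (g t - β * Real.log t) / Real.log t) atTop (𝓝 0) := by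
    refine squeeze_zero_norm' (a := fun t => C / Real.log t) ?_
      (Real.tendsto_log_atTop.const_div_atTop C)
    filter_upwards [h, eventually_pos_log] with t ht hlog
    rw [Real.norm_eq_abs, abs_div, abs_of_pos hlog]
    gcongr
  have h2 := h1.add_const β
  rw [zero_add] at h2
  refine h2.congr' ?_
  filter_upwards [eventually_pos_log] with t ht
  field_simp
  ring

lemma log_one_add_le_log_two_add {t : ℝ} (ht : 1 ≤ t) :
    Real.log (1 + t) ≤ Real.log 2 + Real.log t := by
  rw [← Real.log_mul two_ne_zero (by linarith)]
  exact Real.log_le_log (by linarith) (by linarith)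

lemma log_le_log_one_add {t : ℝ} (ht : 0 < t) : Real.log t ≤ Real.log (1 + t) :=
  Real.log_le_log ht (by linarith)

lemma log_one_add_mul_le {a b : ℝ} (ha : 0 ≤ a) (hb : 0 ≤ b) :
    Real.log (1 + a * b) ≤ Real.log (1 + a) + Real.log (1 + b) := by
  rw [← Real.log_mul (by linarith) (by linarith)]
  exact Real.log_le_log (by positivity) (by nlinarith)

lemma tendsto_log_one_add_div_log :
    Tendsto (fun t : ℝ => Real.log (1 + t) / Real.log t) atTop (𝓝 1) := by
  refine tendsto_div_log_of_abs_sub_le (C := Real.log 2) ?_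
  filter_upwards [eventually_ge_atTop 1] with t ht
  rw [abs_le]
  have := log_one_add_le_log_two_add ht
  have := log_le_log_one_add (show 0 < t by linarith)
  have := Real.log_nonneg one_le_two
  constructor <;> linarith

lemma eventually_log_one_add_le : ∀ᶠ t : ℝ in atTop, Real.log (1 + t) ≤ 2 * Real.log t := by
  filter_upwards [eventually_ge_atTop 2] with t ht
  have := log_one_add_le_log_two_add (show 1 ≤ t by linarith)
  have := Real.log_le_log two_pos ht
  linarith

/-- Dilation invariant generalised limits exist. -/
theorem exists_isDilationInvariant :
    ∃ ω : Linfty →ₗ[ℝ] ℝ, IsGeneralisedLimit ω ∧ IsDilationInvariant ω := by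
  -- The one-dimensional model: the half-line of multiples of log(1+t).
  have h : IsGrowthModel (E := ℝ) (fun x => 0 ≤ x) (fun x t => x * Real.log (1 + t)) id 1 1 := by
    refine ⟨fun x y hx hy => add_nonneg hx hy, fun c hc x hx => mul_nonneg hc hx,
      fun x hx t ht => mul_nonneg hx (log_one_add_nonneg ht.le),
      fun x hx s t hs hst => mul_le_mul_of_nonneg_left (log_one_add_mono hs.le hst) hx,
      fun t _ => zero_mul _, fun x hx => ⟨x * 2, ?_⟩, fun x y hx hy t ht => ?_,
      fun x y hx hy t ht => ?_, fun c hc x hx => ⟨1, le_rfl, fun t ht => ?_⟩,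
      fun _ _ _ _ => rfl, fun _ _ _ _ => rfl, fun x y hx hy H => ?_, zero_le_one, ?_,
      one_pos, one_pos⟩
    · filter_upwards [eventually_log_one_add_le] with t ht
      rw [mul_assoc]
      exact mul_le_mul_of_nonneg_left ht hx
    · rw [← add_mul]
      exact mul_le_mul_of_nonneg_left (log_one_add_mono (by positivity) (by linarith))
        (add_nonneg hx hy)
    · rw [← add_mul]
      exact mul_le_mul_of_nonneg_left (log_one_add_mono (by positivity) (by linarith))
        (add_nonneg hx hy)
    · simp only [div_one, one_mul, smul_eq_mul, mul_assoc, le_refl, and_self]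
    · by_contra! hlt
      simp only [id] at hlt
      obtain ⟨R, hR, hev⟩ := H ((x - y) / 2) (by linarith)
      obtain ⟨t, h1, h2, h3⟩ := (hev.and ((eventually_gt_atTop 1).and (eventually_le_mul_log
        (y * Real.log (1 + R) + 1) (show 0 < (x - y) / 2 by linarith)))).exists
      have h4 := mul_le_mul_of_nonneg_left
        (log_one_add_mul_le (show 0 ≤ R by linarith) (show 0 ≤ t by linarith)) hy
      have h5 := mul_le_mul_of_nonneg_left (log_le_log_one_add (show 0 < t by linarith))
        (sub_pos.2 hlt).le
      linarith
    · simpa using tendsto_log_one_add_div_log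
  obtain ⟨ω, h1, h2, -⟩ := h.exists_generalisedLimit
  exact ⟨ω, h1, h2⟩

lemma IsMarcinkiewiczFun.integral_mono {x : ℝ → ℝ} (hx : IsMarcinkiewiczFun x) {s t : ℝ}
    (h : s ≤ t) : ∫ u in (0 : ℝ)..s, x u ≤ ∫ u in (0 : ℝ)..t, x u := by
  rw [← sub_nonneg, intervalIntegral.integral_interval_sub_left (hx.intervalIntegrable _ _)
    (hx.intervalIntegrable _ _)]
  exact intervalIntegral.integral_nonneg h fun u _ => hx.2.1 u

lemma IsMarcinkiewiczFun.integral_nonneg {x : ℝ → ℝ} (hx : IsMarcinkiewiczFun x) {t : ℝ}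
    (h : 0 ≤ t) : 0 ≤ ∫ u in (0 : ℝ)..t, x u :=
  intervalIntegral.integral_nonneg h fun u _ => hx.2.1 u

lemma IsMarcinkiewiczFun.integral_add {x y : ℝ → ℝ} (hx : IsMarcinkiewiczFun x)
    (hy : IsMarcinkiewiczFun y) (t : ℝ) :
    ∫ u in (0 : ℝ)..t, (x + y) u = (∫ u in (0 : ℝ)..t, x u) + ∫ u in (0 : ℝ)..t, y u :=
  intervalIntegral.integral_add (hx.intervalIntegrable _ _) (hy.intervalIntegrable _ _)

lemma integral_smul_fun (c : ℝ) (x : ℝ → ℝ) (t : ℝ) :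
    ∫ u in (0 : ℝ)..t, (c • x) u = c * ∫ u in (0 : ℝ)..t, x u :=
  intervalIntegral.integral_const_mul c x

lemma IsSymmetricFunctional.map_zero {Λ : (ℝ → ℝ) → ℝ} (hΛ : IsSymmetricFunctional Λ) :
    Λ 0 = 0 := by
  simpa using hΛ.map_smul 0 logDensity le_rfl isMarcinkiewiczFun_logDensity

lemma isMarcinkiewiczFun_zero : IsMarcinkiewiczFun 0 := by
  simpa using isMarcinkiewiczFun_logDensity.smul (le_refl (0 : ℝ))

/-- The primitive of any Marcinkiewicz function is at most K log(1+t), so monotonicity against y = 0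
with ε = K gives Λx ≤ K Λ(`logDensity`). -/
lemma IsSymmetricFunctional.eq_zero {Λ : (ℝ → ℝ) → ℝ} (hΛ : IsSymmetricFunctional Λ)
    (h0 : Λ logDensity = 0) {x : ℝ → ℝ} (hx : IsMarcinkiewiczFun x) : Λ x = 0 := by
  obtain ⟨K, hK0, hK⟩ := hx.exists_bound
  refine le_antisymm ?_ (hΛ.nonneg x hx)
  have := hΛ.mono x 0 hx isMarcinkiewiczFun_zero 1 K 0 one_pos hK0 le_rfl fun s hs => by
    simpa using hK s hs
  rwa [h0, hΛ.map_zero, mul_zero, add_zero] at this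

lemma le_of_forall_pos_le_add_mul {a b c : ℝ} (h : ∀ ε : ℝ, 0 < ε → a ≤ b + ε * c) : a ≤ b := by
  by_contra! hlt
  have := h ((a - b) / (2 * (|c| + 1))) (by have := sub_pos.2 hlt; positivity)
  have h1 : (a - b) / (2 * (|c| + 1)) * c ≤ (a - b) / (2 * (|c| + 1)) * (|c| + 1) := by
    have := sub_pos.2 hlt
    gcongr
    linarith [le_abs_self c]
  have h2 : (a - b) / (2 * (|c| + 1)) * (|c| + 1) = (a - b) / 2 := by
    have : |c| + 1 ≠ 0 := by positivity
    field_simp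
  linarith

lemma IsSymmetricFunctional.isGrowthModel_integral {Λ : (ℝ → ℝ) → ℝ}
    (hΛ : IsSymmetricFunctional Λ) (h0 : 0 < Λ logDensity) :
    IsGrowthModel IsMarcinkiewiczFun (fun x t => ∫ u in (0 : ℝ)..t, x u) Λ logDensity 1 := by
  refine ⟨fun x y hx hy => hx.add hy, fun c hc x hx => hx.smul hc,
    fun x hx t ht => hx.integral_nonneg ht.le, fun x hx s t hs hst => hx.integral_mono hst,
    fun t _ => by simp, fun x hx => ?_, fun x y hx hy t ht => ?_,
    fun x y hx hy t ht => ?_, fun c hc x hx => ⟨1, le_rfl, fun t ht => ?_⟩,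
    hΛ.map_add, fun c hc x hx => hΛ.map_smul c x hc hx, fun x y hx hy H => ?_,
    isMarcinkiewiczFun_logDensity, ?_, one_pos, h0⟩
  · obtain ⟨K, hK0, hK⟩ := hx.exists_bound
    refine ⟨K * 2, ?_⟩
    filter_upwards [eventually_log_one_add_le, eventually_ge_atTop 0] with t ht ht0
    rw [mul_assoc]
    exact (hK t ht0).trans (mul_le_mul_of_nonneg_left ht hK0)
  · rw [← hx.integral_add hy]
    exact (hx.add hy).integral_mono (by linarith)
  · rw [← hx.integral_add hy]
    exact (hx.add hy).integral_mono (by linarith)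
  · rw [integral_smul_fun, integral_smul_fun, div_one, one_mul]
    exact ⟨le_rfl, le_rfl⟩
  · refine le_of_forall_pos_le_add_mul (c := Λ logDensity) fun ε hε => ?_
    obtain ⟨R, hR, hev⟩ := H ε hε
    obtain ⟨T, hT⟩ := eventually_atTop.1 hev
    obtain ⟨n, hn⟩ := exists_nat_ge R
    -- An integer n ≥ R replaces the dilation factor. The constant b, the primitive of x at max(T,
    -- 1), covers the bounded range of s on which the asymptotic inequality is not available.
    refine hΛ.mono x y hx hy n ε (∫ u in (0 : ℝ)..max T 1, x u)
      (by exact_mod_cast (show (0 : ℝ) < n by linarith)) hε.le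
      (hx.integral_nonneg (by positivity)) fun s hs => ?_
    have hy0 : 0 ≤ ∫ u in (0 : ℝ)..(n * s), y u := hy.integral_nonneg (by positivity)
    have hlog : 0 ≤ ε * Real.log (1 + s) := mul_nonneg hε.le (log_one_add_nonneg hs)
    rcases le_total s (max T 1) with h | h
    · linarith [hx.integral_mono h]
    · have h1 : 1 ≤ s := (le_max_right _ _).trans h
      have h2 := hT s ((le_max_left _ _).trans h)
      have h3 := hy.integral_mono (show R * s ≤ n * s by gcongr)
      have h4 := mul_le_mul_of_nonneg_left (log_le_log_one_add (show 0 < s by linarith)) hε.le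
      have h5 : 0 ≤ ∫ u in (0 : ℝ)..max T 1, x u := hx.integral_nonneg (by positivity)
      linarith
  · refine tendsto_log_one_add_div_log.congr' ?_
    filter_upwards [eventually_ge_atTop 0] with t ht
    rw [integral_logDensity ht]

/-- The negative part of y - x tends to 0 at infinity and is annihilated by ω; the positive part has
a nonnegative value. -/
lemma evalAt_le_evalAt {ω : Linfty →ₗ[ℝ] ℝ} (hω : IsGeneralisedLimit ω) {x y : ℝ → ℝ}
    (hx : MemLp x ∞ halfLine) (hy : MemLp y ∞ halfLine)
    (h : ∀ ε : ℝ, 0 < ε → ∀ᶠ t in atTop, x t ≤ y t + ε) : evalAt ω x ≤ evalAt ω y := by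
  rw [evalAt, evalAt, dif_pos hx, dif_pos hy]
  set d : Linfty := hy.toLp - hx.toLp with hd
  have hd1 : ω d = ω d⁺ - ω d⁻ := by rw [← map_sub, posPart_sub_negPart]
  have hneg : ω d⁻ = 0 := by
    refine hω.map_null _ ?_
    have hcoe : ∀ᵐ t ∂halfLine, (d⁻ : Linfty) t = (y t - x t)⁻ := by
      have h1 : (d⁻ : Linfty) =ᵐ[halfLine] fun t => max (-(d t)) 0 := by
        have := Lp.coeFn_sup (-d) 0
        filter_upwards [this, Lp.coeFn_neg d, Lp.coeFn_zero ℝ ∞ halfLine] with t e1 e2 e3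
        rw [negPart_def, e1, Pi.sup_apply, e2, e3]
        rfl
      filter_upwards [h1, Lp.coeFn_sub hy.toLp hx.toLp, hy.coeFn_toLp, hx.coeFn_toLp]
        with t e1 e2 e3 e4
      rw [e1, hd, e2, Pi.sub_apply, e3, e4]
      rfl
    refine Metric.tendsto_nhds.2 fun ε hε => ?_
    filter_upwards [eventually_inf_of_ae hcoe,
      eventually_inf_of_atTop (h (ε / 2) (half_pos hε))] with t e1 e2
    rw [e1, dist_zero_right, Real.norm_of_nonneg (negPart_nonneg _), negPart_def]
    exact max_lt (by linarith) hε
  have hpos := hω.nonneg d⁺ (posPart_nonneg d)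
  have : ω d = ω hy.toLp - ω hx.toLp := by rw [hd, map_sub]
  linarith

section LevelIntegral

/-! ### The growth models of weighted excess integrals -/

/-- The integral of the part of `x` above the level `c`. -/
def excess (x : ℝ → ℝ) (c : ℝ) : ℝ≥0∞ := ∫⁻ u in Ioi (0 : ℝ), ENNReal.ofReal (x u - c)

lemma excess_antitone (x : ℝ → ℝ) : Antitone (excess x) := fun _ _ h =>
  lintegral_mono fun _ => ENNReal.ofReal_le_ofReal (by linarith)

lemma excess_mono {x y : ℝ → ℝ} (h : ∀ u, x u ≤ y u) (c : ℝ) : excess x c ≤ excess y c :=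
  lintegral_mono fun u => ENNReal.ofReal_le_ofReal (by linarith [h u])

lemma measurable_excess (x : ℝ → ℝ) : Measurable (excess x) := (excess_antitone x).measurable

/-- From (a + b - 2c)_+ ≤ (a - c)_+ + (b - c)_+. Doubling the level r/t amounts to halving t. -/
lemma excess_add_le {x y : ℝ → ℝ} (hx : Measurable x) (c : ℝ) :
    excess (x + y) (2 * c) ≤ excess x c + excess y c := by
  unfold excess
  rw [← lintegral_add_left (by fun_prop)]
  refine lintegral_mono fun u => ?_
  refine le_trans (ENNReal.ofReal_le_ofReal ?_) ENNReal.ofReal_add_le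
  rw [Pi.add_apply]
  linarith

lemma le_excess_add {x y : ℝ → ℝ} (hx : Measurable x) (hx0 : ∀ u, 0 ≤ x u) (hy0 : ∀ u, 0 ≤ y u)
    {c : ℝ} (hc : 0 ≤ c) : excess x c + excess y c ≤ excess (x + y) c := by
  unfold excess
  rw [← lintegral_add_left (by fun_prop)]
  refine lintegral_mono fun u => ?_
  rw [Pi.add_apply]
  rcases le_total (x u) c with h | h
  · rw [ENNReal.ofReal_of_nonpos (by linarith), zero_add]
    exact ENNReal.ofReal_le_ofReal (by linarith [hx0 u])
  · rcases le_total (y u) c with h' | h'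
    · rw [ENNReal.ofReal_of_nonpos (p := y u - c) (by linarith), add_zero]
      exact ENNReal.ofReal_le_ofReal (by linarith [hy0 u])
    · rw [← ENNReal.ofReal_add (by linarith) (by linarith)]
      exact ENNReal.ofReal_le_ofReal (by linarith)

lemma excess_smul (x : ℝ → ℝ) {k : ℝ} (hk : 0 ≤ k) (c : ℝ) :
    excess (k • x) (k * c) = ENNReal.ofReal k * excess x c := by
  unfold excess
  rw [← lintegral_const_mul' _ _ ENNReal.ofReal_ne_top]
  refine lintegral_congr fun u => ?_
  rw [← ENNReal.ofReal_mul hk, Pi.smul_apply, smul_eq_mul, mul_sub]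

lemma ofReal_integral_le_lintegral {α : Type*} [MeasurableSpace α] {μ : Measure α} {f : α → ℝ}
    (hf : Integrable f μ) : ENNReal.ofReal (∫ a, f a ∂μ) ≤ ∫⁻ a, ENNReal.ofReal (f a) ∂μ := by
  calc ENNReal.ofReal (∫ a, f a ∂μ) ≤ ENNReal.ofReal (∫ a, max (f a) 0 ∂μ) :=
        ENNReal.ofReal_le_ofReal (integral_mono hf hf.pos_part fun a => le_max_left _ _)
    _ = ∫⁻ a, ENNReal.ofReal (max (f a) 0) ∂μ :=
        ofReal_integral_eq_lintegral_ofReal hf.pos_part (ae_of_all _ fun a => le_max_right _ _)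
    _ = ∫⁻ a, ENNReal.ofReal (f a) ∂μ := lintegral_congr fun a => by
        rcases le_total (f a) 0 with h | h
        · rw [max_eq_right h, ENNReal.ofReal_zero, ENNReal.ofReal_of_nonpos h]
        · rw [max_eq_left h]

lemma IsMarcinkiewiczFun.integral_sub_const {x : ℝ → ℝ} (hx : IsMarcinkiewiczFun x) (c : ℝ)
    {s : ℝ} (hs : 0 ≤ s) :
    ∫ u in Ioc 0 s, (x u - c) = (∫ u in (0 : ℝ)..s, x u) - c * s := by
  rw [← intervalIntegral.integral_of_le hs, intervalIntegral.integral_sub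
    (hx.intervalIntegrable _ _) (by simp)]
  simp [mul_comm]

lemma IsMarcinkiewiczFun.integrableOn_sub_const {x : ℝ → ℝ} (hx : IsMarcinkiewiczFun x) (c : ℝ)
    {s : ℝ} (hs : 0 ≤ s) : IntegrableOn (fun u => x u - c) (Ioc 0 s) := by
  rw [← intervalIntegrable_iff_integrableOn_Ioc_of_le hs]
  exact (hx.intervalIntegrable 0 s).sub (by simp)

/-- With `exists_excess_eq`, this identifies the excess over c as the maximum over s ≥ 0 of ∫_0^s x
- cs, a Legendre transform of the primitive. Monotonicity under majorization follows. -/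
lemma IsMarcinkiewiczFun.ofReal_le_excess {x : ℝ → ℝ} (hx : IsMarcinkiewiczFun x) (c : ℝ)
    {s : ℝ} (hs : 0 ≤ s) :
    ENNReal.ofReal ((∫ u in (0 : ℝ)..s, x u) - c * s) ≤ excess x c := by
  rw [← hx.integral_sub_const c hs]
  refine (ofReal_integral_le_lintegral (hx.integrableOn_sub_const c hs)).trans ?_
  exact lintegral_mono_set Ioc_subset_Ioi_self

lemma IsMarcinkiewiczFun.excess_eq {x : ℝ → ℝ} (hx : IsMarcinkiewiczFun x) {a c : ℝ}
    (ha : 0 ≤ a) (h1 : ∀ u, 0 < u → u < a → c ≤ x u) (h2 : ∀ u, a < u → x u ≤ c) :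
    excess x c = ENNReal.ofReal ((∫ u in (0 : ℝ)..a, x u) - c * a) := by
  refine le_antisymm ?_ (hx.ofReal_le_excess c ha)
  rw [excess, ← Ioc_union_Ioi_eq_Ioi ha]
  refine (lintegral_union_le _ _ _).trans ?_
  have hz : ∫⁻ u in Ioi a, ENNReal.ofReal (x u - c) = 0 := by
    rw [setLIntegral_congr_fun measurableSet_Ioi (g := fun _ => 0) fun u hu =>
      ENNReal.ofReal_of_nonpos (by linarith [h2 u hu])]
    exact lintegral_zero
  rw [hz, add_zero, ← hx.integral_sub_const c ha,
    ofReal_integral_eq_lintegral_ofReal (hx.integrableOn_sub_const c ha)]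
  have : ∀ᵐ u : ℝ, u ≠ a := by simp [ae_iff]
  filter_upwards [ae_restrict_of_ae this, ae_restrict_mem measurableSet_Ioc] with u hu hu'
  have := h1 u hu'.1 (lt_of_le_of_ne hu'.2 hu)
  simpa using this

lemma IsMarcinkiewiczFun.tendsto_zero {x : ℝ → ℝ} (hx : IsMarcinkiewiczFun x) :
    Tendsto x atTop (𝓝 0) := by
  obtain ⟨K, hK0, hK⟩ := hx.exists_bound
  have hlim : Tendsto (fun t : ℝ => K * (2 * (Real.log t / t))) atTop (𝓝 0) := by
    have h1 : Tendsto (fun t : ℝ => Real.log t / t) atTop (𝓝 0) :=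
      Real.isLittleO_log_id_atTop.tendsto_div_nhds_zero
    simpa using (h1.const_mul 2).const_mul K
  refine tendsto_of_tendsto_of_tendsto_of_le_of_le' tendsto_const_nhds hlim
    (Eventually.of_forall hx.2.1) ?_
  filter_upwards [eventually_gt_atTop 0, eventually_log_one_add_le] with t ht hlog
  have h1 : t * x t ≤ ∫ u in (0 : ℝ)..t, x u := by
    have := intervalIntegral.integral_mono_on ht.le
      (intervalIntegrable_const (c := x t)) (hx.intervalIntegrable 0 t) fun u hu => hx.1 hu.2
    simpa using this
  have h2 := (h1.trans (hK t ht.le)).trans (mul_le_mul_of_nonneg_left hlog hK0)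
  rw [← mul_div_assoc, ← mul_div_assoc, le_div_iff₀ ht]
  linarith

lemma IsMarcinkiewiczFun.exists_excess_eq {x : ℝ → ℝ} (hx : IsMarcinkiewiczFun x) {c : ℝ}
    (hc : 0 < c) :
    ∃ a : ℝ, 0 ≤ a ∧ excess x c = ENNReal.ofReal ((∫ u in (0 : ℝ)..a, x u) - c * a) := by
  obtain ⟨T, hT⟩ := eventually_atTop.1 (hx.tendsto_zero.eventually_lt_const hc)
  -- The maximum is attained where x crosses the level c. Including the nonpositive numbers keeps
  -- the set nonempty and its supremum nonnegative.
  set S : Set ℝ := {u | u ≤ 0 ∨ c < x u} with hS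
  have h0 : (0 : ℝ) ∈ S := Or.inl le_rfl
  have hbdd : BddAbove S := ⟨max T 0, fun u hu => by
    rcases hu with h | h
    · exact h.trans (le_max_right _ _)
    · by_contra! hlt
      exact absurd (hT u ((le_max_left _ _).trans hlt.le)) (not_lt.2 h.le)⟩
  refine ⟨sSup S, le_csSup hbdd h0, hx.excess_eq (le_csSup hbdd h0) (fun u hu hua => ?_)
    fun u hu => ?_⟩
  · obtain ⟨v, hv, huv⟩ := exists_lt_of_lt_csSup ⟨0, h0⟩ hua
    rcases hv with h | h
    · linarith
    · exact h.le.trans (hx.1 huv.le)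
  · by_contra! hlt
    exact absurd (le_csSup hbdd (Or.inr hlt)) (not_le.2 hu)

lemma IsMarcinkiewiczFun.excess_le_of_majorized {x y : ℝ → ℝ} (hx : IsMarcinkiewiczFun x)
    (hy : IsMarcinkiewiczFun y)
    (h : ∀ t : ℝ, 0 ≤ t → ∫ u in (0 : ℝ)..t, x u ≤ ∫ u in (0 : ℝ)..t, y u) {c : ℝ} (hc : 0 < c) :
    excess x c ≤ excess y c := by
  obtain ⟨a, ha, hxa⟩ := hx.exists_excess_eq hc
  rw [hxa]
  exact (ENNReal.ofReal_le_ofReal (by linarith [h a ha])).trans (hy.ofReal_le_excess c ha)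

lemma IsMarcinkiewiczFun.exists_bound_pos {x : ℝ → ℝ} (hx : IsMarcinkiewiczFun x) :
    ∃ K : ℝ, 0 < K ∧ ∀ t : ℝ, 0 ≤ t → ∫ s in (0 : ℝ)..t, x s ≤ K * Real.log (1 + t) := by
  obtain ⟨K, hK0, hK⟩ := hx.exists_bound
  refine ⟨K + 1, by linarith, fun t ht => (hK t ht).trans ?_⟩
  have := log_one_add_nonneg ht
  gcongr
  linarith

/-- An upper estimate for max_a (K log(1+a) - ca), obtained from the tangent to the logarithm at 1 +
K/c. -/
lemma IsMarcinkiewiczFun.excess_le {x : ℝ → ℝ} (hx : IsMarcinkiewiczFun x) {K : ℝ} (hK0 : 0 < K)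
    (hK : ∀ t : ℝ, 0 ≤ t → ∫ s in (0 : ℝ)..t, x s ≤ K * Real.log (1 + t)) {c : ℝ} (hc : 0 < c) :
    excess x c ≤ ENNReal.ofReal (K * Real.log (1 + K / c)) := by
  obtain ⟨a, ha, hxa⟩ := hx.exists_excess_eq hc
  rw [hxa]
  refine ENNReal.ofReal_le_ofReal ?_
  have h1 : Real.log (1 + a) ≤ Real.log (1 + K / c) + a * c / (c + K) := by
    have h2 : 0 < 1 + K / c := by positivity
    have h3 := Real.log_le_sub_one_of_pos (show 0 < (1 + a) / (1 + K / c) by positivity)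
    rw [Real.log_div (by positivity) h2.ne'] at h3
    have h4 : (1 + a) / (1 + K / c) - 1 ≤ a * c / (c + K) := by
      have : (1 + a) / (1 + K / c) - 1 = (a * c - K) / (c + K) := by
        field_simp
        ring
      rw [this]
      gcongr
      linarith
    linarith
  have h5 : K * (a * c / (c + K)) ≤ c * a := by
    rw [← mul_div_assoc, div_le_iff₀ (by positivity)]
    have : 0 ≤ c * a * c := by positivity
    nlinarith
  have h6 := mul_le_mul_of_nonneg_left h1 hK0.le
  linarith [hK a ha]

/-- The conditions on a measure of levels under which the weighted excess integrals grow like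
`log t`. -/
structure IsLevelWeight (ν : Measure ℝ) : Prop where
  pos : ∀ᵐ r ∂ν, 0 < r
  mass_ne_zero : ν univ ≠ 0
  mass_ne_top : ν univ ≠ ∞
  moment : ∫⁻ r, ENNReal.ofReal r ∂ν ≠ ∞
  invMoment : ∫⁻ r, ENNReal.ofReal r⁻¹ ∂ν ≠ ∞

/-- The integral of the excess of `x` over the levels `r / t`. -/
def levelIntegral (ν : Measure ℝ) (x : ℝ → ℝ) (t : ℝ) : ℝ≥0∞ := ∫⁻ r, excess x (r / t) ∂ν

variable {ν : Measure ℝ}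

lemma IsLevelWeight.levelIntegral_mono (hν : IsLevelWeight ν) (x : ℝ → ℝ) {s t : ℝ} (hs : 0 < s)
    (h : s ≤ t) : levelIntegral ν x s ≤ levelIntegral ν x t := by
  refine lintegral_mono_ae ?_
  filter_upwards [hν.pos] with r hr
  exact excess_antitone x (by gcongr)

lemma IsLevelWeight.levelIntegral_mono_majorized (hν : IsLevelWeight ν) {x y : ℝ → ℝ}
    (hx : IsMarcinkiewiczFun x) (hy : IsMarcinkiewiczFun y)
    (h : ∀ t : ℝ, 0 ≤ t → ∫ u in (0 : ℝ)..t, x u ≤ ∫ u in (0 : ℝ)..t, y u) {t : ℝ} (ht : 0 < t) :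
    levelIntegral ν x t ≤ levelIntegral ν y t := by
  refine lintegral_mono_ae ?_
  filter_upwards [hν.pos] with r hr
  exact hx.excess_le_of_majorized hy h (by positivity)

/-- Levels r ≥ r₀ are bounded by the excess over r₀/t. Levels r < r₀ use the logarithmic estimate
with log(1 + Kt/r) ≤ log(1 + Kt) + 1/r. The coefficient of log(1 + Kt) is Kν(r < r₀), which can be
made small. -/
lemma IsLevelWeight.levelIntegral_le (hν : IsLevelWeight ν) {x : ℝ → ℝ}
    (hx : IsMarcinkiewiczFun x) {K : ℝ} (hK0 : 0 < K)
    (hK : ∀ t : ℝ, 0 ≤ t → ∫ s in (0 : ℝ)..t, x s ≤ K * Real.log (1 + t)) {t : ℝ} (ht : 0 < t)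
    (r₀ : ℝ) :
    levelIntegral ν x t ≤ ν univ * excess x (r₀ / t)
      + ν (Iio r₀) * ENNReal.ofReal (K * Real.log (1 + K * t))
      + ENNReal.ofReal K * ∫⁻ r, ENNReal.ofReal r⁻¹ ∂ν := by
  have hpt : ∀ᵐ r ∂ν, excess x (r / t) ≤ excess x (r₀ / t)
      + ((Iio r₀).indicator (fun _ => ENNReal.ofReal (K * Real.log (1 + K * t))) r
      + ENNReal.ofReal K * ENNReal.ofReal r⁻¹) := by
    filter_upwards [hν.pos] with r hr
    by_cases hr0 : r < r₀
    · refine le_trans ?_ le_add_self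
      rw [indicator_of_mem (show r ∈ Iio r₀ from hr0), ← ENNReal.ofReal_mul hK0.le,
        ← ENNReal.ofReal_add (mul_nonneg hK0.le (log_one_add_nonneg (by positivity)))
          (by positivity)]
      refine (hx.excess_le hK0 hK (by positivity)).trans (ENNReal.ofReal_le_ofReal ?_)
      rw [← mul_add]
      gcongr
      rw [show K / (r / t) = (K * t) * r⁻¹ by field_simp]
      refine (log_one_add_mul_le (by positivity) (by positivity)).trans ?_
      have := Real.log_le_sub_one_of_pos (show 0 < 1 + r⁻¹ by positivity)
      linarith
    · refine le_trans (excess_antitone x ?_) le_self_add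
      have := not_lt.1 hr0
      gcongr
  calc levelIntegral ν x t ≤ _ := lintegral_mono_ae hpt
    _ = _ := by
      rw [lintegral_add_left measurable_const, lintegral_const,
        lintegral_add_left (measurable_const.indicator measurableSet_Iio),
        lintegral_indicator_const measurableSet_Iio, lintegral_const_mul' _ _ ENNReal.ofReal_ne_top]
      ring

/-- The lower bound ∫_0^s x - (r/t)s for the excess over r/t is integrated in r, with the same s for
all levels. -/
lemma IsMarcinkiewiczFun.le_levelIntegral {x : ℝ → ℝ} (hx : IsMarcinkiewiczFun x) (ν : Measure ℝ)
    {s t : ℝ} (hs : 0 ≤ s) (ht : 0 < t) :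
    ν univ * ENNReal.ofReal (∫ u in (0 : ℝ)..s, x u)
      ≤ levelIntegral ν x t + ENNReal.ofReal (s / t) * ∫⁻ r, ENNReal.ofReal r ∂ν := by
  rw [mul_comm, ← lintegral_const, ← lintegral_const_mul' _ _ ENNReal.ofReal_ne_top,
    levelIntegral, ← lintegral_add_left (f := fun r => excess x (r / t))
      ((measurable_excess x).comp (measurable_id.div_const t))]
  refine lintegral_mono fun r => ?_
  rw [← ENNReal.ofReal_mul (by positivity)]
  calc ENNReal.ofReal (∫ u in (0 : ℝ)..s, x u)
      = ENNReal.ofReal (((∫ u in (0 : ℝ)..s, x u) - r / t * s) + s / t * r) := by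
        congr 1
        ring
    _ ≤ ENNReal.ofReal ((∫ u in (0 : ℝ)..s, x u) - r / t * s) + ENNReal.ofReal (s / t * r) :=
        ENNReal.ofReal_add_le
    _ ≤ _ := by
        gcongr
        exact hx.ofReal_le_excess _ hs

lemma IsLevelWeight.levelIntegral_ne_top (hν : IsLevelWeight ν) {x : ℝ → ℝ}
    (hx : IsMarcinkiewiczFun x) {t : ℝ} (ht : 0 < t) : levelIntegral ν x t ≠ ∞ := by
  obtain ⟨K, hK0, hK⟩ := hx.exists_bound_pos
  refine ne_top_of_le_ne_top ?_ (hν.levelIntegral_le hx hK0 hK ht 1)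
  have h1 : excess x (1 / t) ≠ ∞ :=
    ne_top_of_le_ne_top ENNReal.ofReal_ne_top (hx.excess_le hK0 hK (by positivity))
  have h2 : ν (Iio 1) ≠ ∞ := ne_top_of_le_ne_top hν.mass_ne_top (measure_mono (subset_univ _))
  exact ENNReal.add_ne_top.2 ⟨ENNReal.add_ne_top.2 ⟨ENNReal.mul_ne_top hν.mass_ne_top h1,
    ENNReal.mul_ne_top h2 ENNReal.ofReal_ne_top⟩,
    ENNReal.mul_ne_top ENNReal.ofReal_ne_top hν.invMoment⟩

lemma IsLevelWeight.mass_pos (hν : IsLevelWeight ν) : 0 < ν.real univ :=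
  ENNReal.toReal_pos hν.mass_ne_zero hν.mass_ne_top

/-- The real form of the upper estimate of the level integral. -/
lemma IsLevelWeight.toReal_levelIntegral_le (hν : IsLevelWeight ν) {x : ℝ → ℝ}
    (hx : IsMarcinkiewiczFun x) {K : ℝ} (hK0 : 0 < K)
    (hK : ∀ t : ℝ, 0 ≤ t → ∫ s in (0 : ℝ)..t, x s ≤ K * Real.log (1 + t)) {t : ℝ} (ht : 0 < t)
    {r₀ : ℝ} (hr₀ : 0 < r₀) :
    (levelIntegral ν x t).toReal ≤ ν.real univ * (excess x (r₀ / t)).toReal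
      + ν.real (Iio r₀) * (K * Real.log (1 + K * t))
      + K * (∫⁻ r, ENNReal.ofReal r⁻¹ ∂ν).toReal := by
  have h1 : excess x (r₀ / t) ≠ ∞ :=
    ne_top_of_le_ne_top ENNReal.ofReal_ne_top (hx.excess_le hK0 hK (by positivity))
  have h2 : ν (Iio r₀) ≠ ∞ := ne_top_of_le_ne_top hν.mass_ne_top (measure_mono (subset_univ _))
  have e1 := ENNReal.mul_ne_top hν.mass_ne_top h1
  have e2 : ν (Iio r₀) * ENNReal.ofReal (K * Real.log (1 + K * t)) ≠ ∞ :=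
    ENNReal.mul_ne_top h2 ENNReal.ofReal_ne_top
  have e3 : ENNReal.ofReal K * ∫⁻ r, ENNReal.ofReal r⁻¹ ∂ν ≠ ∞ :=
    ENNReal.mul_ne_top ENNReal.ofReal_ne_top hν.invMoment
  have h := ENNReal.toReal_mono (ENNReal.add_ne_top.2 ⟨ENNReal.add_ne_top.2 ⟨e1, e2⟩, e3⟩)
    (hν.levelIntegral_le hx hK0 hK ht r₀)
  rw [ENNReal.toReal_add (ENNReal.add_ne_top.2 ⟨e1, e2⟩) e3, ENNReal.toReal_add e1 e2,
    ENNReal.toReal_mul, ENNReal.toReal_mul, ENNReal.toReal_mul, ENNReal.toReal_ofReal hK0.le,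
    ENNReal.toReal_ofReal (mul_nonneg hK0.le (log_one_add_nonneg (by positivity)))] at h
  exact h

/-- The real form of the lower estimate of the level integral. -/
lemma IsLevelWeight.le_toReal_levelIntegral (hν : IsLevelWeight ν) {x : ℝ → ℝ}
    (hx : IsMarcinkiewiczFun x) {s t : ℝ} (hs : 0 ≤ s) (ht : 0 < t) :
    ν.real univ * (∫ u in (0 : ℝ)..s, x u)
      ≤ (levelIntegral ν x t).toReal + s / t * (∫⁻ r, ENNReal.ofReal r ∂ν).toReal := by
  have e1 := hν.levelIntegral_ne_top hx ht
  have e2 : ENNReal.ofReal (s / t) * ∫⁻ r, ENNReal.ofReal r ∂ν ≠ ∞ :=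
    ENNReal.mul_ne_top ENNReal.ofReal_ne_top hν.moment
  have h := ENNReal.toReal_mono (ENNReal.add_ne_top.2 ⟨e1, e2⟩) (hx.le_levelIntegral ν hs ht)
  rw [ENNReal.toReal_add e1 e2, ENNReal.toReal_mul, ENNReal.toReal_mul,
    ENNReal.toReal_ofReal (hx.integral_nonneg hs), ENNReal.toReal_ofReal (by positivity)] at h
  exact h

lemma IsLevelWeight.exists_levelIntegral_le_log (hν : IsLevelWeight ν) {x : ℝ → ℝ}
    (hx : IsMarcinkiewiczFun x) {K : ℝ} (hK0 : 0 < K)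
    (hK : ∀ t : ℝ, 0 ≤ t → ∫ s in (0 : ℝ)..t, x s ≤ K * Real.log (1 + t)) :
    ∃ C : ℝ, ∀ t : ℝ, 0 < t →
      (levelIntegral ν x t).toReal ≤ ν.real univ * K * Real.log (1 + t) + C := by
  refine ⟨ν.real univ * K * Real.log (1 + K) + K * (∫⁻ r, ENNReal.ofReal r⁻¹ ∂ν).toReal,
    fun t ht => ?_⟩
  -- For r₀ ≥ t x(0) the level r₀/t lies above x on the half-line, so letting r₀ grow removes the
  -- excess term.
  have hlim : Tendsto (fun r₀ : ℝ => excess x (r₀ / t)) atTop (𝓝 0) := by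
    refine tendsto_const_nhds.congr' ?_
    filter_upwards [eventually_ge_atTop (t * x 0)] with r hr
    rw [excess, setLIntegral_congr_fun measurableSet_Ioi (g := fun _ => 0) fun u hu =>
      ENNReal.ofReal_of_nonpos ?_, lintegral_zero]
    have h1 : x u ≤ x 0 := hx.1 (le_of_lt hu)
    have h2 : x 0 ≤ r / t := by
      rw [le_div_iff₀ ht]
      linarith
    linarith
  have hlim' : Tendsto (fun r₀ : ℝ => ν.real univ * (excess x (r₀ / t)).toReal
      + ν.real univ * (K * Real.log (1 + K * t))
      + K * (∫⁻ r, ENNReal.ofReal r⁻¹ ∂ν).toReal) atTop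
      (𝓝 (ν.real univ * 0 + ν.real univ * (K * Real.log (1 + K * t))
      + K * (∫⁻ r, ENNReal.ofReal r⁻¹ ∂ν).toReal)) :=
    ((((ENNReal.tendsto_toReal ENNReal.zero_ne_top).comp hlim).const_mul _).add_const _).add_const _
  have hle := ge_of_tendsto hlim' (b := (levelIntegral ν x t).toReal) (by
    filter_upwards [eventually_gt_atTop 0] with r₀ hr₀
    refine (hν.toReal_levelIntegral_le hx hK0 hK ht hr₀).trans ?_
    have h1 : 0 ≤ K * Real.log (1 + K * t) :=
      mul_nonneg hK0.le (log_one_add_nonneg (by positivity))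
    have h2 : ν.real (Iio r₀) ≤ ν.real univ :=
      measureReal_mono (subset_univ _) hν.mass_ne_top
    gcongr)
  have h3 := mul_le_mul_of_nonneg_left (log_one_add_mul_le hK0.le ht.le)
    (mul_nonneg hν.mass_pos.le hK0.le)
  linarith

end LevelIntegral

/-! ### Comparing level integrals with primitives -/

section LevelIntegral

variable {ν : Measure ℝ}

lemma levelIntegral_add_le (x : ℝ → ℝ) {y : ℝ → ℝ}
    (hx : Measurable x) (t : ℝ) :
    levelIntegral ν (x + y) (t / 2) ≤ levelIntegral ν x t + levelIntegral ν y t := by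
  unfold levelIntegral
  rw [← lintegral_add_left (f := fun r => excess x (r / t))
    ((measurable_excess x).comp (measurable_id.div_const t))]
  refine lintegral_mono fun r => ?_
  rw [show r / (t / 2) = 2 * (r / t) by rw [div_div_eq_mul_div]; ring]
  exact excess_add_le hx _

lemma IsLevelWeight.le_levelIntegral_add (hν : IsLevelWeight ν) {x y : ℝ → ℝ}
    (hx : IsMarcinkiewiczFun x) (hy : IsMarcinkiewiczFun y) {t : ℝ} (ht : 0 < t) :
    levelIntegral ν x t + levelIntegral ν y t ≤ levelIntegral ν (x + y) t := by
  unfold levelIntegral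
  rw [← lintegral_add_left (f := fun r => excess x (r / t))
    ((measurable_excess x).comp (measurable_id.div_const t))]
  refine lintegral_mono_ae ?_
  filter_upwards [hν.pos] with r hr
  exact le_excess_add hx.1.measurable hx.2.1 hy.2.1 (by positivity)

lemma levelIntegral_smul (ν : Measure ℝ) (x : ℝ → ℝ) {k : ℝ} (hk : 0 < k) (t : ℝ) :
    levelIntegral ν (k • x) (t / k) = ENNReal.ofReal k * levelIntegral ν x t := by
  unfold levelIntegral
  rw [← lintegral_const_mul' _ _ ENNReal.ofReal_ne_top]
  refine lintegral_congr fun r => ?_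
  rw [← excess_smul x hk.le, div_div_eq_mul_div, mul_comm r k, mul_div_assoc]

lemma IsLevelWeight.toReal_levelIntegral_mono (hν : IsLevelWeight ν) {x : ℝ → ℝ}
    (hx : IsMarcinkiewiczFun x) {s t : ℝ} (hs : 0 < s) (h : s ≤ t) :
    (levelIntegral ν x s).toReal ≤ (levelIntegral ν x t).toReal :=
  ENNReal.toReal_mono (hν.levelIntegral_ne_top hx (hs.trans_le h)) (hν.levelIntegral_mono x hs h)

/-- Markov's inequality for 1/r: the mass below r₀ is at most r₀ times the inverse moment. -/
lemma IsLevelWeight.exists_measureReal_Iio_lt (hν : IsLevelWeight ν) {ε : ℝ} (hε : 0 < ε) :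
    ∃ r₀ : ℝ, 0 < r₀ ∧ ν.real (Iio r₀) ≤ ε := by
  have hD : ∀ r₀ : ℝ, 0 < r₀ → ν.real (Iio r₀) ≤ r₀ * (∫⁻ r, ENNReal.ofReal r⁻¹ ∂ν).toReal :=
    fun r₀ hr₀ => by
      have h1 : ν (Iio r₀) ≤ ENNReal.ofReal r₀ * ∫⁻ r, ENNReal.ofReal r⁻¹ ∂ν := by
        rw [← lintegral_const_mul' _ _ ENNReal.ofReal_ne_top,
          ← lintegral_indicator_one measurableSet_Iio]
        refine lintegral_mono_ae ?_
        filter_upwards [hν.pos] with r hr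
        by_cases hr' : r ∈ Iio r₀
        swap
        · rw [indicator_of_notMem hr']
          exact zero_le
        rw [indicator_of_mem hr', ← ENNReal.ofReal_mul hr₀.le, Pi.one_apply, ← ENNReal.ofReal_one]
        refine ENNReal.ofReal_le_ofReal ?_
        rw [← div_eq_mul_inv, one_le_div hr]
        exact (mem_Iio.1 hr').le
      have := ENNReal.toReal_mono (ENNReal.mul_ne_top ENNReal.ofReal_ne_top hν.invMoment) h1
      rwa [ENNReal.toReal_mul, ENNReal.toReal_ofReal hr₀.le] at this
  set D := (∫⁻ r, ENNReal.ofReal r⁻¹ ∂ν).toReal with hDdef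
  have hD0 : 0 ≤ D := ENNReal.toReal_nonneg
  refine ⟨ε / (D + 1), by positivity, (hD _ (by positivity)).trans ?_⟩
  rw [div_mul_eq_mul_div, div_le_iff₀ (by positivity)]
  gcongr
  linarith

/-- Comparison of level integrals of `x` and `y`, where `y` decays at most like `1 / s`, implies
comparison of the integrals of `x` and `y`. -/
lemma IsLevelWeight.exists_integral_le (hν : IsLevelWeight ν) {x y : ℝ → ℝ}
    (hx : IsMarcinkiewiczFun x) (hy : IsMarcinkiewiczFun y) {δ : ℝ} (hδ : 0 < δ)
    (hδy : ∀ s, δ * logDensity s ≤ y s) {ε R : ℝ} (hε : 0 < ε) (hR : 1 ≤ R)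
    (h : ∀ᶠ t in atTop, (levelIntegral ν x t).toReal
      ≤ (levelIntegral ν y (R * t)).toReal + ε * Real.log t) :
    ∃ (n : ℕ) (b : ℝ), 0 < n ∧ 0 ≤ b ∧ ∀ s : ℝ, 0 ≤ s →
      ν.real univ * (∫ u in (0 : ℝ)..s, x u)
        ≤ ν.real univ * (∫ u in (0 : ℝ)..(n * s), y u) + 2 * ε * Real.log (1 + s) + b := by
  obtain ⟨K, hK0, hK⟩ := hy.exists_bound_pos
  have hR0 : 0 < R := by linarith
  have hΓ := hν.mass_pos
  set Γ := ν.real univ with hΓdef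
  set m := (∫⁻ r, ENNReal.ofReal r ∂ν).toReal with hm
  set D := (∫⁻ r, ENNReal.ofReal r⁻¹ ∂ν).toReal with hD
  have hm0 : 0 ≤ m := ENNReal.toReal_nonneg
  have hD0 : 0 ≤ D := ENNReal.toReal_nonneg
  obtain ⟨r₀, hr₀, hνr⟩ := hν.exists_measureReal_Iio_lt (show 0 < ε / K by positivity)
  -- This n gives mR ≤ Γ r₀ n, so that the correction (s/t)m of the lower estimate is covered by
  -- Γ·Y·ns below.
  obtain ⟨n, hn⟩ := exists_nat_ge (m * R / (Γ * r₀) + 1)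
  have hn1 : (1 : ℝ) ≤ n := by
    have : 0 ≤ m * R / (Γ * r₀) := by positivity
    linarith
  have hn0 : (0 : ℝ) < n := by linarith
  have hlogD : ∀ s : ℝ, 0 ≤ s → logDensity s = 1 / (1 + s) := fun s hs => by
    rw [logDensity, max_eq_left hs]
  have hypos : ∀ s : ℝ, 0 ≤ s → 0 < y s := fun s hs => by
    refine lt_of_lt_of_le ?_ (hδy s)
    rw [hlogD s hs]
    positivity
  have hns : Tendsto (fun s : ℝ => n * s) atTop atTop := tendsto_id.const_mul_atTop hn0
  have hτ : Tendsto (fun s : ℝ => r₀ / (R * y (n * s))) atTop atTop := by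
    have h1 : Tendsto (fun s : ℝ => R * y (n * s)) atTop (𝓝[>] 0) := by
      refine tendsto_nhdsWithin_iff.2 ⟨?_, ?_⟩
      · simpa using (hy.tendsto_zero.comp hns).const_mul R
      · filter_upwards [eventually_ge_atTop 0] with s hs
        exact mul_pos hR0 (hypos _ (by positivity))
    simpa [div_eq_mul_inv] using (h1.inv_tendsto_nhdsGT_zero).const_mul_atTop hr₀
  obtain ⟨S, hS⟩ := eventually_atTop.1 (hτ.eventually h)
  set C : ℝ := Real.log (1 + r₀ / δ) + Real.log (1 + K * (r₀ / δ)) + 2 * Real.log 2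
    + 2 * Real.log (1 + n) with hC
  have hC0 : 0 ≤ C := by
    have h1 := log_one_add_nonneg (show 0 ≤ r₀ / δ by positivity)
    have h2 := log_one_add_nonneg (show 0 ≤ K * (r₀ / δ) by positivity)
    have h3 := log_one_add_nonneg hn0.le
    have h4 := Real.log_nonneg one_le_two
    positivity
  refine ⟨n, Γ * (∫ u in (0 : ℝ)..max S 0, x u) + ε * C + K * D, by exact_mod_cast hn0, ?_,
    fun s hs => ?_⟩
  · have := hx.integral_nonneg (le_max_right S 0)
    positivity
  have hI0 : 0 ≤ Γ * ∫ u in (0 : ℝ)..max S 0, x u :=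
    mul_nonneg hΓ.le (hx.integral_nonneg (le_max_right S 0))
  have hlogs := log_one_add_nonneg hs
  rcases le_total s S with hsS | hsS
  · have h1 := mul_le_mul_of_nonneg_left (hx.integral_mono (hsS.trans (le_max_left S 0))) hΓ.le
    have h2 : 0 ≤ Γ * (∫ u in (0 : ℝ)..(n * s), y u) :=
      mul_nonneg hΓ.le (hy.integral_nonneg (by positivity))
    have h3 : 0 ≤ 2 * ε * Real.log (1 + s) := by positivity
    have h4 : 0 ≤ ε * C + K * D := by positivity
    linarith
  have hns0 : 0 ≤ n * s := by positivity
  have hY := hypos _ hns0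
  set Y := y (n * s) with hYdef
  -- For this t the level r₀/(Rt) is the value y(ns), so the excess of y over it is ∫_0^{ns} y -
  -- Y·ns. The negative term compensates the correction (s/t)m of the lower estimate for x.
  set t := r₀ / (R * Y) with ht
  have ht0 : 0 < t := by positivity
  have hRt : R * t = r₀ / Y := by
    rw [ht]
    field_simp
  have h1 := hν.le_toReal_levelIntegral hx hs ht0
  have h2 := hS s hsS
  have h3 := hν.toReal_levelIntegral_le hy hK0 hK (show 0 < R * t by positivity) hr₀
  have h4 : r₀ / (R * t) = Y := by
    rw [hRt]
    field_simp
  have h5 : (excess y Y).toReal = (∫ u in (0 : ℝ)..(n * s), y u) - Y * (n * s) := by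
    rw [hy.excess_eq hns0 (fun u _ hu => hy.1 hu.le) (fun u hu => hy.1 hu.le),
      ENNReal.toReal_ofReal]
    have := intervalIntegral.integral_mono_on hns0
      (intervalIntegrable_const (c := Y)) (hy.intervalIntegrable 0 (n * s)) fun u hu => hy.1 hu.2
    simp only [intervalIntegral.integral_const, smul_eq_mul, sub_zero] at this
    linarith
  rw [h4, h5] at h3
  have h6 : s / t * m ≤ Γ * (Y * (n * s)) := by
    have h7 : m * R ≤ Γ * r₀ * n := by
      have : m * R / (Γ * r₀) ≤ n := by linarith
      rwa [div_le_iff₀' (by positivity)] at this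
    have h8 : s / t * m = (m * R) * (s * Y / r₀) := by
      rw [ht]
      field_simp
    rw [h8]
    calc m * R * (s * Y / r₀) ≤ Γ * r₀ * n * (s * Y / r₀) := by gcongr
      _ = Γ * (Y * (n * s)) := by field_simp
  -- The lower bound y ≥ δ/(1+s) enters here: t grows at most linearly in s, so log t and log(1 +
  -- KRt) are log(1+s) plus constants at most. Each carries the coefficient ε, which explains the 2ε
  -- in the conclusion.
  have hRtle : R * t ≤ r₀ / δ * (1 + n * s) := by
    rw [hRt, div_mul_eq_mul_div, div_le_div_iff₀ hY hδ]
    have h9 : δ ≤ Y * (1 + n * s) := by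
      have := hδy (n * s)
      rwa [hlogD _ hns0, mul_one_div, div_le_iff₀ (by positivity)] at this
    calc r₀ * δ ≤ r₀ * (Y * (1 + n * s)) := by gcongr
      _ = _ := by ring
  have hlog2 : Real.log (1 + (1 + n * s)) ≤ Real.log 2 + Real.log (1 + n) + Real.log (1 + s) := by
    have h10 := log_one_add_le_log_two_add (show 1 ≤ 1 + n * s by linarith)
    have h11 := log_one_add_mul_le hn0.le hs
    linarith
  have hlogt : Real.log t ≤ Real.log (1 + r₀ / δ) + (Real.log 2 + Real.log (1 + n)
      + Real.log (1 + s)) := by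
    have ht' : t ≤ r₀ / δ * (1 + n * s) := (le_mul_of_one_le_left ht0.le hR).trans hRtle
    refine (Real.log_le_log ht0 (show t ≤ 1 + r₀ / δ * (1 + n * s) by linarith)).trans ?_
    refine (log_one_add_mul_le (by positivity) (by positivity)).trans ?_
    linarith
  have hlogK : Real.log (1 + K * (R * t)) ≤ Real.log (1 + K * (r₀ / δ)) + (Real.log 2
      + Real.log (1 + n) + Real.log (1 + s)) := by
    have h12 : K * (R * t) ≤ K * (r₀ / δ) * (1 + n * s) := by
      rw [mul_assoc]
      gcongr
    refine (log_one_add_mono (by positivity) h12).trans ?_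
    refine (log_one_add_mul_le (by positivity) (by positivity)).trans ?_
    linarith
  have h13 : ν.real (Iio r₀) * (K * Real.log (1 + K * (R * t)))
      ≤ ε * Real.log (1 + K * (R * t)) := by
    have h14 := log_one_add_nonneg (show 0 ≤ K * (R * t) by positivity)
    calc ν.real (Iio r₀) * (K * Real.log (1 + K * (R * t)))
        ≤ ε / K * (K * Real.log (1 + K * (R * t))) := by gcongr
      _ = _ := by field_simp
  have h15 := mul_le_mul_of_nonneg_left hlogt hε.le
  have h16 := mul_le_mul_of_nonneg_left hlogK hε.le
  rw [hC]
  linarith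

lemma IsLevelWeight.tendsto_levelIntegral_logDensity (hν : IsLevelWeight ν) :
    Tendsto (fun t => (levelIntegral ν logDensity t).toReal / Real.log t) atTop
      (𝓝 (ν.real univ)) := by
  obtain ⟨C, hC⟩ := hν.exists_levelIntegral_le_log isMarcinkiewiczFun_logDensity one_pos
    fun t ht => by rw [integral_logDensity ht, one_mul]
  have hΓ := hν.mass_pos
  set Γ := ν.real univ with hΓdef
  set m := (∫⁻ r, ENNReal.ofReal r ∂ν).toReal with hm
  have hm0 : 0 ≤ m := ENNReal.toReal_nonneg
  refine tendsto_div_log_of_abs_sub_le (C := Γ * Real.log 2 + |C| + m) ?_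
  filter_upwards [eventually_ge_atTop 1] with t ht
  have ht0 : 0 < t := by linarith
  have h1 := hC t ht0
  have h2 := hν.le_toReal_levelIntegral isMarcinkiewiczFun_logDensity ht0.le ht0
  rw [integral_logDensity ht0.le, div_self ht0.ne', one_mul] at h2
  have h3 := mul_le_mul_of_nonneg_left (log_one_add_le_log_two_add ht) hΓ.le
  have h4 := mul_le_mul_of_nonneg_left (log_le_log_one_add ht0) hΓ.le
  have h5 : 0 ≤ Γ * Real.log 2 := mul_nonneg hΓ.le (Real.log_nonneg one_le_two)
  rw [mul_one] at h1
  rw [abs_le]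
  constructor <;> linarith [le_abs_self C, abs_nonneg C]

lemma IsSymmetricFunctional.isGrowthModel_levelIntegral {Λ : (ℝ → ℝ) → ℝ}
    (hΛ : IsSymmetricFunctional Λ) (h0 : 0 < Λ logDensity) (hν : IsLevelWeight ν) :
    IsGrowthModel IsMarcinkiewiczFun (fun x t => (levelIntegral ν x t).toReal) Λ logDensity
      (ν.real univ) := by
  have hΓ := hν.mass_pos
  refine ⟨fun x y hx hy => hx.add hy, fun c hc x hx => hx.smul hc,
    fun x hx t ht => ENNReal.toReal_nonneg, fun x hx s t hs hst =>
      hν.toReal_levelIntegral_mono hx hs hst, fun t ht => ?_, fun x hx => ?_,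
    fun x y hx hy t ht => ?_, fun x y hx hy t ht => ?_,
    -- The scaling Ψ_{cx}(t/c) = cΨ_x(t) is exact; one R must bound both c and 1/c.
    fun c hc x hx => ⟨max c c⁻¹, ?_, fun t ht => ?_⟩,
    hΛ.map_add, fun c hc x hx => hΛ.map_smul c x hc hx, fun x y hx hy H => ?_,
    isMarcinkiewiczFun_logDensity, hν.tendsto_levelIntegral_logDensity, hΓ, h0⟩
  · have : levelIntegral ν 0 t = 0 := by
      refine (lintegral_congr_ae ?_).trans lintegral_zero
      filter_upwards [hν.pos] with r hr
      refine (lintegral_congr fun u => ?_).trans lintegral_zero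
      refine ENNReal.ofReal_of_nonpos ?_
      have : 0 < r / t := by positivity
      simpa using this.le
    rw [this, ENNReal.toReal_zero]
  · obtain ⟨K, hK0, hK⟩ := hx.exists_bound_pos
    obtain ⟨C, hC⟩ := hν.exists_levelIntegral_le_log hx hK0 hK
    refine ⟨ν.real univ * K * 2 + 1, ?_⟩
    filter_upwards [eventually_gt_atTop 0, eventually_log_one_add_le,
      eventually_le_mul_log C one_pos] with t ht h1 h2
    have h3 := mul_le_mul_of_nonneg_left h1 (show 0 ≤ ν.real univ * K by positivity)
    linarith [hC t ht]
  · rw [← ENNReal.toReal_add (hν.levelIntegral_ne_top hx ht) (hν.levelIntegral_ne_top hy ht)]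
    exact ENNReal.toReal_mono (ENNReal.add_ne_top.2
      ⟨hν.levelIntegral_ne_top hx ht, hν.levelIntegral_ne_top hy ht⟩)
      (levelIntegral_add_le x hx.1.measurable t)
  · rw [← ENNReal.toReal_add (hν.levelIntegral_ne_top hx ht) (hν.levelIntegral_ne_top hy ht)]
    exact (ENNReal.toReal_mono (hν.levelIntegral_ne_top (hx.add hy) ht)
      (hν.le_levelIntegral_add hx hy ht)).trans
      (hν.toReal_levelIntegral_mono (hx.add hy) ht (by linarith))
  · rcases le_total 1 c with h | h
    · exact h.trans (le_max_left _ _)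
    · exact (one_le_inv₀ hc).2 h |>.trans (le_max_right _ _)
  · have h1 : (levelIntegral ν (c • x) (t / c)).toReal = c * (levelIntegral ν x t).toReal := by
      rw [levelIntegral_smul ν x hc, ENNReal.toReal_mul, ENNReal.toReal_ofReal hc.le]
    have hmax : 0 < max c c⁻¹ := hc.trans_le (le_max_left _ _)
    rw [← h1]
    refine ⟨hν.toReal_levelIntegral_mono (hx.smul hc.le) (by positivity) ?_,
      hν.toReal_levelIntegral_mono (hx.smul hc.le) (by positivity) ?_⟩
    · gcongr
      exact le_max_left _ _
    · rw [div_eq_inv_mul]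
      gcongr
      exact le_max_right _ _
  · set Γ := ν.real univ with hΓdef
    have hc0 : 0 ≤ Λ logDensity := h0.le
    -- Replacing y by y + ε`logDensity` provides the decay bound needed for the comparison. It costs
    -- ε Λ(`logDensity`), and the error 2ε/Γ in the comparison costs the rest of the constant.
    refine le_of_forall_pos_le_add_mul (c := (1 + 2 / Γ) * Λ logDensity) fun ε hε => ?_
    obtain ⟨R, hR, hev⟩ := H ε hε
    have hρ := isMarcinkiewiczFun_logDensity
    have hy' := hy.add (hρ.smul hε.le)
    have hev' : ∀ᶠ t in atTop, (levelIntegral ν x t).toReal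
        ≤ (levelIntegral ν (y + ε • logDensity) (R * t)).toReal + ε * Real.log t := by
      filter_upwards [hev, eventually_gt_atTop 0] with t ht ht0
      refine ht.trans (add_le_add_left (ENNReal.toReal_mono
        (hν.levelIntegral_ne_top hy' (by positivity)) ?_) _)
      refine lintegral_mono fun r => excess_mono (fun u => ?_) _
      simpa using mul_nonneg hε.le (hρ.2.1 u)
    obtain ⟨n, b, hn, hb, hmain⟩ := hν.exists_integral_le hx hy' hε
      (fun s => by simpa using hy.2.1 s) hε hR hev'
    have h1 := hΛ.mono x _ hx hy' n (2 * ε / Γ) (b / Γ) hn (by positivity) (by positivity)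
      fun s hs => by
        have h2 := hmain s hs
        rw [← mul_le_mul_iff_right₀ hΓ]
        refine h2.trans (le_of_eq ?_)
        field_simp
        rw [← hΓdef]
        ring
    rw [hΛ.map_add y _ hy (hρ.smul hε.le), hΛ.map_smul ε _ hε.le hρ] at h1
    refine h1.trans (le_of_eq ?_)
    field_simp
    ring

end LevelIntegral

section HeatWeight

/-! ### The heat kernel function as a level integral -/

variable {q : ℝ}

lemma heatFun_of_pos {u : ℝ} (hu : 0 < u) : heatFun q u = Real.exp (-(u ^ (-q))) := if_pos hu

lemma heatFun_of_nonpos {u : ℝ} (hu : u ≤ 0) : heatFun q u = 0 := if_neg (not_lt.2 hu)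

lemma heatFun_nonneg (q u : ℝ) : 0 ≤ heatFun q u := by
  rcases le_or_gt u 0 with h | h
  · rw [heatFun_of_nonpos h]
  · rw [heatFun_of_pos h]
    positivity

lemma heatFun_mono (hq : 0 < q) : Monotone (heatFun q) := fun u v h => by
  rcases le_or_gt u 0 with hu | hu
  · rw [heatFun_of_nonpos hu]
    exact heatFun_nonneg q v
  · rw [heatFun_of_pos hu, heatFun_of_pos (hu.trans_le h)]
    refine Real.exp_le_exp.2 (neg_le_neg ?_)
    exact Real.rpow_le_rpow_of_nonpos hu h (by linarith)

lemma exp_neg_le_factorial_div (n : ℕ) {w : ℝ} (hw : 0 < w) :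
    Real.exp (-w) ≤ n.factorial / w ^ n := by
  have := Real.pow_div_factorial_le_exp w hw.le n
  rw [Real.exp_neg, ← inv_div]
  exact inv_anti₀ (by positivity) this

lemma heatFun_le_rpow {u : ℝ} (hu : 0 < u) : heatFun q u ≤ u ^ q := by
  rw [heatFun_of_pos hu]
  refine (exp_neg_le_factorial_div 1 (by positivity)).trans (le_of_eq ?_)
  rw [pow_one, Real.rpow_neg hu.le, Nat.factorial_one, Nat.cast_one, one_div, inv_inv]

/-- The derivative of `heatFun q` on `(0, ∞)`. -/
def heatDeriv (q r : ℝ) : ℝ := q * r ^ (-q - 1) * Real.exp (-(r ^ (-q)))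

lemma hasDerivAt_heatFun {u : ℝ} (hu : 0 < u) : HasDerivAt (heatFun q) (heatDeriv q u) u := by
  have h1 : HasDerivAt (fun v : ℝ => Real.exp (-(v ^ (-q)))) (heatDeriv q u) u := by
    have h := ((Real.hasDerivAt_rpow_const (p := -q) (Or.inl hu.ne')).neg).exp
    have he : heatDeriv q u = Real.exp (-(u ^ (-q))) * -(-q * u ^ (-q - 1)) := by
      rw [heatDeriv]
      ring
    rw [he]
    exact h
  refine h1.congr_of_eventuallyEq ?_
  filter_upwards [lt_mem_nhds hu] with v hv using heatFun_of_pos hv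

lemma heatDeriv_nonneg (hq : 0 < q) {r : ℝ} (hr : 0 < r) : 0 ≤ heatDeriv q r := by
  unfold heatDeriv
  positivity

lemma continuous_heatFun (hq : 0 < q) : Continuous (heatFun q) := by
  refine continuous_iff_continuousAt.2 fun u => ?_
  rcases lt_trichotomy u 0 with h | rfl | h
  · refine (continuousAt_const (y := (0 : ℝ))).congr ?_
    filter_upwards [gt_mem_nhds h] with v hv using (heatFun_of_nonpos (le_of_lt hv)).symm
  · have hlim : Tendsto (fun v : ℝ => (max v 0) ^ q) (𝓝 0) (𝓝 0) := by
      have h1 : ContinuousAt (fun v : ℝ => (max v 0) ^ q) 0 :=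
        ContinuousAt.rpow_const (by fun_prop) (Or.inr hq.le)
      simpa [ContinuousAt, Real.zero_rpow hq.ne'] using h1
    rw [ContinuousAt, heatFun_of_nonpos le_rfl]
    refine squeeze_zero (heatFun_nonneg q) (fun v => ?_) hlim
    rcases le_or_gt v 0 with hv | hv
    · rw [heatFun_of_nonpos hv]
      positivity
    · rw [max_eq_left hv.le]
      exact heatFun_le_rpow hv
  · exact (hasDerivAt_heatFun h).continuousAt

lemma measurable_heatDeriv (q : ℝ) : Measurable (heatDeriv q) := by
  unfold heatDeriv
  fun_prop

lemma lintegral_heatDeriv (hq : 0 < q) {u : ℝ} (hu : 0 < u) :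
    ∫⁻ r in Ioo 0 u, ENNReal.ofReal (heatDeriv q r) = ENNReal.ofReal (heatFun q u) := by
  have hcont : ContinuousOn (heatFun q) (Icc 0 u) := (continuous_heatFun hq).continuousOn
  have hInt : IntervalIntegrable (heatDeriv q) volume 0 u := by
    refine intervalIntegral.intervalIntegrable_deriv_of_nonneg
      (continuous_heatFun hq).continuousOn (fun r hr => ?_) fun r hr => ?_
    · rw [min_eq_left hu.le] at hr
      exact hasDerivAt_heatFun hr.1
    · rw [min_eq_left hu.le] at hr
      exact heatDeriv_nonneg hq hr.1
  have h := intervalIntegral.integral_eq_sub_of_hasDerivAt_of_le hu.le hcont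
    (fun r hr => hasDerivAt_heatFun hr.1) hInt
  rw [heatFun_of_nonpos le_rfl, sub_zero, intervalIntegral.integral_of_le hu.le] at h
  rw [← h, ofReal_integral_eq_lintegral_ofReal
    ((intervalIntegrable_iff_integrableOn_Ioc_of_le hu.le).1 hInt),
    restrict_Ioo_eq_restrict_Ioc]
  filter_upwards [ae_restrict_mem measurableSet_Ioc] with r hr using heatDeriv_nonneg hq hr.1

/-- The measure `(heatFun q)'(r) / r dr` on `(0, ∞)`. -/
def heatWeight (q : ℝ) : Measure ℝ :=
  halfLine.withDensity fun r => ENNReal.ofReal (heatDeriv q r / r)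

lemma ae_pos_heatWeight (q : ℝ) : ∀ᵐ r ∂heatWeight q, 0 < r :=
  (withDensity_absolutelyContinuous _ _).ae_le (ae_restrict_mem measurableSet_Ioi)

lemma lintegral_heatWeight (q : ℝ) {g : ℝ → ℝ≥0∞} (hg : Measurable g) :
    ∫⁻ r, g r ∂heatWeight q
      = ∫⁻ r in Ioi 0, ENNReal.ofReal (heatDeriv q r / r) * g r :=
  lintegral_withDensity_eq_lintegral_mul _
    (((measurable_heatDeriv q).div measurable_id).ennreal_ofReal) hg

/-- The factor r cancels the division by r in the weight, leaving the integral of f' over (0, u).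
This writes f as a superposition of step functions. -/
lemma lintegral_indicator_heatWeight (hq : 0 < q) (u : ℝ) :
    ∫⁻ r, (if r < u then ENNReal.ofReal r else 0) ∂heatWeight q
      = ENNReal.ofReal (heatFun q u) := by
  rw [lintegral_heatWeight q (Measurable.ite measurableSet_Iio (by fun_prop) (by fun_prop))]
  have h1 : ∫⁻ r in Ioi 0, ENNReal.ofReal (heatDeriv q r / r)
        * (if r < u then ENNReal.ofReal r else 0)
      = ∫⁻ r in Ioi 0, (Iio u).indicator (fun r => ENNReal.ofReal (heatDeriv q r)) r := by
    refine setLIntegral_congr_fun measurableSet_Ioi fun r hr => ?_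
    have hr0 : 0 < r := hr
    by_cases h : r < u
    · rw [if_pos h, indicator_of_mem (show r ∈ Iio u from h),
        ← ENNReal.ofReal_mul (div_nonneg (heatDeriv_nonneg hq hr0) hr0.le),
        div_mul_cancel₀ _ hr0.ne']
    · rw [if_neg h, indicator_of_notMem (show r ∉ Iio u from h), mul_zero]
  rw [h1, lintegral_indicator measurableSet_Iio, Measure.restrict_restrict measurableSet_Iio,
    Iio_inter_Ioi]
  rcases le_or_gt u 0 with hu | hu
  · rw [Ioo_eq_empty (not_lt.2 hu), heatFun_of_nonpos hu]
    simp
  · exact lintegral_heatDeriv hq hu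

/-- The function r + 1/r dominates 1, r and 1/r, so one integrable bound settles the mass and both
moments. Near 0 the factor exp(-r^{-q}) beats every power of 1/r; at infinity r^{-q-1} is
integrable. -/
lemma exists_heatDeriv_le (hq : 0 < q) :
    ∃ C : ℝ, ∀ r : ℝ, 0 < r → heatDeriv q r / r * (r + r⁻¹)
      ≤ (Ioc 0 1).indicator (fun _ => C) r
        + (Ioi 1).indicator (fun r => 2 * q * r ^ (-q - 1)) r := by
  -- Then qn ≥ q + 3, so r^{qn} compensates the singularity r^{-q-3} on (0, 1].
  obtain ⟨n, hn⟩ := exists_nat_ge ((q + 3) / q)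
  rw [div_le_iff₀ hq] at hn
  refine ⟨2 * q * n.factorial, fun r hr => ?_⟩
  rcases le_or_gt r 1 with h | h
  · rw [indicator_of_mem (show r ∈ Ioc 0 1 from ⟨hr, h⟩),
      indicator_of_notMem (show r ∉ Ioi 1 from not_lt.2 h), add_zero]
    have h1 : r + r⁻¹ ≤ 2 * r⁻¹ := by
      have := (one_le_inv₀ hr).2 h
      linarith
    have h2 := exp_neg_le_factorial_div n (show 0 < r ^ (-q) by positivity)
    have h3 : r ^ (-q - 1) * r⁻¹ * r⁻¹ * (1 / (r ^ (-q)) ^ n) ≤ 1 := by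
      have e1 : (r ^ (-q)) ^ n = r ^ (-q * n) := (Real.rpow_mul_natCast hr.le (-q) n).symm
      rw [e1, one_div, ← Real.rpow_neg hr.le, ← Real.rpow_neg_one r, ← Real.rpow_add hr,
        ← Real.rpow_add hr, ← Real.rpow_add hr]
      refine Real.rpow_le_one hr.le h ?_
      linarith
    calc heatDeriv q r / r * (r + r⁻¹) ≤ heatDeriv q r / r * (2 * r⁻¹) := by
          have := heatDeriv_nonneg hq hr
          gcongr
      _ = 2 * q * (r ^ (-q - 1) * r⁻¹ * r⁻¹) * Real.exp (-(r ^ (-q))) := by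
          rw [heatDeriv]
          ring
      _ ≤ 2 * q * (r ^ (-q - 1) * r⁻¹ * r⁻¹) * (n.factorial / (r ^ (-q)) ^ n) := by gcongr
      _ = 2 * q * n.factorial * (r ^ (-q - 1) * r⁻¹ * r⁻¹ * (1 / (r ^ (-q)) ^ n)) := by ring
      _ ≤ 2 * q * n.factorial * 1 := by gcongr
      _ = _ := mul_one _
  · rw [indicator_of_notMem (show r ∉ Ioc 0 1 from fun h' => not_le.2 h h'.2),
      indicator_of_mem (show r ∈ Ioi 1 from h), zero_add]
    have h1 : r + r⁻¹ ≤ 2 * r := by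
      have := inv_le_one_of_one_le₀ h.le
      linarith
    have h2 : Real.exp (-(r ^ (-q))) ≤ 1 := by
      rw [Real.exp_le_one_iff]
      have : 0 ≤ r ^ (-q) := by positivity
      linarith
    calc heatDeriv q r / r * (r + r⁻¹) ≤ heatDeriv q r / r * (2 * r) := by
          have := heatDeriv_nonneg hq hr
          gcongr
      _ = 2 * q * r ^ (-q - 1) * Real.exp (-(r ^ (-q))) := by
          rw [heatDeriv]
          field_simp
      _ ≤ 2 * q * r ^ (-q - 1) * 1 := by gcongr
      _ = _ := mul_one _

lemma lintegral_add_inv_heatWeight_ne_top (hq : 0 < q) :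
    ∫⁻ r, ENNReal.ofReal (r + r⁻¹) ∂heatWeight q ≠ ∞ := by
  obtain ⟨C, hC⟩ := exists_heatDeriv_le hq
  rw [lintegral_heatWeight q (by fun_prop)]
  have hInt : Integrable (fun r => (Ioc 0 1).indicator (fun _ => C) r
      + (Ioi 1).indicator (fun r => 2 * q * r ^ (-q - 1)) r) volume := by
    refine Integrable.add ?_ ?_
    · exact (integrable_indicator_iff measurableSet_Ioc).2 (integrableOn_const (by simp))
    · rw [integrable_indicator_iff measurableSet_Ioi]
      exact (integrableOn_Ioi_rpow_of_lt (by linarith) one_pos).const_mul _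
  refine ne_top_of_le_ne_top hInt.lintegral_lt_top.ne ?_
  refine le_trans ?_ (setLIntegral_le_lintegral (Ioi 0) _)
  refine setLIntegral_mono_ae' measurableSet_Ioi (ae_of_all _ fun r hr => ?_)
  have hr0 : 0 < r := hr
  rw [← ENNReal.ofReal_mul (div_nonneg (heatDeriv_nonneg hq hr0) hr0.le)]
  exact ENNReal.ofReal_le_ofReal (hC r hr0)

lemma isLevelWeight_heatWeight (hq : 0 < q) : IsLevelWeight (heatWeight q) := by
  have htop := lintegral_add_inv_heatWeight_ne_top hq
  refine ⟨ae_pos_heatWeight q, fun h0 => ?_, ?_, ?_, ?_⟩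
  · have h1 := lintegral_indicator_heatWeight hq 1
    rw [Measure.measure_univ_eq_zero.1 h0, lintegral_zero_measure, eq_comm,
      ENNReal.ofReal_eq_zero, heatFun_of_pos one_pos] at h1
    exact absurd h1 (not_le.2 (Real.exp_pos _))
  · refine ne_top_of_le_ne_top htop ?_
    rw [← lintegral_one]
    refine lintegral_mono_ae ?_
    filter_upwards [ae_pos_heatWeight q] with r hr
    rw [← ENNReal.ofReal_one]
    refine ENNReal.ofReal_le_ofReal ?_
    rcases le_total 1 r with h | h
    · have : 0 < r⁻¹ := by positivity
      linarith
    · have := (one_le_inv₀ hr).2 h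
      linarith
  · refine ne_top_of_le_ne_top htop (lintegral_mono_ae ?_)
    filter_upwards [ae_pos_heatWeight q] with r hr
    refine ENNReal.ofReal_le_ofReal ?_
    have : 0 < r⁻¹ := by positivity
    linarith
  · refine ne_top_of_le_ne_top htop (lintegral_mono_ae ?_)
    filter_upwards [ae_pos_heatWeight q] with r hr
    exact ENNReal.ofReal_le_ofReal (by linarith)

/-- The trace of the heat operator in terms of the singular value function `x`. -/
def heatCount (q : ℝ) (x : ℝ → ℝ) (s : ℝ) : ℝ≥0∞ :=
  ∫⁻ u in Ioi (0 : ℝ), ENNReal.ofReal (heatFun q (s * x u))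

lemma heatCount_mono (hq : 0 < q) {x : ℝ → ℝ} (hx0 : ∀ u, 0 ≤ x u) : Monotone (heatCount q x) :=
  fun _ _ h => lintegral_mono fun u => ENNReal.ofReal_le_ofReal
    (heatFun_mono hq (mul_le_mul_of_nonneg_right h (hx0 u)))

/-- The integral of r/s² from r/x to t is x - r/t, the height of x above the level r/t. -/
lemma lintegral_inv_sq_indicator {r t x : ℝ} (hr : 0 < r) (ht : 0 < t) (hx : 0 ≤ x) :
    ∫⁻ s in Ioc 0 t, ENNReal.ofReal (s ^ 2)⁻¹ * (if r < s * x then ENNReal.ofReal r else 0)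
      = ENNReal.ofReal (x - r / t) := by
  rcases le_or_gt (t * x) r with h | h
  · have h0 : x ≤ r / t := by
      rw [le_div_iff₀ ht]
      linarith
    rw [ENNReal.ofReal_of_nonpos (sub_nonpos.2 h0),
      setLIntegral_congr_fun measurableSet_Ioc (g := fun _ => 0) fun s hs => ?_, lintegral_zero]
    rw [if_neg, mul_zero]
    have : s * x ≤ t * x := mul_le_mul_of_nonneg_right hs.2 hx
    linarith
  have hx0 : 0 < x := by
    rcases hx.lt_or_eq with h' | h'
    · exact h'
    · rw [← h', mul_zero] at h
      linarith
  have ha : 0 < r / x := by positivity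
  have hat : r / x ≤ t := by
    rw [div_le_iff₀ hx0]
    exact h.le
  have h1 : ∫⁻ s in Ioc 0 t, ENNReal.ofReal (s ^ 2)⁻¹ * (if r < s * x then ENNReal.ofReal r else 0)
      = ∫⁻ s in Ioc (r / x) t, ENNReal.ofReal (r * (s ^ 2)⁻¹) := by
    rw [show Ioc (r / x) t = Ioi (r / x) ∩ Ioc 0 t by
      ext s
      simp only [mem_Ioc, mem_inter_iff, mem_Ioi]
      constructor
      · exact fun hs => ⟨hs.1, ha.trans hs.1, hs.2⟩
      · exact fun hs => ⟨hs.1, hs.2.2⟩,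
      ← Measure.restrict_restrict measurableSet_Ioi, ← lintegral_indicator measurableSet_Ioi]
    refine lintegral_congr fun s => ?_
    by_cases hs : r / x < s
    · rw [indicator_of_mem (show s ∈ Ioi (r / x) from hs), if_pos (by rwa [div_lt_iff₀ hx0] at hs),
        ← ENNReal.ofReal_mul (by positivity), mul_comm]
    · rw [indicator_of_notMem (show s ∉ Ioi (r / x) from hs),
        if_neg (by rwa [div_lt_iff₀ hx0] at hs), mul_zero]
  have hderiv : ∀ s ∈ uIcc (r / x) t, HasDerivAt (fun s : ℝ => -(r * s⁻¹)) (r * (s ^ 2)⁻¹) s :=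
    fun s hs => by
      rw [uIcc_of_le hat] at hs
      have hs0 : s ≠ 0 := (ha.trans_le hs.1).ne'
      have h := ((hasDerivAt_inv hs0).const_mul r).neg
      rw [mul_neg, neg_neg] at h
      exact h
  have hInt : IntervalIntegrable (fun s : ℝ => r * (s ^ 2)⁻¹) volume (r / x) t := by
    refine ContinuousOn.intervalIntegrable fun s hs => ?_
    rw [uIcc_of_le hat] at hs
    have hs0 : s ^ 2 ≠ 0 := pow_ne_zero 2 (ha.trans_le hs.1).ne'
    fun_prop (disch := assumption)
  have h2 := intervalIntegral.integral_eq_sub_of_hasDerivAt hderiv hInt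
  rw [intervalIntegral.integral_of_le hat] at h2
  rw [h1, ← ofReal_integral_eq_lintegral_ofReal
    ((intervalIntegrable_iff_integrableOn_Ioc_of_le hat).1 hInt)
    (ae_of_all _ fun s => by positivity), h2]
  congr 1
  field_simp
  ring

/-- The identity behind the theorem: with f written as a superposition of step functions, Tonelli's
theorem allows s to be integrated first, which turns each step into an excess over the level r/t. -/
lemma lintegral_heatCount (hq : 0 < q) {x : ℝ → ℝ} (hx : Measurable x) (hx0 : ∀ u, 0 ≤ x u)
    {t : ℝ} (ht : 0 < t) :
    ∫⁻ s in Ioc 0 t, ENNReal.ofReal (s ^ 2)⁻¹ * heatCount q x s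
      = levelIntegral (heatWeight q) x t := by
  have hν := isLevelWeight_heatWeight hq
  have : IsFiniteMeasure (heatWeight q) := ⟨hν.mass_ne_top.lt_top⟩
  have hc := (continuous_heatFun hq).measurable
  calc ∫⁻ s in Ioc 0 t, ENNReal.ofReal (s ^ 2)⁻¹ * heatCount q x s
      = ∫⁻ s in Ioc 0 t, ∫⁻ u in Ioi (0 : ℝ),
          ENNReal.ofReal (s ^ 2)⁻¹ * ENNReal.ofReal (heatFun q (s * x u)) := by
        refine lintegral_congr fun s => ?_
        rw [lintegral_const_mul' _ _ ENNReal.ofReal_ne_top, heatCount]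
    _ = ∫⁻ u in Ioi (0 : ℝ), ∫⁻ s in Ioc 0 t,
          ENNReal.ofReal (s ^ 2)⁻¹ * ENNReal.ofReal (heatFun q (s * x u)) :=
        lintegral_lintegral_swap (by
          refine Measurable.aemeasurable ?_
          unfold Function.uncurry
          fun_prop)
    _ = ∫⁻ u in Ioi (0 : ℝ), ∫⁻ s in Ioc 0 t, ∫⁻ r, ENNReal.ofReal (s ^ 2)⁻¹
          * (if r < s * x u then ENNReal.ofReal r else 0) ∂heatWeight q := by
        refine lintegral_congr fun u => lintegral_congr fun s => ?_
        rw [lintegral_const_mul' _ _ ENNReal.ofReal_ne_top, lintegral_indicator_heatWeight hq]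
    _ = ∫⁻ u in Ioi (0 : ℝ), ∫⁻ r, ∫⁻ s in Ioc 0 t, ENNReal.ofReal (s ^ 2)⁻¹
          * (if r < s * x u then ENNReal.ofReal r else 0) ∂volume ∂heatWeight q := by
        refine lintegral_congr fun u => lintegral_lintegral_swap ?_
        refine Measurable.aemeasurable ?_
        unfold Function.uncurry
        refine Measurable.mul (by fun_prop) (Measurable.ite ?_ (by fun_prop) (by fun_prop))
        exact measurableSet_lt (by fun_prop) (by fun_prop)
    _ = ∫⁻ u in Ioi (0 : ℝ), ∫⁻ r, ENNReal.ofReal (x u - r / t) ∂heatWeight q := by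
        refine lintegral_congr fun u => lintegral_congr_ae ?_
        filter_upwards [hν.pos] with r hr
        exact lintegral_inv_sq_indicator hr ht (hx0 u)
    _ = levelIntegral (heatWeight q) x t :=
        lintegral_lintegral_swap (by
          refine Measurable.aemeasurable ?_
          unfold Function.uncurry
          fun_prop)

end HeatWeight

section HeatTrace

variable {N : VonNeumannAlgebra H} {τ : (H →L[ℂ] H) → ℝ≥0∞} {q : ℝ}

/-! ### Cesaro means of the heat kernel function -/

lemma measurable_heatCount (hq : 0 < q) {x : ℝ → ℝ} (hx0 : ∀ u, 0 ≤ x u) :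
    Measurable (heatCount q x) := (heatCount_mono hq hx0).measurable

/-- By monotonicity an infinite value at s would persist on (s, 2s] and make the level integral at
2s infinite. -/
lemma IsMarcinkiewiczFun.heatCount_ne_top {x : ℝ → ℝ} (hx : IsMarcinkiewiczFun x) (hq : 0 < q)
    {s : ℝ} (hs : 0 < s) : heatCount q x s ≠ ∞ := fun htop => by
  have h1 := lintegral_heatCount hq hx.1.measurable hx.2.1 (show 0 < 2 * s by positivity)
  have h2 : ∫⁻ r in Ioc s (2 * s), ENNReal.ofReal (r ^ 2)⁻¹ * heatCount q x r = ∞ := by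
    rw [setLIntegral_congr_fun measurableSet_Ioc (g := fun _ => ∞) fun r hr => ?_,
      setLIntegral_const, ENNReal.top_mul]
    · simp [hs]
    · have hr0 : 0 < r := hs.trans hr.1
      have : heatCount q x r = ∞ := top_le_iff.1 (htop ▸ heatCount_mono hq hx.2.1 hr.1.le)
      rw [this, ENNReal.mul_top]
      exact (ENNReal.ofReal_pos.2 (by positivity)).ne'
  refine (isLevelWeight_heatWeight hq).levelIntegral_ne_top hx (show 0 < 2 * s by positivity) ?_
  rw [← h1, ← top_le_iff, ← h2]
  exact lintegral_mono_set (Ioc_subset_Ioc_left hs.le)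

lemma IsMarcinkiewiczFun.ofReal_heatCount {x : ℝ → ℝ} (hx : IsMarcinkiewiczFun x) (hq : 0 < q)
    {s : ℝ} (hs : 0 < s) :
    ENNReal.ofReal (1 / s * (heatCount q x s).toReal / s)
      = ENNReal.ofReal (s ^ 2)⁻¹ * heatCount q x s := by
  rw [show 1 / s * (heatCount q x s).toReal / s = (s ^ 2)⁻¹ * (heatCount q x s).toReal by
    field_simp, ENNReal.ofReal_mul (by positivity),
    ENNReal.ofReal_toReal (hx.heatCount_ne_top hq hs)]

lemma IsMarcinkiewiczFun.lintegral_ofReal_heatCount {x : ℝ → ℝ} (hx : IsMarcinkiewiczFun x)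
    (hq : 0 < q) {t : ℝ} (ht : 0 < t) :
    ∫⁻ s in Ioc 0 t, ENNReal.ofReal (1 / s * (heatCount q x s).toReal / s)
      = levelIntegral (heatWeight q) x t := by
  rw [← lintegral_heatCount hq hx.1.measurable hx.2.1 ht]
  exact setLIntegral_congr_fun measurableSet_Ioc fun s hs => hx.ofReal_heatCount hq hs.1

lemma heatCount_density_nonneg (q : ℝ) (x : ℝ → ℝ) (s : ℝ) :
    0 ≤ 1 / s * (heatCount q x s).toReal / s := by
  rw [show 1 / s * (heatCount q x s).toReal / s = (heatCount q x s).toReal / (s * s) by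
    rw [one_div, div_eq_mul_inv, div_eq_mul_inv, mul_inv]
    ring]
  exact div_nonneg ENNReal.toReal_nonneg (mul_self_nonneg s)

lemma IsMarcinkiewiczFun.intervalIntegrable_heatCount {x : ℝ → ℝ} (hx : IsMarcinkiewiczFun x)
    (hq : 0 < q) {t : ℝ} (ht : 0 < t) :
    IntervalIntegrable (fun s => 1 / s * (heatCount q x s).toReal / s) volume 0 t := by
  have hm := measurable_heatCount hq hx.2.1
  rw [intervalIntegrable_iff_integrableOn_Ioc_of_le ht.le]
  refine ⟨Measurable.aestronglyMeasurable (by fun_prop), ?_⟩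
  rw [hasFiniteIntegral_iff_ofReal (ae_of_all _ (heatCount_density_nonneg q x)),
    hx.lintegral_ofReal_heatCount hq ht]
  exact ((isLevelWeight_heatWeight hq).levelIntegral_ne_top hx ht).lt_top

lemma IsMarcinkiewiczFun.integral_heatCount {x : ℝ → ℝ} (hx : IsMarcinkiewiczFun x)
    (hq : 0 < q) {t : ℝ} (ht : 0 < t) :
    ∫ s in (0 : ℝ)..t, 1 / s * (heatCount q x s).toReal / s
      = (levelIntegral (heatWeight q) x t).toReal := by
  have hm := measurable_heatCount hq hx.2.1
  rw [intervalIntegral.integral_of_le ht.le,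
    integral_eq_lintegral_of_nonneg_ae (ae_of_all _ (heatCount_density_nonneg q x))
      (Measurable.aestronglyMeasurable (by fun_prop)), hx.lintegral_ofReal_heatCount hq ht]

lemma IsMarcinkiewiczFun.cesaro_heatCount {x : ℝ → ℝ} (hx : IsMarcinkiewiczFun x)
    (hq : 0 < q) {t : ℝ} (ht : 0 < t) :
    cesaro (fun s => 1 / s * (heatCount q x s).toReal) t
      = 1 / Real.log t * ((levelIntegral (heatWeight q) x t).toReal
        - (levelIntegral (heatWeight q) x 1).toReal) := by
  rw [cesaro, ← hx.integral_heatCount hq ht, ← hx.integral_heatCount hq one_pos,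
    intervalIntegral.integral_interval_sub_left (hx.intervalIntegrable_heatCount hq ht)
      (hx.intervalIntegrable_heatCount hq one_pos)]

lemma abs_sub_one_le_two_mul_abs_log {t : ℝ} (h1 : 1 / 2 ≤ t) (h2 : t ≤ 2) :
    |t - 1| ≤ 2 * |Real.log t| := by
  have ht : 0 < t := by linarith
  rcases le_total 1 t with h | h
  · rw [abs_of_nonneg (by linarith), abs_of_nonneg (Real.log_nonneg h)]
    have h3 := Real.one_sub_inv_le_log_of_pos ht
    have h4 : (t - 1) / 2 ≤ 1 - t⁻¹ := by
      rw [← sub_nonneg, show 1 - t⁻¹ - (t - 1) / 2 = (t - 1) * (2 - t) / (2 * t) by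
        field_simp]
      have := mul_nonneg (sub_nonneg.2 h) (sub_nonneg.2 h2)
      positivity
    linarith
  · rw [abs_of_nonpos (by linarith), abs_of_nonpos (Real.log_nonpos ht.le h)]
    have h3 := Real.log_le_sub_one_of_pos ht
    linarith

/-- A Lipschitz bound near t = 1, where the denominator log t of the Cesaro mean vanishes to first
order. -/
lemma IsMarcinkiewiczFun.abs_levelIntegral_sub_le {x : ℝ → ℝ} (hx : IsMarcinkiewiczFun x)
    (hq : 0 < q) {t : ℝ} (h1 : 1 / 2 ≤ t) (h2 : t ≤ 2) :
    |(levelIntegral (heatWeight q) x t).toReal - (levelIntegral (heatWeight q) x 1).toReal|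
      ≤ 4 * (heatCount q x 2).toReal * |t - 1| := by
  have ht : 0 < t := by linarith
  rw [← hx.integral_heatCount hq ht, ← hx.integral_heatCount hq one_pos,
    intervalIntegral.integral_interval_sub_left (hx.intervalIntegrable_heatCount hq ht)
      (hx.intervalIntegrable_heatCount hq one_pos), ← Real.norm_eq_abs]
  refine intervalIntegral.norm_integral_le_of_norm_le_const fun s hs => ?_
  have hs' : 1 / 2 ≤ s ∧ s ≤ 2 := by
    rcases mem_uIoc.1 hs with h | h
    · exact ⟨by linarith [h.1], by linarith [h.2]⟩
    · exact ⟨by linarith [h.1], by linarith [h.2]⟩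
  have hs0 : 0 < s := by linarith [hs'.1]
  rw [Real.norm_of_nonneg (heatCount_density_nonneg q x s)]
  have h3 : (heatCount q x s).toReal ≤ (heatCount q x 2).toReal :=
    ENNReal.toReal_mono (hx.heatCount_ne_top hq two_pos) (heatCount_mono hq hx.2.1 hs'.2)
  have h4 : 1 / s ≤ 2 := by
    rw [div_le_iff₀ hs0]
    linarith [hs'.1]
  calc 1 / s * (heatCount q x s).toReal / s
      = (1 / s) * (1 / s) * (heatCount q x s).toReal := by ring
    _ ≤ 2 * 2 * (heatCount q x 2).toReal := by gcongr
    _ = _ := by ring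

lemma IsMarcinkiewiczFun.exists_abs_cesaro_le {x : ℝ → ℝ} (hx : IsMarcinkiewiczFun x)
    (hq : 0 < q) : ∃ C : ℝ, ∀ t : ℝ, 0 < t →
      |cesaro (fun s => 1 / s * (heatCount q x s).toReal) t| ≤ C := by
  have hν := isLevelWeight_heatWeight hq
  obtain ⟨K, hK0, hK⟩ := hx.exists_bound_pos
  obtain ⟨C, hC⟩ := hν.exists_levelIntegral_le_log hx hK0 hK
  have hΓ := hν.mass_pos
  set Γ := (heatWeight q).real univ
  set Ψ : ℝ → ℝ := fun t => (levelIntegral (heatWeight q) x t).toReal with hΨ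
  have hΨ0 : ∀ t, 0 ≤ Ψ t := fun t => ENNReal.toReal_nonneg
  have hΨm : ∀ s t, 0 < s → s ≤ t → Ψ s ≤ Ψ t := fun s t hs h =>
    hν.toReal_levelIntegral_mono hx hs h
  have hl2 : 0 < Real.log 2 := Real.log_pos one_lt_two
  set n₂ := (heatCount q x 2).toReal with hn₂
  have hn₂0 : 0 ≤ n₂ := ENNReal.toReal_nonneg
  have hΨ1 := hΨ0 1
  refine ⟨(2 * (Γ * K) + |C| / Real.log 2) + 8 * n₂ + Ψ 1 / Real.log 2, fun t ht => ?_⟩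
  have p1 : 0 ≤ 2 * (Γ * K) + |C| / Real.log 2 := by positivity
  have p2 : 0 ≤ 8 * n₂ := by positivity
  have p3 : 0 ≤ Ψ 1 / Real.log 2 := by positivity
  rw [hx.cesaro_heatCount hq ht, abs_mul, abs_div, abs_one, one_div_mul_eq_div]
  change |Ψ t - Ψ 1| / |Real.log t| ≤ _
  -- For t ≥ 2 the logarithmic growth of Ψ decides, on [1/2, 2] the Lipschitz bound (division by log
  -- 1 = 0 gives 0), and below 1/2 the monotonicity of Ψ together with |log t| ≥ log 2.
  rcases le_or_gt 2 t with h2 | h2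
  · have hlt : Real.log 2 ≤ Real.log t := Real.log_le_log two_pos h2
    have hlt0 : 0 < Real.log t := by linarith
    have h3 : |Ψ t - Ψ 1| ≤ Ψ t := by
      rw [abs_of_nonneg (sub_nonneg.2 (hΨm 1 t one_pos (by linarith)))]
      linarith
    have h4 := log_one_add_le_log_two_add (show 1 ≤ t by linarith)
    have h5 : Γ * K * Real.log (1 + t) ≤ Γ * K * (2 * Real.log t) := by
      gcongr
      linarith
    have h6 : C ≤ |C| / Real.log 2 * Real.log t := by
      calc C ≤ |C| := le_abs_self C
        _ = |C| / Real.log 2 * Real.log 2 := by field_simp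
        _ ≤ _ := by gcongr
    have h7 : |Ψ t - Ψ 1| / |Real.log t| ≤ 2 * (Γ * K) + |C| / Real.log 2 := by
      rw [abs_of_pos hlt0, div_le_iff₀ hlt0]
      linarith [hC t ht]
    linarith
  rcases le_or_gt (1 / 2) t with h1 | h1
  · have h3 : |Ψ t - Ψ 1| / |Real.log t| ≤ 8 * n₂ := by
      refine div_le_of_le_mul₀ (abs_nonneg _) p2 ?_
      refine (hx.abs_levelIntegral_sub_le hq h1 h2.le).trans ?_
      have := mul_le_mul_of_nonneg_left (abs_sub_one_le_two_mul_abs_log h1 h2.le)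
        (show 0 ≤ 4 * n₂ by positivity)
      linarith
    linarith
  · have h3 : |Ψ t - Ψ 1| ≤ Ψ 1 := by
      rw [abs_of_nonpos (sub_nonpos.2 (hΨm t 1 ht (by linarith)))]
      linarith [hΨ0 t]
    have h4 : Real.log 2 ≤ |Real.log t| := by
      have h5 := Real.log_le_log ht h1.le
      rw [one_div, Real.log_inv] at h5
      rw [abs_of_nonpos (by linarith)]
      linarith
    have h6 : |Ψ t - Ψ 1| / |Real.log t| ≤ Ψ 1 / Real.log 2 := div_le_div₀ hΨ1 h3 hl2 h4
    linarith

lemma IsMarcinkiewiczFun.memLp_cesaro {x : ℝ → ℝ} (hx : IsMarcinkiewiczFun x) (hq : 0 < q) :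
    MemLp (cesaro fun s => 1 / s * (heatCount q x s).toReal) ∞ halfLine := by
  obtain ⟨C, hC⟩ := hx.exists_abs_cesaro_le hq
  have hν := isLevelWeight_heatWeight hq
  refine memLp_top_of_bound ?_ C ?_
  · have h1 : MonotoneOn (fun t => (levelIntegral (heatWeight q) x t).toReal) (Ioi 0) :=
      fun s hs t _ h => hν.toReal_levelIntegral_mono hx hs h
    have h2 := aemeasurable_restrict_of_monotoneOn (μ := volume) measurableSet_Ioi h1
    have h3 : AEMeasurable (fun t => 1 / Real.log t
        * ((levelIntegral (heatWeight q) x t).toReal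
        - (levelIntegral (heatWeight q) x 1).toReal)) halfLine :=
      (Real.measurable_log.const_div 1).aemeasurable.mul (h2.sub_const _)
    refine (h3.congr ?_).aestronglyMeasurable
    filter_upwards [ae_restrict_mem measurableSet_Ioi] with t ht
    exact (hx.cesaro_heatCount hq ht).symm
  · filter_upwards [ae_restrict_mem measurableSet_Ioi] with t ht using hC t ht

lemma IsMarcinkiewiczFun.tendsto_cesaro_sub {x : ℝ → ℝ} (hx : IsMarcinkiewiczFun x)
    (hq : 0 < q) :
    Tendsto (fun t => cesaro (fun s => 1 / s * (heatCount q x s).toReal) t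
      - (levelIntegral (heatWeight q) x t).toReal / Real.log t) atTop (𝓝 0) := by
  have h1 : Tendsto (fun t : ℝ => -(levelIntegral (heatWeight q) x 1).toReal / Real.log t) atTop
      (𝓝 0) := Real.tendsto_log_atTop.const_div_atTop _
  refine h1.congr' ?_
  filter_upwards [eventually_gt_atTop 0] with t ht
  rw [hx.cesaro_heatCount hq ht]
  ring

lemma IsMarcinkiewiczFun.memLp_mean {x : ℝ → ℝ} (hx : IsMarcinkiewiczFun x) :
    MemLp (fun t => 1 / Real.log (1 + t) * ∫ s in (0 : ℝ)..t, x s) ∞ halfLine := by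
  obtain ⟨K, hK0, hK⟩ := hx.exists_bound
  refine memLp_top_of_bound ?_ K ?_
  · have h1 : Continuous fun t => ∫ s in (0 : ℝ)..t, x s :=
      intervalIntegral.continuous_primitive (fun a b => hx.intervalIntegrable a b) 0
    have h2 : Measurable fun t : ℝ => 1 / Real.log (1 + t) := by fun_prop
    exact (h2.mul h1.measurable).aestronglyMeasurable
  · filter_upwards [ae_restrict_mem measurableSet_Ioi] with t ht
    have hl := log_one_add_pos ht
    have ht0 : 0 ≤ t := le_of_lt ht
    rw [Real.norm_of_nonneg (mul_nonneg (by positivity) (hx.integral_nonneg ht0)),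
      one_div_mul_eq_div, div_le_iff₀ hl]
    exact hK t ht0

lemma IsMarcinkiewiczFun.tendsto_mean_sub {x : ℝ → ℝ} (hx : IsMarcinkiewiczFun x) :
    Tendsto (fun t => 1 / Real.log (1 + t) * (∫ s in (0 : ℝ)..t, x s)
      - (∫ s in (0 : ℝ)..t, x s) / Real.log t) atTop (𝓝 0) := by
  obtain ⟨K, hK0, hK⟩ := hx.exists_bound
  have h1 : Tendsto (fun t : ℝ => K * (Real.log (1 + t) / Real.log t - 1)) atTop (𝓝 0) := by
    simpa using (tendsto_log_one_add_div_log.sub_const 1).const_mul K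
  refine squeeze_zero_norm' ?_ h1
  filter_upwards [eventually_gt_atTop 1] with t ht
  have ht0 : 0 < t := by linarith
  have hl : 0 < Real.log t := Real.log_pos ht
  have hl1 := log_one_add_pos ht0
  have hle := log_le_log_one_add ht0
  have hΦ := hx.integral_nonneg ht0.le
  have hKt := hK t ht0.le
  set Φ := ∫ s in (0 : ℝ)..t, x s
  have e1 : 1 / Real.log (1 + t) * Φ - Φ / Real.log t
      = -(Φ / Real.log (1 + t) * (Real.log (1 + t) / Real.log t - 1)) := by
    field_simp
    ring
  have h2 : 0 ≤ Real.log (1 + t) / Real.log t - 1 := by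
    rw [sub_nonneg, one_le_div hl]
    exact hle
  rw [e1, norm_neg, Real.norm_of_nonneg (by positivity)]
  gcongr
  rwa [div_le_iff₀ hl1]

/-! ### The functionals on operators -/

lemma IsFNSTrace.trace_heatOp (hτ : IsFNSTrace N τ) (hq : 0 < q) {A : H →L[ℂ] H} (hAN : A ∈ N)
    (hA : 0 ≤ A) {t : ℝ} (ht : 0 < t) :
    τ (heatOp q A t) = heatCount q (singularValue N τ A) t := by
  have hf : Continuous fun u => heatFun q (t * u) := (continuous_heatFun hq).comp (by fun_prop)
  have h1 : heatOp q A t = cfc (fun u => heatFun q (t * u)) A := by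
    rw [heatOp]
    exact (cfc_comp_const_mul t (heatFun q) A (continuous_heatFun hq).continuousOn
      (IsSelfAdjoint.of_nonneg hA)).symm
  rw [h1, hτ.trace_eq_lintegral (cfc_mem_vonNeumannAlgebra hAN _)
    (cfc_nonneg fun u _ => heatFun_nonneg q _), heatCount]
  refine lintegral_congr fun u => ?_
  rw [hτ.singularValue_cfc hAN hA hf (fun u _ v _ h => heatFun_mono hq
    (mul_le_mul_of_nonneg_left h ht.le)) (by rw [mul_zero, heatFun_of_nonpos le_rfl])]

lemma cesaro_congr {x y : ℝ → ℝ} (h : ∀ s, 0 < s → x s = y s) {t : ℝ} (ht : 0 < t) :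
    cesaro x t = cesaro y t := by
  rw [cesaro, cesaro, intervalIntegral.integral_congr fun s hs => ?_]
  have hs0 : 0 < s := by
    rcases le_total 1 t with h1 | h1
    · rw [uIcc_of_le h1] at hs
      linarith [hs.1]
    · rw [uIcc_of_ge h1] at hs
      linarith [hs.1]
  rw [h s hs0]

lemma IsFNSTrace.heatTrace_eq (hτ : IsFNSTrace N τ) (hq : 0 < q) {A : H →L[ℂ] H} (hAN : A ∈ N)
    (hA : 0 ≤ A) {t : ℝ} (ht : 0 < t) :
    heatTrace τ q A t = 1 / t * (heatCount q (singularValue N τ A) t).toReal := by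
  rw [heatTrace, hτ.trace_heatOp hq hAN hA ht]

lemma IsFNSTrace.cesaro_heatTrace (hτ : IsFNSTrace N τ) (hq : 0 < q) {A : H →L[ℂ] H}
    (hAN : A ∈ N) (hA : 0 ≤ A) {t : ℝ} (ht : 0 < t) :
    cesaro (heatTrace τ q A) t
      = cesaro (fun s => 1 / s * (heatCount q (singularValue N τ A) s).toReal) t :=
  cesaro_congr (fun _ hs => hτ.heatTrace_eq hq hAN hA hs) ht

lemma IsFNSTrace.isWellDefinedAt (hτ : IsFNSTrace N τ) (hq : 0 < q) {A : H →L[ℂ] H}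
    (hAM : A ∈ marcinkiewicz N τ) (hA : 0 ≤ A) : IsWellDefinedAt N τ q A := by
  have hx := isMarcinkiewiczFun_singularValue hτ hAM
  have hAN : A ∈ N := hAM.1
  refine ⟨fun t ht => ?_, fun t ht => ?_, ?_, hx.memLp_mean⟩
  · rw [hτ.trace_heatOp hq hAN hA ht]
    exact (hx.heatCount_ne_top hq ht).lt_top
  · have h1 : IntervalIntegrable (fun s => 1 / s
        * (heatCount q (singularValue N τ A) s).toReal / s) volume 1 t :=
      (hx.intervalIntegrable_heatCount hq one_pos).symm.trans
        (hx.intervalIntegrable_heatCount hq ht)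
    refine h1.congr fun s hs => ?_
    have hs0 : 0 < s := by
      rcases mem_uIoc.1 hs with h | h
      · linarith [h.1]
      · linarith [h.1]
    rw [hτ.heatTrace_eq hq hAN hA hs0]
  · refine (hx.memLp_cesaro hq).ae_eq ?_
    filter_upwards [ae_restrict_mem measurableSet_Ioi] with t ht
    exact (hτ.cesaro_heatTrace hq hAN hA ht).symm

/-- A functional that is computed by a monotone expression on positive operators is
fully symmetric. -/
lemma isFullySymmetric_of_eq_extend {φ : (H →L[ℂ] H) → ℂ}
    (hφ : IsLinearFunctional N τ φ) {f : (H →L[ℂ] H) → ℝ} {c : ℝ} (hc : 0 ≤ c) (h0 : f 0 = 0)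
    (hmono : ∀ A ∈ marcinkiewicz N τ, ∀ B ∈ marcinkiewicz N τ, 0 ≤ A → 0 ≤ B →
      Majorized N τ B A → f B ≤ f A)
    (h : ∀ A ∈ marcinkiewicz N τ, φ A = c * extend f A) : IsFullySymmetric N τ φ := by
  refine ⟨hφ, fun A hA B hB hA0 hB0 hBA => ?_⟩
  rw [h A hA, h B hB, extend_of_nonneg h0 hA0, extend_of_nonneg h0 hB0]
  exact_mod_cast mul_le_mul_of_nonneg_left (hmono A hA B hB hA0 hB0 hBA) hc

lemma IsFNSTrace.evalAt_cesaro_mono (hτ : IsFNSTrace N τ) (hq : 0 < q) {ω : Linfty →ₗ[ℝ] ℝ}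
    (hω : IsGeneralisedLimit ω) {A B : H →L[ℂ] H} (hA : A ∈ marcinkiewicz N τ)
    (hB : B ∈ marcinkiewicz N τ) (hA0 : 0 ≤ A) (hB0 : 0 ≤ B) (hBA : Majorized N τ B A) :
    evalAt ω (cesaro (heatTrace τ q B)) ≤ evalAt ω (cesaro (heatTrace τ q A)) := by
  have hν := isLevelWeight_heatWeight hq
  have hxA := isMarcinkiewiczFun_singularValue hτ hA
  have hxB := isMarcinkiewiczFun_singularValue hτ hB
  refine evalAt_le_evalAt hω (hτ.isWellDefinedAt hq hB hB0).memLp_cesaro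
    (hτ.isWellDefinedAt hq hA hA0).memLp_cesaro fun ε hε => ?_
  filter_upwards [(hxA.tendsto_cesaro_sub hq).eventually_const_lt
      (show -(ε / 2) < 0 by linarith),
    (hxB.tendsto_cesaro_sub hq).eventually_lt_const (half_pos hε), eventually_gt_atTop 0,
    eventually_pos_log] with t h1 h2 ht hlog
  rw [hτ.cesaro_heatTrace hq hA.1 hA0 ht, hτ.cesaro_heatTrace hq hB.1 hB0 ht]
  have h3 : (levelIntegral (heatWeight q) (singularValue N τ B) t).toReal / Real.log t
      ≤ (levelIntegral (heatWeight q) (singularValue N τ A) t).toReal / Real.log t := by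
    have := ENNReal.toReal_mono (hν.levelIntegral_ne_top hxA ht)
      (hν.levelIntegral_mono_majorized hxB hxA hBA ht)
    gcongr
  linarith

lemma IsFNSTrace.evalAt_dixmierMean_mono (hτ : IsFNSTrace N τ) {ω : Linfty →ₗ[ℝ] ℝ}
    (hω : IsGeneralisedLimit ω) {A B : H →L[ℂ] H} (hA : A ∈ marcinkiewicz N τ)
    (hB : B ∈ marcinkiewicz N τ) (hBA : Majorized N τ B A) :
    evalAt ω (dixmierMean N τ B) ≤ evalAt ω (dixmierMean N τ A) := by
  refine evalAt_le_evalAt hω (isMarcinkiewiczFun_singularValue hτ hB).memLp_mean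
    (isMarcinkiewiczFun_singularValue hτ hA).memLp_mean fun ε hε => ?_
  filter_upwards [eventually_gt_atTop 0] with t ht
  have hl := log_one_add_pos ht
  have h1 := mul_le_mul_of_nonneg_left (hBA t ht.le) (one_div_pos.2 hl).le
  rw [dixmierMean, dixmierMean]
  linarith

lemma singularValue_zero (N : VonNeumannAlgebra H) (τ : (H →L[ℂ] H) → ℝ≥0∞) (hτ : IsFNSTrace N τ)
    (t : ℝ) : singularValue N τ 0 t = 0 :=
  le_antisymm (by simpa using hτ.singularValue_le_norm 0 t) (singularValue_nonneg N τ 0 t)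

lemma evalAt_zero_fun (ω : Linfty →ₗ[ℝ] ℝ) {x : ℝ → ℝ} (h : ∀ t, 0 < t → x t = 0) :
    evalAt ω x = 0 := by
  rw [evalAt]
  split_ifs with hx
  · have : hx.toLp = 0 := by
      rw [Lp.eq_zero_iff_ae_eq_zero]
      filter_upwards [hx.coeFn_toLp, ae_restrict_mem measurableSet_Ioi] with t h1 h2
      rw [h1, h t h2, Pi.zero_apply]
    rw [this, map_zero]
  · rfl

lemma IsFNSTrace.evalAt_cesaro_zero (hτ : IsFNSTrace N τ) (hq : 0 < q) (ω : Linfty →ₗ[ℝ] ℝ) :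
    evalAt ω (cesaro (heatTrace τ q (0 : H →L[ℂ] H))) = 0 := by
  refine evalAt_zero_fun ω fun t ht => ?_
  rw [hτ.cesaro_heatTrace hq N.zero_mem le_rfl ht]
  have h1 : ∀ s, heatCount q (singularValue N τ 0) s = 0 := fun s => by
    rw [heatCount]
    simp [singularValue_zero N τ hτ, heatFun_of_nonpos]
  simp [cesaro, h1]

lemma IsFNSTrace.evalAt_dixmierMean_zero (hτ : IsFNSTrace N τ) (ω : Linfty →ₗ[ℝ] ℝ) :
    evalAt ω (dixmierMean N τ (0 : H →L[ℂ] H)) = 0 := by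
  refine evalAt_zero_fun ω fun t ht => ?_
  simp [dixmierMean, singularValue_zero N τ hτ]

/-- Growth models of the singular value functions represent fully symmetric functionals. -/
lemma IsFullySymmetric.exists_eq_extend (hτ : IsFNSTrace N τ) {φ : (H →L[ℂ] H) → ℂ}
    (hφ : IsFullySymmetric N τ φ) {Λ : (ℝ → ℝ) → ℝ} (hΛ : IsSymmetricFunctional Λ)
    (hφΛ : ∀ A ∈ marcinkiewicz N τ, 0 ≤ A → φ A = Λ (singularValue N τ A))
    {G : (ℝ → ℝ) → ℝ → ℝ} {β : ℝ}
    (hG : 0 < Λ logDensity → IsGrowthModel IsMarcinkiewiczFun G Λ logDensity β)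
    {a : (H →L[ℂ] H) → ℝ → ℝ}
    (ha : ∀ A ∈ marcinkiewicz N τ, 0 ≤ A → MemLp (a A) ∞ halfLine ∧
      Tendsto (fun t => a A t - G (singularValue N τ A) t / Real.log t) atTop (𝓝 0)) :
    ∃ (ω : Linfty →ₗ[ℝ] ℝ) (c : ℝ), IsGeneralisedLimit ω ∧ IsDilationInvariant ω ∧ 0 ≤ c ∧
      ∀ A ∈ marcinkiewicz N τ, φ A = c * extend (fun A => evalAt ω (a A)) A := by
  -- In the degenerate case φ vanishes on the whole space, and any dilation invariant generalised
  -- limit works with c = 0.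
  rcases (hΛ.nonneg _ isMarcinkiewiczFun_logDensity).lt_or_eq with h0 | h0
  · obtain ⟨ω, h1, h2, h3⟩ := (hG h0).exists_generalisedLimit
    have hβ := (hG h0).rate_pos
    refine ⟨ω, Λ logDensity / β, h1, h2, by positivity, fun A hA =>
      hφ.toIsLinearFunctional.eq_extend hτ (fun A hA hA0 => ?_) hA⟩
    rw [hφΛ A hA hA0, h3 _ (isMarcinkiewiczFun_singularValue hτ hA) (a A) (ha A hA hA0).1
      (ha A hA hA0).2]
    push_cast
    ring
  · obtain ⟨ω, h1, h2⟩ := exists_isDilationInvariant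
    refine ⟨ω, 0, h1, h2, le_rfl, fun A hA =>
      hφ.toIsLinearFunctional.eq_extend hτ (fun A hA hA0 => ?_) hA⟩
    rw [hφΛ A hA hA0, hΛ.eq_zero h0.symm (isMarcinkiewiczFun_singularValue hτ hA)]
    simp

end HeatTrace

end HeatKernel

end

theorem mainTheorem3 {H : Type*} [NormedAddCommGroup H] [InnerProductSpace ℂ H] [CompleteSpace H]
    (N : VonNeumannAlgebra H) (τ : (H →L[ℂ] H) → ℝ≥0∞)
    (hτ : HeatKernel.IsFNSTrace N τ) (hinf : τ 1 = ∞)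
    (hN : HeatKernel.IsDiffuse N ∨ ∀ A : H →L[ℂ] H, A ∈ N)
    (q : ℝ) (hq : 0 < q) :
    (∀ A ∈ HeatKernel.marcinkiewicz N τ, 0 ≤ A → HeatKernel.IsWellDefinedAt N τ q A) ∧
    ∀ φ : (H →L[ℂ] H) → ℂ, HeatKernel.IsLinearFunctional N τ φ →
      (HeatKernel.IsFullySymmetric N τ φ ↔
        ∃ (ω : HeatKernel.Linfty →ₗ[ℝ] ℝ) (c : ℝ),
          HeatKernel.IsGeneralisedLimit ω ∧ HeatKernel.IsDilationInvariant ω ∧ 0 ≤ c ∧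
          ∀ A ∈ HeatKernel.marcinkiewicz N τ, φ A = c * HeatKernel.xi τ q ω A) ∧
      (HeatKernel.IsFullySymmetric N τ φ ↔
        ∃ (ω : HeatKernel.Linfty →ₗ[ℝ] ℝ) (c : ℝ),
          HeatKernel.IsGeneralisedLimit ω ∧ HeatKernel.IsDilationInvariant ω ∧ 0 ≤ c ∧
          ∀ A ∈ HeatKernel.marcinkiewicz N τ, φ A = c * HeatKernel.dixmierTrace N τ ω A) := by
  refine ⟨fun A hA hA0 => hτ.isWellDefinedAt hq hA hA0, fun φ hφ =>
    ⟨⟨fun h => ?_, ?_⟩, ⟨fun h => ?_, ?_⟩⟩⟩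
  · obtain ⟨α, p, hα, hp⟩ := hτ.exists_traceSequence hinf hN
    obtain ⟨Λ, hΛ, hφΛ⟩ := h.exists_symmetricFunctional hτ hα hp
    refine h.exists_eq_extend hτ hΛ hφΛ (fun h0 => hΛ.isGrowthModel_levelIntegral h0
      (HeatKernel.isLevelWeight_heatWeight hq)) fun A hA hA0 =>
      ⟨(hτ.isWellDefinedAt hq hA hA0).memLp_cesaro, ?_⟩
    refine ((HeatKernel.isMarcinkiewiczFun_singularValue hτ hA).tendsto_cesaro_sub hq).congr' ?_
    filter_upwards [eventually_gt_atTop 0] with t ht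
    rw [hτ.cesaro_heatTrace hq hA.1 hA0 ht]
  -- Linearity of φ is part of the assumptions, so only monotonicity under majorization of the
  -- expression on positive operators has to be supplied.
  · rintro ⟨ω, c, hω, -, hc, h⟩
    exact HeatKernel.isFullySymmetric_of_eq_extend hφ hc (hτ.evalAt_cesaro_zero hq ω)
      (fun A hA B hB hA0 hB0 hBA => hτ.evalAt_cesaro_mono hq hω hA hB hA0 hB0 hBA) h
  · obtain ⟨α, p, hα, hp⟩ := hτ.exists_traceSequence hinf hN
    obtain ⟨Λ, hΛ, hφΛ⟩ := h.exists_symmetricFunctional hτ hα hp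
    exact h.exists_eq_extend hτ hΛ hφΛ (fun h0 => hΛ.isGrowthModel_integral h0) fun A hA _ =>
      ⟨(HeatKernel.isMarcinkiewiczFun_singularValue hτ hA).memLp_mean,
        (HeatKernel.isMarcinkiewiczFun_singularValue hτ hA).tendsto_mean_sub⟩
  · rintro ⟨ω, c, hω, -, hc, h⟩
    exact HeatKernel.isFullySymmetric_of_eq_extend hφ hc (hτ.evalAt_dixmierMean_zero ω)
      (fun A hA B hB _ _ hBA => hτ.evalAt_dixmierMean_mono hω hA hB hBA) h
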